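/- Let $n\ge 3$ and $a\ge n$ be integers, let $\hbar,\varepsilon\in\mathbb{C}$ with $\hbar\neq 0$, and set $\kappa=-\dfrac{n\hbar+\varepsilon}{\hbar}$. **Completions.** For an associative $\mathbb{C}$-algebra $A$ graded by $\mathbb{Z}$, its standard degreewise completion is the algebra $A_{\mathrm{comp}}=\bigoplus_{d\in\mathbb{Z}}\varprojlim_{N}A_d/\sum_{r>N}A_{d-r}A_r$. **Evaluation elements.** Suppose that elements $e_{i,j}t^s$ ($1\le i,j\le a$, $s\in\mathbb{Z}$) of degree $s$ and $c$ of degree $0$ of a graded algebra $A$ are given. Put $h_0=e_{n,n}-e_{1,1}+c$, $x_0^+=e_{n,1}t$, $x_0^-=e_{1,n}t^{-1}$, and $h_i=e_{i,i}-e_{i+1,i+1}$, $x_i^+=e_{i,i+1}$, $x_i^-=e_{i+1,i}$ for $1\le i\le n-1$. Define in $A_{\mathrm{comp}}$ $$\begin{aligned} \mathrm{ev}(H_{0,1})&=\hbar c h_0-\hbar e_{n,n}(e_{1,1}-c)+\hbar\sum_{s\ge0}\sum_{k=1}^n e_{n,k}t^{-s}e_{k,n}t^{s}-\hbar\sum_{s\ge0}\sum_{k=1}^n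 e_{1,k}t^{-s-1}e_{k,1}t^{s+1},\\ \mathrm{ev}(X_{0,1}^+)&=\hbar c x_0^++\hbar\sum_{s\ge0}\sum_{k=1}^n e_{n,k}t^{-s}e_{k,1}t^{s+1},\qquad \mathrm{ev}(X_{0,1}^-)=\hbar c x_0^-+\hbar\sum_{s\ge0}\sum_{k=1}^n e_{1,k}t^{-s-1}e_{k,n}t^{s}, \end{aligned}$$ and, for $1\le i\le n-1$, with $Q_{p,q}=\sum_{s\ge0}\sum_{k=1}^{i}e_{p,k}t^{-s}e_{k,q}t^{s}+\sum_{s\ge0}\sum_{k=i+1}^{n}e_{p,k}t^{-s-1}e_{k,q}t^{s+1}$, $$\begin{aligned} \mathrm{ev}(H_{i,1})&=-\tfrac i2\hbar h_i-\hbar e_{i,i}e_{i+1,i+1}+\hbar Q_{i,i}-\hbar Q_{i+1,i+1},\\ \mathrm{ev}(X_{i,1}^+)&=-\tfrac i2\hbar x_i^++\hbar Q_{i,i+1},\qquad \mathrm{ev}(X_{i,1}^-)=-\tfrac i2\hbar x_i^-+\hbar Q_{i+1,i}. \end{aligned}$$ **The extended Yangian.** Let $(a_{ij})_{0\le i,j\le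 n-1}$ be the Cartan matrix of type $A^{(1)}_{n-1}$. Let $\widetilde Y$ be the associative algebra with generators $H_{i,r},X_{i,r}^\pm$ ($0\le i\le n-1$, $r=0,1$), $e_{i,j}t^s$ ($1\le i,j\le a$, $s\in\mathbb{Z}$), $c_a$, and the following relations, where $\tilde H_{i,1}=H_{i,1}-\frac\hbar2H_{i,0}^2$, $\eta=\varepsilon+\frac n2\hbar$, $\{u,v\}=uv+vu$, and "ordinary" means $(i,j)\ne(0,n-1),(n-1,0)$: $[H_{i,r},H_{j,s}]=0$; $[X^+_{i,0},X^-_{j,0}]=\delta_{ij}H_{i,0}$; $[X^+_{i,1},X^-_{j,0}]=\delta_{ij}H_{i,1}=[X^+_{i,0},X^-_{j,1}]$; $[H_{i,0},X^\pm_{j,r}]=\pm a_{ij}X^\pm_{j,r}$; $[\tilde H_{i,1},X^\pm_{j,0}]=\pm a_{ij}X^\pm_{j,1}$ for ordinary $(i,j)$; $[\tilde H_{0,1},X^\pm_{n-1,0}]=\mp(X^\pm_{n-1,1}-\eta X^\pm_{n-1,0})$; $[\tilde H_{n-1,1},X^\pm_{0,0}]=\mp(X^\pm_{0,1}+\eta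 X^\pm_{0,0})$; $[X^\pm_{i,1},X^\pm_{j,0}]-[X^\pm_{i,0},X^\pm_{j,1}]=\pm a_{ij}\frac\hbar2\{X^\pm_{i,0},X^\pm_{j,0}\}$ for ordinary $(i,j)$; $[X^\pm_{0,1},X^\pm_{n-1,0}]-[X^\pm_{0,0},X^\pm_{n-1,1}]=\mp\frac\hbar2\{X^\pm_{0,0},X^\pm_{n-1,0}\}-\eta[X^\pm_{0,0},X^\pm_{n-1,0}]$; $(\mathrm{ad}\,X^\pm_{i,0})^{1-a_{ij}}(X^\pm_{j,0})=0$ for $i\ne j$; $[e_{p,q}t^s,e_{i,j}t^u]=\delta_{i,q}e_{p,j}t^{s+u}-\delta_{p,j}e_{i,q}t^{s+u}+s\delta_{s+u,0}(\delta_{i,q}\delta_{p,j}c_a+\delta_{p,q}\delta_{i,j})$; $c_a$ is central; $H_{i,0}=h_i$ and $X^\pm_{i,0}=x^\pm_i$ (with $c=c_a$). Grade $\widetilde Y$ by $\deg H_{i,r}=0$, $\deg X^\pm_{i,r}=\pm\delta_{i,0}$, $\deg e_{i,j}t^s=s$, $\deg c_a=0$, and let $\widehat Y$ be its degreewise completion.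 The extended Yangian $Y^a_{\hbar,\varepsilon}(\widehat{\mathfrak{sl}}(n))$ is the quotient of $\widehat Y$ by the following relations, for all $n<v\le a$ and $w\in\mathbb{Z}$, where $u_{v,j}$ stands for either of $e_{v,j}t^w$, $e_{j,v}t^w$ (the same one on both sides) and $\mathrm{ev}(H_{i,1})\in\widehat Y$ is formed with $c=c_a$. To the node $i\ne0$ belong the positions $i,i+1$, and to the node $0$ the positions $n,1$. * $[H_{i,1},u_{v,j}]=[\mathrm{ev}(H_{i,1}),u_{v,j}]$ for $0\le i\le n-1$ and every $1\le j\le n$ not belonging to $i$; * $[H_{i',1}+H_{i,1},u_{v,j}]=[\mathrm{ev}(H_{i',1})+\mathrm{ev}(H_{i,1}),u_{v,j}]$ for $0\le i\le n-1$ and $i'\equiv i-1 \pmod n$, where $j$ is the position common to $i'$ and $i$ (that is, $j=i$ if $i\ne0$ and $j=n$ if $i=0$). **Target.** Let $\widehat{\mathfrak{gl}}(a)$ be the Lie algebra with basis $e_{i,j}t^s$ ($1\le i,j\le a$, $s\in\mathbb{Z}$), $c$, $z$, with $c,z$ central and $[e_{p,q}t^s,e_{i,j}t^u]=\delta_{i,q}e_{p,j}t^{s+u}-\delta_{p,j}e_{i,q}t^{s+u}+s\delta_{s+u,0}(\delta_{i,q}\delta_{p,j}c+\delta_{p,q}\delta_{i,j}z)$.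 Let $U=U(\widehat{\mathfrak{gl}}(a))/(z-1,\,c-\kappa)$, graded by $\deg e_{i,j}t^s=s$, and let $U_{\mathrm{comp}}$ be its degreewise completion. **Theorem.** For every $x\in\mathbb{C}$ there is exactly one algebra homomorphism $\widetilde{\mathrm{ev}}^x\colon Y^a_{\hbar,\varepsilon}(\widehat{\mathfrak{sl}}(n))\to U_{\mathrm{comp}}$ whose composite with $\widehat Y\to Y^a_{\hbar,\varepsilon}(\widehat{\mathfrak{sl}}(n))$ preserves degrees and is continuous in each degree for the inverse limit topologies, and such that, for all indices, $$\widetilde{\mathrm{ev}}^x(e_{i,j}t^s)=e_{i,j}t^s,\quad \widetilde{\mathrm{ev}}^x(c_a)=\kappa,\quad \widetilde{\mathrm{ev}}^x(H_{i,1})=\mathrm{ev}(H_{i,1})+x h_i,\quad \widetilde{\mathrm{ev}}^x(X^\pm_{i,1})=\mathrm{ev}(X^\pm_{i,1})+x x^\pm_i .$$ -/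

import Mathlib

noncomputable section

namespace ExtendedYangian

/-! ### The affine Lie algebra of `gl(a)` with two central elements -/

section AffineLie

open scoped TensorProduct

attribute [local instance 100] LieRing.ofAssociativeRing

/-- The loop algebra `gl(a)[t, t⁻¹]`. -/
abbrev LoopGl (a : ℕ) : Type := LieAlgebra.loopAlgebra ℂ ℤ (Matrix (Fin a) (Fin a) ℂ)

/-- The invariant form `(X, Y) ↦ tr(XY)` on `gl(a)`. -/
def trForm (a : ℕ) : LinearMap.BilinForm ℂ (Matrix (Fin a) (Fin a) ℂ) :=
  LinearMap.mk₂ ℂ (fun X Y => (X * Y).trace)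
    (fun X X' Y => by simp [add_mul]) (fun r X Y => by simp)
    (fun X Y Y' => by simp [mul_add]) (fun r X Y => by simp)

/-- The invariant form `(X, Y) ↦ tr(X) tr(Y)` on `gl(a)`. -/
def trTrForm (a : ℕ) : LinearMap.BilinForm ℂ (Matrix (Fin a) (Fin a) ℂ) :=
  LinearMap.mk₂ ℂ (fun X Y => X.trace * Y.trace)
    (fun X X' Y => by simp [add_mul]) (fun r X Y => by simp [mul_assoc])
    (fun X Y Y' => by simp [mul_add]) (fun r X Y => by simp [mul_left_comm])

theorem trForm_isSymm (a : ℕ) : (trForm a).IsSymm :=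
  ⟨fun X Y => by simp [trForm, Matrix.trace_mul_comm X Y]⟩

theorem trTrForm_isSymm (a : ℕ) : (trTrForm a).IsSymm :=
  ⟨fun X Y => by simp [trTrForm, mul_comm]⟩

theorem trForm_invariant (a : ℕ) :
    (trForm a).lieInvariant (Matrix (Fin a) (Fin a) ℂ) := by
  intro X Y Z
  simp only [trForm, LinearMap.mk₂_apply, Ring.lie_def, sub_mul, mul_sub, Matrix.trace_sub,
    ← mul_assoc]
  rw [Matrix.trace_mul_comm (Y * Z) X, ← mul_assoc]
  ring

theorem trTrForm_invariant (a : ℕ) :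
    (trTrForm a).lieInvariant (Matrix (Fin a) (Fin a) ℂ) := by
  intro X Y Z
  simp [trTrForm, Ring.lie_def, Matrix.trace_mul_comm X]

/-- The pairing `(X t^s, Y t^u) ↦ s δ_{s+u,0} Φ(X, Y)` on the loop algebra. -/
def loopPairing (a : ℕ) (Φ : LinearMap.BilinForm ℂ (Matrix (Fin a) (Fin a) ℂ)) :
    LinearMap.BilinForm ℂ (LoopGl a) :=
  (LieAlgebra.LoopAlgebra.residuePairing ℂ ℤ (Matrix (Fin a) (Fin a) ℂ) Φ).flip

theorem loopPairing_self {a : ℕ} {Φ : LinearMap.BilinForm ℂ (Matrix (Fin a) (Fin a) ℂ)}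
    (hs : Φ.IsSymm) (f : LoopGl a) : loopPairing a Φ f f = 0 := by
  have h := LieModule.Cohomology.mem_twoCochain_iff.mp
    (LieAlgebra.LoopAlgebra.twoCochainOfBilinear ℂ ℤ (Matrix (Fin a) (Fin a) ℂ) Φ hs).2 f
  exact h

theorem loopPairing_jacobi {a : ℕ} {Φ : LinearMap.BilinForm ℂ (Matrix (Fin a) (Fin a) ℂ)}
    (hs : Φ.IsSymm) (hi : Φ.lieInvariant (Matrix (Fin a) (Fin a) ℂ)) (f g h : LoopGl a) :
    loopPairing a Φ f ⁅g, h⁆ = loopPairing a Φ ⁅f, g⁆ h + loopPairing a Φ g ⁅f, h⁆ := by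
  have skew : ∀ x y : LoopGl a, loopPairing a Φ x y = - loopPairing a Φ y x := by
    intro x y
    have := loopPairing_self hs (x + y)
    simp only [map_add, LinearMap.add_apply, loopPairing_self hs] at this
    linear_combination this
  have H := (LieModule.Cohomology.mem_twoCocycle_iff_of_trivial ℂ (LoopGl a) _ _).mp
    (LieAlgebra.LoopAlgebra.twoCocycleOfBilinear ℂ ℤ (Matrix (Fin a) (Fin a) ℂ) Φ hi hs).2 f g h
  have H' : loopPairing a Φ ⁅g, h⁆ f = loopPairing a Φ h ⁅f, g⁆ + loopPairing a Φ ⁅f, h⁆ g := H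
  rw [skew f, skew _ h, skew g, H']
  ring

/-- The underlying space `gl(a)[t, t⁻¹] ⊕ ℂ c ⊕ ℂ z` of the affine Lie algebra. -/
@[ext]
structure AffineGl (a : ℕ) where
  loop : LoopGl a
  coeffC : ℂ
  coeffZ : ℂ

namespace AffineGl

variable {a : ℕ}

/-- The identification with a product, used to transport the vector space structure. -/
def equivProd (a : ℕ) : AffineGl a ≃ LoopGl a × ℂ × ℂ where
  toFun x := (x.loop, x.coeffC, x.coeffZ)
  invFun p := ⟨p.1, p.2.1, p.2.2⟩
  left_inv _ := rfl
  right_inv _ := rfl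

instance : AddCommGroup (AffineGl a) := (equivProd a).addCommGroup
instance : Module ℂ (AffineGl a) := (equivProd a).module ℂ

@[simp] theorem add_loop (x y : AffineGl a) : (x + y).loop = x.loop + y.loop := rfl
@[simp] theorem add_coeffC (x y : AffineGl a) : (x + y).coeffC = x.coeffC + y.coeffC := rfl
@[simp] theorem add_coeffZ (x y : AffineGl a) : (x + y).coeffZ = x.coeffZ + y.coeffZ := rfl
@[simp] theorem sub_loop (x y : AffineGl a) : (x - y).loop = x.loop - y.loop := rfl
@[simp] theorem sub_coeffC (x y : AffineGl a) : (x - y).coeffC = x.coeffC - y.coeffC := rfl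
@[simp] theorem sub_coeffZ (x y : AffineGl a) : (x - y).coeffZ = x.coeffZ - y.coeffZ := rfl
@[simp] theorem zero_loop : (0 : AffineGl a).loop = 0 := rfl
@[simp] theorem zero_coeffC : (0 : AffineGl a).coeffC = 0 := rfl
@[simp] theorem zero_coeffZ : (0 : AffineGl a).coeffZ = 0 := rfl
@[simp] theorem smul_loop (r : ℂ) (x : AffineGl a) : (r • x).loop = r • x.loop := rfl
@[simp] theorem smul_coeffC (r : ℂ) (x : AffineGl a) : (r • x).coeffC = r * x.coeffC := rfl
@[simp] theorem smul_coeffZ (r : ℂ) (x : AffineGl a) : (r • x).coeffZ = r * x.coeffZ := rfl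

instance : Bracket (AffineGl a) (AffineGl a) where
  bracket x y :=
    ⟨⁅x.loop, y.loop⁆, loopPairing a (trForm a) x.loop y.loop,
      loopPairing a (trTrForm a) x.loop y.loop⟩

@[simp] theorem lie_loop (x y : AffineGl a) : ⁅x, y⁆.loop = ⁅x.loop, y.loop⁆ := rfl
@[simp] theorem lie_coeffC (x y : AffineGl a) :
    ⁅x, y⁆.coeffC = loopPairing a (trForm a) x.loop y.loop := rfl
@[simp] theorem lie_coeffZ (x y : AffineGl a) :
    ⁅x, y⁆.coeffZ = loopPairing a (trTrForm a) x.loop y.loop := rfl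

instance : LieRing (AffineGl a) where
  add_lie x y w := by
    ext1
    · exact add_lie (L := LoopGl a) (M := LoopGl a) x.loop y.loop w.loop
    · simp
    · simp
  lie_add x y w := by
    ext1
    · exact lie_add (L := LoopGl a) (M := LoopGl a) x.loop y.loop w.loop
    · simp
    · simp
  lie_self x := by
    ext1
    · exact lie_self (L := LoopGl a) x.loop
    · simp [loopPairing_self (trForm_isSymm a)]
    · simp [loopPairing_self (trTrForm_isSymm a)]
  leibniz_lie x y w := by
    ext1
    · exact LieRing.leibniz_lie (L := LoopGl a) x.loop y.loop w.loop
    · simpa using loopPairing_jacobi (trForm_isSymm a) (trForm_invariant a) x.loop y.loop w.loop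
    · simpa using
        loopPairing_jacobi (trTrForm_isSymm a) (trTrForm_invariant a) x.loop y.loop w.loop

instance : LieAlgebra ℂ (AffineGl a) where
  lie_smul r x y := by
    ext1
    · exact lie_smul (L := LoopGl a) (M := LoopGl a) r x.loop y.loop
    · simp
    · simp

/-- The element `E_{i,j} t^s`. -/
def E (i j : Fin a) (s : ℤ) : AffineGl a :=
  ⟨AddMonoidAlgebra.single s 1 ⊗ₜ[ℂ] Matrix.single i j 1, 0, 0⟩

/-- The central element `c`. -/
def c (a : ℕ) : AffineGl a := ⟨0, 1, 0⟩

/-- The central element `z`. -/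
def z (a : ℕ) : AffineGl a := ⟨0, 0, 1⟩

theorem c_lie (x : AffineGl a) : ⁅c a, x⁆ = 0 := by
  ext1
  · exact zero_lie (L := LoopGl a) (M := LoopGl a) x.loop
  · simp [c]
  · simp [c]

theorem z_lie (x : AffineGl a) : ⁅z a, x⁆ = 0 := by
  ext1
  · exact zero_lie (L := LoopGl a) (M := LoopGl a) x.loop
  · simp [z]
  · simp [z]

theorem loopPairing_single (Φ : LinearMap.BilinForm ℂ (Matrix (Fin a) (Fin a) ℂ))
    (X Y : Matrix (Fin a) (Fin a) ℂ) (s u : ℤ) :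
    loopPairing a Φ (AddMonoidAlgebra.single s 1 ⊗ₜ[ℂ] X) (AddMonoidAlgebra.single u 1 ⊗ₜ[ℂ] Y)
      = if s + u = 0 then (s : ℂ) * Φ Y X else 0 := by
  have h := LieAlgebra.LoopAlgebra.toFinsupp_single_tmul ℂ ℤ (Matrix (Fin a) (Fin a) ℂ)
  change Finsupp.sum (LieAlgebra.LoopAlgebra.toFinsupp ℂ ℤ (Matrix (Fin a) (Fin a) ℂ)
    (AddMonoidAlgebra.single s 1 ⊗ₜ[ℂ] X)) (fun b v => b • Φ (LieAlgebra.LoopAlgebra.toFinsupp ℂ ℤ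
      (Matrix (Fin a) (Fin a) ℂ) (AddMonoidAlgebra.single u 1 ⊗ₜ[ℂ] Y) (-b)) v) = _
  rw [h, h, Finsupp.sum_single_index (by simp)]
  by_cases hsu : s + u = 0
  · have : u = -s := by omega
    subst this
    simp
  · have : u ≠ -s := by omega
    simp [hsu, this]

theorem loop_bracket (X Y : Matrix (Fin a) (Fin a) ℂ) (s u : ℤ) :
    ⁅(AddMonoidAlgebra.single s 1 ⊗ₜ[ℂ] X : LoopGl a),
      (AddMonoidAlgebra.single u 1 ⊗ₜ[ℂ] Y : LoopGl a)⁆ =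
      AddMonoidAlgebra.single (s + u) 1 ⊗ₜ[ℂ] (X * Y - Y * X) := by
  refine (LieAlgebra.ExtendScalars.bracket_tmul ..).trans ?_
  rw [AddMonoidAlgebra.single_mul_single, mul_one, Ring.lie_def]

/-- The defining commutation relations of the affine Lie algebra. -/
theorem E_lie_E (p q i j : Fin a) (s u : ℤ) :
    ⁅E p q s, E i j u⁆ =
      (if i = q then E p j (s + u) else 0) - (if p = j then E i q (s + u) else 0)
      + (if i = q ∧ p = j ∧ s + u = 0 then (s : ℂ) • c a else 0)
      + (if p = q ∧ i = j ∧ s + u = 0 then (s : ℂ) • z a else 0) := by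
  have hmul : ∀ k l m r : Fin a, Matrix.single k l (1 : ℂ) * Matrix.single m r 1 =
      if m = l then Matrix.single k r 1 else 0 := by
    intro k l m r
    by_cases h : m = l
    · subst h; simp
    · rw [if_neg h]; exact Matrix.single_mul_single_of_ne (c := (1 : ℂ)) _ _ _ (Ne.symm h) 1
  ext1
  · refine (loop_bracket _ _ s u).trans ?_
    rw [hmul, hmul, TensorProduct.tmul_sub]
    have hC : (if i = q ∧ p = j ∧ s + u = 0 then (s : ℂ) • c a else 0 : AffineGl a).loop = 0 := by
      split_ifs <;> simp [c]
    have hZ : (if p = q ∧ i = j ∧ s + u = 0 then (s : ℂ) • z a else 0 : AffineGl a).loop = 0 := by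
      split_ifs <;> simp [z]
    rw [add_loop, add_loop, sub_loop, hC, hZ, add_zero, add_zero]
    congr 1
    · split_ifs <;> simp [E]
    · split_ifs <;> simp [E]
  · refine (loopPairing_single (trForm a) _ _ s u).trans ?_
    rw [add_coeffC, add_coeffC, sub_coeffC]
    simp only [trForm, LinearMap.mk₂_apply, hmul]
    by_cases h1 : i = q <;> by_cases h2 : p = j <;> by_cases h3 : s + u = 0 <;>
      simp [h1, h2, h3, E, c, z, apply_ite coeffC]
  · refine (loopPairing_single (trTrForm a) _ _ s u).trans ?_
    rw [add_coeffZ, add_coeffZ, sub_coeffZ]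
    simp only [trTrForm, LinearMap.mk₂_apply]
    by_cases h1 : i = j <;> by_cases h2 : p = q <;> by_cases h3 : s + u = 0 <;>
      simp [h1, h2, h3, E, c, z, apply_ite coeffZ]

end AffineGl
end AffineLie

/-! ### Graded algebras and their degreewise completions -/

section Grading

variable {A : Type*} [Ring A] [Algebra ℂ A] {X : Type*}

/-- The degree `d` part of the algebra generated by the elements `ι g`, `g : X`, when the generator
`ι g` is given the degree `deg g`: the span of all monomials in the generators of degree `d`. -/
def degreePart (ι : X → A) (deg : X → ℤ) (d : ℤ) : Submodule ℂ A :=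
  Submodule.span ℂ {y | ∃ l : List X, (l.map deg).sum = d ∧ (l.map ι).prod = y}

theorem mem_degreePart (ι : X → A) (deg : X → ℤ) (g : X) : ι g ∈ degreePart ι deg (deg g) :=
  Submodule.subset_span ⟨[g], by simp, by simp⟩

instance (ι : X → A) (deg : X → ℤ) : SetLike.GradedMonoid (degreePart ι deg) where
  one_mem := Submodule.subset_span ⟨[], by simp, by simp⟩
  mul_mem i j x y hx hy := by
    have h : x * y ∈ degreePart ι deg i * degreePart ι deg j := Submodule.mul_mem_mul hx hy
    rw [degreePart, degreePart, Submodule.span_mul_span] at h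
    refine Submodule.span_mono ?_ h
    rintro _ ⟨_, ⟨l, hl, rfl⟩, _, ⟨m, hm, rfl⟩, rfl⟩
    exact ⟨l ++ m, by simp [hl, hm], by simp⟩

end Grading

section Completion

variable {A : Type*} [Ring A] [Algebra ℂ A] (𝒜 : ℤ → Submodule ℂ A)

/-- The subspace `∑_{r > N} A_{d-r} A_r` of `A_d`. -/
def tail (N : ℕ) (d : ℤ) : Submodule ℂ A :=
  ⨆ (r : ℤ) (_ : (N : ℤ) < r), 𝒜 (d - r) * 𝒜 r

theorem mul_mem_tail {N : ℕ} {d r : ℤ} (hr : (N : ℤ) < r) {x y : A} (hx : x ∈ 𝒜 (d - r))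
    (hy : y ∈ 𝒜 r) : x * y ∈ tail 𝒜 N d :=
  Submodule.mem_iSup_of_mem r (Submodule.mem_iSup_of_mem hr (Submodule.mul_mem_mul hx hy))

theorem tail_induction {N : ℕ} {d : ℤ} {p : A → Prop}
    (hmul : ∀ r : ℤ, (N : ℤ) < r → ∀ x ∈ 𝒜 (d - r), ∀ y ∈ 𝒜 r, p (x * y))
    (hadd : ∀ x y, p x → p y → p (x + y)) (h0 : p 0) {x : A} (hx : x ∈ tail 𝒜 N d) : p x := by
  refine Submodule.iSup_induction _ (motive := p) hx (fun r y hy => ?_) h0 hadd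
  refine Submodule.iSup_induction _ (motive := p) hy (fun hr z hz => ?_) h0 hadd
  exact Submodule.mul_induction_on hz (hmul r hr) hadd

theorem tail_anti {M N : ℕ} (h : M ≤ N) (d : ℤ) : tail 𝒜 N d ≤ tail 𝒜 M d := fun _ hx =>
  tail_induction 𝒜 (p := fun y => y ∈ tail 𝒜 M d)
    (fun _ hr _ hu _ hv => mul_mem_tail 𝒜 (by omega) hu hv)
    (fun _ _ => add_mem) (zero_mem _) hx

theorem mul_tail [SetLike.GradedMonoid 𝒜] {N : ℕ} {d e : ℤ} {x y : A} (hx : x ∈ 𝒜 d)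
    (hy : y ∈ tail 𝒜 N e) : x * y ∈ tail 𝒜 N (d + e) := by
  refine tail_induction 𝒜 (p := fun y => x * y ∈ tail 𝒜 N (d + e)) (fun r hr u hu v hv => ?_)
    (fun u v hu hv => ?_) (by simp) hy
  · rw [← mul_assoc]
    refine mul_mem_tail 𝒜 hr ?_ hv
    rw [add_sub_assoc]
    exact SetLike.mul_mem_graded hx hu
  · rw [mul_add]; exact add_mem hu hv

theorem tail_mul [SetLike.GradedMonoid 𝒜] {K N : ℕ} {d e : ℤ} (hK : (N : ℤ) ≤ K + e) {x y : A}
    (hx : x ∈ tail 𝒜 K d) (hy : y ∈ 𝒜 e) : x * y ∈ tail 𝒜 N (d + e) := by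
  refine tail_induction 𝒜 (p := fun x => x * y ∈ tail 𝒜 N (d + e)) (fun r hr u hu v hv => ?_)
    (fun u v hu hv => ?_) (by simp) hx
  · rw [mul_assoc]
    refine mul_mem_tail 𝒜 (r := r + e) (by omega) ?_ (SetLike.mul_mem_graded hv hy)
    rwa [add_sub_add_right_eq_sub]
  · rw [add_mul]; exact add_mem hu hv

/-- The compatible families of classes modulo `∑_{r > N} A_{d-r} A_r`: those such that, for every
`N`, the members up to `N` are the classes of one element of `A_d`. -/
def compatibleFamilies (d : ℤ) : Submodule ℂ (∀ N : ℕ, A ⧸ tail 𝒜 N d) where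
  carrier := {f | ∀ N, ∃ x ∈ 𝒜 d, ∀ M ≤ N, f M = Submodule.Quotient.mk x}
  add_mem' {f g} hf hg N := by
    obtain ⟨x, hx, hfx⟩ := hf N
    obtain ⟨y, hy, hgy⟩ := hg N
    exact ⟨x + y, add_mem hx hy, fun M hM => by
      rw [Pi.add_apply, hfx M hM, hgy M hM, Submodule.Quotient.mk_add]⟩
  zero_mem' N := ⟨0, zero_mem _, fun M _ => by simp⟩
  smul_mem' c f hf N := by
    obtain ⟨x, hx, hfx⟩ := hf N
    exact ⟨c • x, Submodule.smul_mem _ c hx, fun M hM => by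
      rw [Pi.smul_apply, hfx M hM, Submodule.Quotient.mk_smul]⟩

/-- The degree `d` part `lim_N A_d / ∑_{r > N} A_{d-r} A_r` of the completion. -/
def completionPart (d : ℤ) : Type _ := compatibleFamilies 𝒜 d

instance (d : ℤ) : AddCommGroup (completionPart 𝒜 d) :=
  inferInstanceAs (AddCommGroup (compatibleFamilies 𝒜 d))

instance (d : ℤ) : Module ℂ (completionPart 𝒜 d) :=
  inferInstanceAs (Module ℂ (compatibleFamilies 𝒜 d))

namespace completionPart

variable {𝒜}

theorem exists_rep {d : ℤ} (f : completionPart 𝒜 d) (N : ℕ) :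
    ∃ x ∈ 𝒜 d, ∀ M ≤ N, f.1 M = Submodule.Quotient.mk x := f.2 N

/-- A representative in `A_d` of the class at level `N`. -/
def rep {d : ℤ} (f : completionPart 𝒜 d) (N : ℕ) : A := (exists_rep f N).choose

theorem rep_mem {d : ℤ} (f : completionPart 𝒜 d) (N : ℕ) : rep f N ∈ 𝒜 d :=
  (exists_rep f N).choose_spec.1

theorem mk_rep {d : ℤ} (f : completionPart 𝒜 d) {M N : ℕ} (h : M ≤ N) :
    f.1 M = Submodule.Quotient.mk (rep f N) :=
  (exists_rep f N).choose_spec.2 M h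

/-- The class of an element of `A_d`. -/
def of {d : ℤ} (x : A) (hx : x ∈ 𝒜 d) : completionPart 𝒜 d :=
  ⟨fun _ => Submodule.Quotient.mk x, fun _ => ⟨x, hx, fun _ _ => rfl⟩⟩

/-- The sum `∑_{s ≥ 0} y s` of a series whose term `y s` lies in `A_{d-r} A_r` for some `r ≥ s`. -/
def series {d : ℤ} (y : ℕ → A) (hd : ∀ s, y s ∈ 𝒜 d)
    (hy : ∀ s : ℕ, ∃ r : ℤ, (s : ℤ) ≤ r ∧ y s ∈ 𝒜 (d - r) * 𝒜 r) : completionPart 𝒜 d :=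
  ⟨fun N => Submodule.Quotient.mk (∑ s ∈ Finset.range (N + 1), y s), fun N =>
    ⟨∑ s ∈ Finset.range (N + 1), y s, sum_mem fun s _ => hd s, fun M hM => by
      rw [eq_comm, Submodule.Quotient.eq, ← Finset.sum_range_add_sum_Ico y (Nat.succ_le_succ hM),
        add_sub_cancel_left]
      refine sum_mem fun s hs => ?_
      obtain ⟨r, hr, hmem⟩ := hy s
      have hs' := (Finset.mem_Ico.mp hs).1
      have hr' : (M : ℤ) < r := by omega
      exact (le_iSup₂_of_le (f := fun (r : ℤ) (_ : (M : ℤ) < r) => 𝒜 (d - r) * 𝒜 r)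
        r hr' le_rfl) hmem⟩⟩

theorem of_apply {d : ℤ} (x : A) (hx : x ∈ 𝒜 d) (N : ℕ) :
    (of x hx).1 N = Submodule.Quotient.mk x := rfl

/-- Two elements of possibly differently written degrees agree when they have common
representatives. -/
theorem mk_eq {d e : ℤ} (h : d = e) (f : completionPart 𝒜 d) (g : completionPart 𝒜 e)
    (H : ∀ N, ∃ x : A, f.1 N = Submodule.Quotient.mk x ∧ g.1 N = Submodule.Quotient.mk x) :
    (⟨d, f⟩ : GradedMonoid fun d => completionPart 𝒜 d) = ⟨e, g⟩ := by
  subst h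
  congr 1
  apply Subtype.ext
  funext N
  obtain ⟨x, h1, h2⟩ := H N
  rw [h1, h2]

variable [SetLike.GradedMonoid 𝒜]

/-- The product of two compatible families: at level `N` it is the class of `x y`, where `y`
represents the right factor at level `N` and `x` the left factor at level `N - deg y`. -/
def mul {d e : ℤ} (f : completionPart 𝒜 d) (g : completionPart 𝒜 e) : completionPart 𝒜 (d + e) :=
  ⟨fun N => Submodule.Quotient.mk (rep f (N - e).toNat * rep g N), fun N => by
    refine ⟨rep f ((N - e).toNat) * rep g N,
      SetLike.mul_mem_graded (rep_mem f _) (rep_mem g _), fun M hM => ?_⟩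
    have hle : (M - e).toNat ≤ (N - e).toNat := by omega
    have h1 : rep f (M - e).toNat - rep f (N - e).toNat ∈ tail 𝒜 (M - e).toNat d :=
      (Submodule.Quotient.eq _).mp ((mk_rep f le_rfl).symm.trans (mk_rep f hle))
    have h2 : rep g M - rep g N ∈ tail 𝒜 M e :=
      (Submodule.Quotient.eq _).mp ((mk_rep g le_rfl).symm.trans (mk_rep g hM))
    rw [Submodule.Quotient.eq]
    have := add_mem (tail_mul 𝒜 (N := M) (by omega) h1 (rep_mem g M))
      (mul_tail 𝒜 (rep_mem f (N - e).toNat) h2)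
    convert this using 1
    noncomm_ring⟩

/-- The product may be computed on arbitrary representatives. -/
theorem mul_apply {d e : ℤ} (f : completionPart 𝒜 d) (g : completionPart 𝒜 e) {N K : ℕ}
    (hK : (N : ℤ) ≤ K + e) {x y : A} (hx : x ∈ 𝒜 d) (_hy : y ∈ 𝒜 e)
    (hfx : f.1 K = Submodule.Quotient.mk x) (hgy : g.1 N = Submodule.Quotient.mk y) :
    (mul f g).1 N = Submodule.Quotient.mk (x * y) := by
  have hle : (N - e).toNat ≤ K := by omega
  have h0 : rep f K - x ∈ tail 𝒜 K d :=
    (Submodule.Quotient.eq _).mp ((mk_rep f le_rfl).symm.trans hfx)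
  have h1 : rep f (N - e).toNat - rep f K ∈ tail 𝒜 (N - e).toNat d :=
    (Submodule.Quotient.eq _).mp ((mk_rep f le_rfl).symm.trans (mk_rep f hle))
  have h1' : rep f (N - e).toNat - x ∈ tail 𝒜 (N - e).toNat d := by
    simpa using add_mem h1 (tail_anti 𝒜 hle d h0)
  have h2 : rep g N - y ∈ tail 𝒜 N e :=
    (Submodule.Quotient.eq _).mp ((mk_rep g le_rfl).symm.trans hgy)
  change Submodule.Quotient.mk (rep f (N - e).toNat * rep g N) = _
  rw [Submodule.Quotient.eq]
  have := add_mem (tail_mul 𝒜 (N := N) (by omega) h1' (rep_mem g N)) (mul_tail 𝒜 hx h2)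
  convert this using 1
  noncomm_ring

theorem mul_apply_rep {d e : ℤ} (f : completionPart 𝒜 d) (g : completionPart 𝒜 e) {N K L : ℕ}
    (hK : (N : ℤ) ≤ K + e) (hL : N ≤ L) :
    (mul f g).1 N = Submodule.Quotient.mk (rep f K * rep g L) :=
  mul_apply f g hK (rep_mem f K) (rep_mem g L) (mk_rep f le_rfl) (mk_rep g hL)

instance : GradedMonoid.GMul fun d => completionPart 𝒜 d := ⟨mul⟩

instance : GradedMonoid.GOne fun d => completionPart 𝒜 d := ⟨of 1 SetLike.GradedOne.one_mem⟩

instance : DirectSum.GRing fun d => completionPart 𝒜 d where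
  mul_zero {d e} f := by
    apply Subtype.ext; funext N
    refine (mul_apply f 0 (K := (N - e).toNat) (by omega) (rep_mem f _) (zero_mem _)
      (mk_rep f le_rfl) rfl).trans ?_
    rw [mul_zero]; rfl
  zero_mul {d e} g := by
    apply Subtype.ext; funext N
    refine (mul_apply 0 g (K := (N - e).toNat) (by omega) (zero_mem _) (rep_mem g N)
      rfl (mk_rep g le_rfl)).trans ?_
    rw [zero_mul]; rfl
  mul_add {d e} f g h := by
    apply Subtype.ext; funext N
    refine (mul_apply f (g + h) (K := (N - e).toNat) (by omega) (rep_mem f _)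
      (add_mem (rep_mem g N) (rep_mem h N)) (mk_rep f le_rfl)
      (congrArg₂ (· + ·) (mk_rep g le_rfl) (mk_rep h le_rfl))).trans ?_
    rw [mul_add, Submodule.Quotient.mk_add]
    exact (congrArg₂ (· + ·) (mul_apply_rep f g (by omega) le_rfl)
      (mul_apply_rep f h (by omega) le_rfl)).symm
  add_mul {d e} f g h := by
    apply Subtype.ext; funext N
    refine (mul_apply (f + g) h (K := (N - e).toNat) (by omega)
      (add_mem (rep_mem f _) (rep_mem g _)) (rep_mem h N)
      (congrArg₂ (· + ·) (mk_rep f le_rfl) (mk_rep g le_rfl)) (mk_rep h le_rfl)).trans ?_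
    rw [add_mul, Submodule.Quotient.mk_add]
    exact (congrArg₂ (· + ·) (mul_apply_rep f h (by omega) le_rfl)
      (mul_apply_rep g h (by omega) le_rfl)).symm
  one_mul := by
    rintro ⟨d, f⟩
    refine mk_eq (zero_add d) _ _ fun N => ⟨rep f N, ?_, mk_rep f le_rfl⟩
    refine (mul_apply _ f (K := (N - d).toNat) (by omega) SetLike.GradedOne.one_mem
      (rep_mem f N) rfl (mk_rep f le_rfl)).trans ?_
    rw [one_mul]
  mul_one := by
    rintro ⟨d, f⟩
    refine mk_eq (add_zero d) _ _ fun N => ⟨rep f N, ?_, mk_rep f le_rfl⟩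
    refine (mul_apply f _ (K := N) (by omega) (rep_mem f N) SetLike.GradedOne.one_mem
      (mk_rep f le_rfl) rfl).trans ?_
    rw [mul_one]
  mul_assoc := by
    rintro ⟨d, f⟩ ⟨e, g⟩ ⟨k, h⟩
    refine mk_eq (add_assoc d e k) _ _ fun N => ?_
    obtain ⟨K, hK⟩ : ∃ K : ℕ, (N : ℤ) ≤ K + k := ⟨(N - k).toNat, by omega⟩
    obtain ⟨L, hL⟩ : ∃ L : ℕ, (K : ℤ) ≤ L + e ∧ (N : ℤ) ≤ L + (e + k) :=
      ⟨(K - e).toNat + (N - (e + k)).toNat, by omega, by omega⟩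
    refine ⟨rep f L * rep g K * rep h N, ?_, ?_⟩
    · exact mul_apply (mul f g) h hK (SetLike.mul_mem_graded (rep_mem f L) (rep_mem g K))
        (rep_mem h N) (mul_apply_rep f g hL.1 le_rfl) (mk_rep h le_rfl)
    · rw [mul_assoc]
      exact mul_apply f (mul g h) hL.2 (rep_mem f L)
        (SetLike.mul_mem_graded (rep_mem g K) (rep_mem h N)) (mk_rep f le_rfl)
        (mul_apply_rep g h hK le_rfl)
  natCast m := (m : ℂ) • of 1 SetLike.GradedOne.one_mem
  natCast_zero := by rw [Nat.cast_zero, zero_smul]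
  natCast_succ m := by rw [Nat.cast_succ, add_smul, one_smul]; rfl
  intCast m := (m : ℂ) • of 1 SetLike.GradedOne.one_mem
  intCast_ofNat m := by rw [Int.cast_natCast]
  intCast_negSucc_ofNat m := by rw [Int.cast_negSucc]; exact neg_smul _ _

instance : DirectSum.GAlgebra ℂ fun d => completionPart 𝒜 d where
  toFun :=
    { toFun := fun r => r • of 1 SetLike.GradedOne.one_mem
      map_zero' := zero_smul _ _
      map_add' := fun r s => add_smul r s _ }
  map_one := one_smul _ _
  map_mul r s := by
    refine mk_eq (add_zero (0 : ℤ)).symm _ _ fun N => ⟨(r • (1 : A)) * (s • (1 : A)), ?_, ?_⟩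
    · rw [smul_mul_smul_comm, mul_one]
      rfl
    · exact mul_apply _ _ (K := N) (by omega)
        (Submodule.smul_mem _ r SetLike.GradedOne.one_mem)
        (Submodule.smul_mem _ s SetLike.GradedOne.one_mem) rfl rfl
  commutes := by
    rintro r ⟨d, f⟩
    refine mk_eq ((zero_add d).trans (add_zero d).symm) _ _ fun N => ⟨r • rep f N, ?_, ?_⟩
    · refine (mul_apply _ f (K := (N - d).toNat) (by omega)
        (Submodule.smul_mem _ r SetLike.GradedOne.one_mem) (rep_mem f N) rfl
        (mk_rep f le_rfl)).trans ?_
      rw [smul_mul_assoc, one_mul]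
    · refine (mul_apply f _ (K := N) (by omega) (rep_mem f N)
        (Submodule.smul_mem _ r SetLike.GradedOne.one_mem) (mk_rep f le_rfl) rfl).trans ?_
      rw [mul_smul_comm, mul_one]
  smul_def := by
    rintro r ⟨d, f⟩
    refine mk_eq (zero_add d).symm _ _ fun N => ⟨r • rep f N, ?_, ?_⟩
    · rw [Submodule.Quotient.mk_smul, ← mk_rep f le_rfl]
      rfl
    · refine (mul_apply _ f (K := (N - d).toNat) (by omega)
        (Submodule.smul_mem _ r SetLike.GradedOne.one_mem) (rep_mem f N) rfl
        (mk_rep f le_rfl)).trans ?_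
      rw [smul_mul_assoc, one_mul]

end completionPart

/-- The standard degreewise completion `⨁_d lim_N A_d / ∑_{r > N} A_{d-r} A_r`. -/
abbrev Completion : Type _ := DirectSum ℤ fun d => completionPart 𝒜 d

end Completion

/-! ### Nodes of the cyclic diagram and positions of matrix units -/

section Nodes

variable {n a : ℕ}

/-- The nodes `0, …, n - 1` are the elements of `Fin n`, and `e_{i,j}` with `1 ≤ i, j ≤ a` is indexed
by `Fin a`, the number `i` corresponding to the element of `Fin a` with value `i - 1`.
`up k` is the position `k` among `1, …, n`, seen among `1, …, a`. -/
def up (hna : n ≤ a) (k : Fin n) : Fin a := Fin.castLE hna k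

/-- The position `i` of a node `i ≠ 0`, and the position `n` for the node `0`. -/
def lft (hna : n ≤ a) (i : Fin n) : Fin a :=
  ⟨if i.val = 0 then n - 1 else i.val - 1, by have := i.isLt; split_ifs <;> omega⟩

/-- The position `i + 1` of a node `i`; thus the position `1` for the node `0`. -/
def rgt (hna : n ≤ a) (i : Fin n) : Fin a := up hna i

/-- `δ_{i,0}`. -/
def delta0 (i : Fin n) : ℤ := if i.val = 0 then 1 else 0

/-- The Cartan matrix `a_{i,j}` of the cyclic diagram with `n ≥ 3` nodes. -/
def cartan (i j : Fin n) : ℤ :=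
  if i = j then 2
  else if i.val + 1 = j.val ∨ j.val + 1 = i.val ∨ (i.val = 0 ∧ j.val + 1 = n) ∨
    (i.val + 1 = n ∧ j.val = 0) then -1
  else 0

/-- The pairs `(0, n - 1)` and `(n - 1, 0)`. -/
def IsEndPair (i j : Fin n) : Prop :=
  (i.val = 0 ∧ j.val + 1 = n) ∨ (i.val + 1 = n ∧ j.val = 0)

variable {A : Type*} [Ring A]

/-- `h_0 = e_{n,n} - e_{1,1} + c` and `h_i = e_{i,i} - e_{i+1,i+1}` for `i ≠ 0`. -/
def chevalleyH (hna : n ≤ a) (e : Fin a → Fin a → ℤ → A) (c : A) (i : Fin n) : A :=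
  e (lft hna i) (lft hna i) 0 - e (rgt hna i) (rgt hna i) 0 + (if i.val = 0 then c else 0)

/-- `x_0^+ = e_{n,1} t`, `x_0^- = e_{1,n} t⁻¹`, and `x_i^+ = e_{i,i+1}`, `x_i^- = e_{i+1,i}` for
`i ≠ 0`. The sign is an element of `ℤˣ = {1, -1}`. -/
def chevalleyX (hna : n ≤ a) (e : Fin a → Fin a → ℤ → A) (σ : ℤˣ) (i : Fin n) : A :=
  if σ = 1 then e (lft hna i) (rgt hna i) (delta0 i) else e (rgt hna i) (lft hna i) (-delta0 i)

end Nodes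

/-! ### The evaluation elements in a completion -/

/-- A family of elements `e_{i,j} t^s` (of degree `s`) and `c` (of degree `0`) in a graded algebra. -/
structure Currents {A : Type*} [Ring A] [Algebra ℂ A] (𝒜 : ℤ → Submodule ℂ A) (a : ℕ) where
  e : Fin a → Fin a → ℤ → A
  c : A
  e_mem : ∀ i j s, e i j s ∈ 𝒜 s
  c_mem : c ∈ 𝒜 0

namespace Currents

variable {A : Type*} [Ring A] [Algebra ℂ A] {𝒜 : ℤ → Submodule ℂ A} [SetLike.GradedMonoid 𝒜]
  {n a : ℕ} (F : Currents 𝒜 a)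

/-- `e_{i,j} t^s` in the completion. -/
def E (i j : Fin a) (s : ℤ) : Completion 𝒜 :=
  DirectSum.of (completionPart 𝒜) s (completionPart.of (F.e i j s) (F.e_mem i j s))

/-- `c` in the completion. -/
def C : Completion 𝒜 := DirectSum.of (completionPart 𝒜) 0 (completionPart.of F.c F.c_mem)

/-- `h_i` in the completion. -/
def h (hna : n ≤ a) (i : Fin n) : Completion 𝒜 := chevalleyH hna F.E F.C i

/-- `x_i^±` in the completion. -/
def x (hna : n ≤ a) (σ : ℤˣ) (i : Fin n) : Completion 𝒜 := chevalleyX hna F.E σ i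

/-- The element `∑_{s ≥ 0} e_{i,k} t^{-s-α} e_{k,j} t^{s+β}` of the completion, of degree `β - α`. -/
def quad (i k j : Fin a) (α β : ℕ) : Completion 𝒜 :=
  DirectSum.of (completionPart 𝒜) ((β : ℤ) - α)
    (completionPart.series (fun s : ℕ => F.e i k (-s - α) * F.e k j (s + β))
      (fun s => by
        have h := SetLike.mul_mem_graded (F.e_mem i k (-s - α)) (F.e_mem k j (s + β))
        rwa [show (-s - α + (s + β) : ℤ) = β - α by ring] at h)
      (fun s => ⟨s + β, by omega, by
        have h := Submodule.mul_mem_mul (F.e_mem i k (-s - α)) (F.e_mem k j (s + β))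
        rwa [show (-s - α : ℤ) = β - α - (s + β) by ring] at h ⊢⟩))

/-- The value at `H_{i,1}` of the evaluation map. -/
def evH (hna : n ≤ a) (ħ : ℂ) (i : Fin n) : Completion 𝒜 :=
  if i.val = 0 then
    ħ • (F.C * F.h hna i)
    - ħ • (F.E (lft hna i) (lft hna i) 0 * (F.E (rgt hna i) (rgt hna i) 0 - F.C))
    + ħ • ∑ k : Fin n, F.quad (lft hna i) (up hna k) (lft hna i) 0 0
    - ħ • ∑ k : Fin n, F.quad (rgt hna i) (up hna k) (rgt hna i) 1 1
  else
    -((i.val : ℂ) / 2 * ħ) • F.h hna i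
    - ħ • (F.E (lft hna i) (lft hna i) 0 * F.E (rgt hna i) (rgt hna i) 0)
    + ħ • ∑ k : Fin n with k.val < i.val, F.quad (lft hna i) (up hna k) (lft hna i) 0 0
    + ħ • ∑ k : Fin n with i.val ≤ k.val, F.quad (lft hna i) (up hna k) (lft hna i) 1 1
    - ħ • ∑ k : Fin n with k.val < i.val, F.quad (rgt hna i) (up hna k) (rgt hna i) 0 0
    - ħ • ∑ k : Fin n with i.val ≤ k.val, F.quad (rgt hna i) (up hna k) (rgt hna i) 1 1

/-- The value at `X_{i,1}^+` of the evaluation map. -/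
def evXPlus (hna : n ≤ a) (ħ : ℂ) (i : Fin n) : Completion 𝒜 :=
  if i.val = 0 then
    ħ • (F.C * F.x hna 1 i)
    + ħ • ∑ k : Fin n, F.quad (lft hna i) (up hna k) (rgt hna i) 0 1
  else
    -((i.val : ℂ) / 2 * ħ) • F.x hna 1 i
    + ħ • ∑ k : Fin n with k.val < i.val, F.quad (lft hna i) (up hna k) (rgt hna i) 0 0
    + ħ • ∑ k : Fin n with i.val ≤ k.val, F.quad (lft hna i) (up hna k) (rgt hna i) 1 1

/-- The value at `X_{i,1}^-` of the evaluation map. -/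
def evXMinus (hna : n ≤ a) (ħ : ℂ) (i : Fin n) : Completion 𝒜 :=
  if i.val = 0 then
    ħ • (F.C * F.x hna (-1) i)
    + ħ • ∑ k : Fin n, F.quad (rgt hna i) (up hna k) (lft hna i) 1 0
  else
    -((i.val : ℂ) / 2 * ħ) • F.x hna (-1) i
    + ħ • ∑ k : Fin n with k.val < i.val, F.quad (rgt hna i) (up hna k) (lft hna i) 0 0
    + ħ • ∑ k : Fin n with i.val ≤ k.val, F.quad (rgt hna i) (up hna k) (lft hna i) 1 1

end Currents

/-! ### The affine Yangian and its extension -/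

/-- The defining relations of Guay's affine Yangian `Y_{ħ,ε}(ŝl(n))`, for elements `H_{i,r}` and
`X_{i,r}^±`, `r = 0, 1`, of an algebra. -/
inductive GuayRel {A : Type*} [Ring A] [Algebra ℂ A] {n : ℕ} (ħ ε : ℂ) (H : Fin n → Fin 2 → A)
    (X : ℤˣ → Fin n → Fin 2 → A) : A → A → Prop
  | H_H (i j : Fin n) (r s : Fin 2) : GuayRel ħ ε H X ⁅H i r, H j s⁆ 0
  | X_X_zero (i j : Fin n) :
      GuayRel ħ ε H X ⁅X 1 i 0, X (-1) j 0⁆ (if i = j then H i 0 else 0)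
  | X_X_left (i j : Fin n) :
      GuayRel ħ ε H X ⁅X 1 i 1, X (-1) j 0⁆ (if i = j then H i 1 else 0)
  | X_X_right (i j : Fin n) :
      GuayRel ħ ε H X ⁅X 1 i 0, X (-1) j 1⁆ (if i = j then H i 1 else 0)
  | H_X_zero (σ : ℤˣ) (i j : Fin n) (r : Fin 2) :
      GuayRel ħ ε H X ⁅H i 0, X σ j r⁆ (((σ : ℤ) * cartan i j : ℂ) • X σ j r)
  | H_X_one (σ : ℤˣ) (i j : Fin n) (hij : ¬ IsEndPair i j) :
      GuayRel ħ ε H X ⁅H i 1 - (ħ / 2) • (H i 0) ^ 2, X σ j 0⁆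
        (((σ : ℤ) * cartan i j : ℂ) • X σ j 1)
  | H_X_first_last (σ : ℤˣ) (i j : Fin n) (hi : i.val = 0) (hj : j.val + 1 = n) :
      GuayRel ħ ε H X ⁅H i 1 - (ħ / 2) • (H i 0) ^ 2, X σ j 0⁆
        (-(((σ : ℤ) : ℂ) • (X σ j 1 - (ε + n / 2 * ħ) • X σ j 0)))
  | H_X_last_first (σ : ℤˣ) (i j : Fin n) (hi : i.val + 1 = n) (hj : j.val = 0) :
      GuayRel ħ ε H X ⁅H i 1 - (ħ / 2) • (H i 0) ^ 2, X σ j 0⁆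
        (-(((σ : ℤ) : ℂ) • (X σ j 1 + (ε + n / 2 * ħ) • X σ j 0)))
  | X_X_same (σ : ℤˣ) (i j : Fin n) (hij : ¬ IsEndPair i j) :
      GuayRel ħ ε H X (⁅X σ i 1, X σ j 0⁆ - ⁅X σ i 0, X σ j 1⁆)
        (((σ : ℤ) * cartan i j * (ħ / 2) : ℂ) • (X σ i 0 * X σ j 0 + X σ j 0 * X σ i 0))
  | X_X_first_last (σ : ℤˣ) (i j : Fin n) (hi : i.val = 0) (hj : j.val + 1 = n) :
      GuayRel ħ ε H X (⁅X σ i 1, X σ j 0⁆ - ⁅X σ i 0, X σ j 1⁆)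
        (-(((σ : ℤ) * (ħ / 2) : ℂ) • (X σ i 0 * X σ j 0 + X σ j 0 * X σ i 0))
          - (ε + n / 2 * ħ) • ⁅X σ i 0, X σ j 0⁆)
  | serre (σ : ℤˣ) (i j : Fin n) (hij : i ≠ j) :
      GuayRel ħ ε H X ((fun y => ⁅X σ i 0, y⁆)^[(1 - cartan i j).toNat] (X σ j 0)) 0

/-- The generators `H_{i,r}`, `X_{i,r}^±` (`0 ≤ i ≤ n - 1`, `r = 0, 1`), `e_{i,j} t^s`
(`1 ≤ i, j ≤ a`, `s ∈ ℤ`) and `c_a`. -/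
inductive Gen (n a : ℕ) : Type
  | H (i : Fin n) (r : Fin 2) : Gen n a
  | X (σ : ℤˣ) (i : Fin n) (r : Fin 2) : Gen n a
  | e (i j : Fin a) (s : ℤ) : Gen n a
  | c : Gen n a

/-- The degrees of the generators. -/
def Gen.deg {n a : ℕ} : Gen n a → ℤ
  | .H _ _ => 0
  | .X σ i _ => (σ : ℤ) * delta0 i
  | .e _ _ s => s
  | .c => 0

section Yangian

variable {n a : ℕ} (hna : n ≤ a) (ħ ε : ℂ)

/-- A generator as an element of the free algebra. -/
abbrev freeGen (g : Gen n a) : FreeAlgebra ℂ (Gen n a) := FreeAlgebra.ι ℂ g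

/-- The relations among the generators: those of the affine Yangian, those of the affine Lie algebra
of `gl(a)`, and the identification of the two copies of the Chevalley generators. -/
inductive TildeRel : FreeAlgebra ℂ (Gen n a) → FreeAlgebra ℂ (Gen n a) → Prop
  | guay {u v : FreeAlgebra ℂ (Gen n a)}
      (h : GuayRel ħ ε (fun i r => freeGen (Gen.H i r)) (fun σ i r => freeGen (Gen.X σ i r)) u v) :
      TildeRel u v
  | e_e (p q i j : Fin a) (s u : ℤ) :
      TildeRel ⁅freeGen (n := n) (.e p q s), freeGen (n := n) (.e i j u)⁆
        ((if i = q then freeGen (Gen.e p j (s + u)) else 0)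
          - (if p = j then freeGen (Gen.e i q (s + u)) else 0)
          + (if i = q ∧ p = j ∧ s + u = 0 then (s : ℂ) • freeGen (Gen.c : Gen n a) else 0)
          + (if p = q ∧ i = j ∧ s + u = 0 then algebraMap ℂ _ (s : ℂ) else 0))
  | c_central (u : FreeAlgebra ℂ (Gen n a)) : TildeRel ⁅freeGen (Gen.c : Gen n a), u⁆ 0
  | H_zero (i : Fin n) :
      TildeRel (freeGen (Gen.H i 0))
        (chevalleyH hna (fun p q s => freeGen (Gen.e p q s)) (freeGen Gen.c) i)
  | X_zero (σ : ℤˣ) (i : Fin n) :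
      TildeRel (freeGen (Gen.X σ i 0)) (chevalleyX hna (fun p q s => freeGen (Gen.e p q s)) σ i)

/-- The algebra `Ỹ^a_{ħ,ε}(ŝl(n))`. -/
abbrev TildeYangian : Type := RingQuot (TildeRel hna ħ ε)

/-- A generator as an element of `Ỹ^a_{ħ,ε}(ŝl(n))`. -/
def tildeGen (g : Gen n a) : TildeYangian hna ħ ε :=
  RingQuot.mkAlgHom ℂ (TildeRel hna ħ ε) (freeGen g)

/-- The grading of `Ỹ^a_{ħ,ε}(ŝl(n))`. -/
abbrev tildeGrading : ℤ → Submodule ℂ (TildeYangian hna ħ ε) :=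
  degreePart (tildeGen hna ħ ε) Gen.deg

/-- The degreewise completion `Ŷ^a_{ħ,ε}(ŝl(n))` of `Ỹ^a_{ħ,ε}(ŝl(n))`. -/
abbrev HatYangian : Type := Completion (tildeGrading hna ħ ε)

/-- The elements `e_{i,j} t^s` and `c_a` of `Ỹ^a_{ħ,ε}(ŝl(n))`. -/
def tildeCurrents : Currents (tildeGrading hna ħ ε) a where
  e i j s := tildeGen hna ħ ε (Gen.e i j s)
  c := tildeGen hna ħ ε Gen.c
  e_mem i j s := mem_degreePart (tildeGen hna ħ ε) Gen.deg (Gen.e i j s)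
  c_mem := mem_degreePart (tildeGen hna ħ ε) Gen.deg Gen.c

/-- A generator as an element of the completion `Ŷ^a_{ħ,ε}(ŝl(n))`. -/
def hatGen (g : Gen n a) : HatYangian hna ħ ε :=
  DirectSum.of (completionPart (tildeGrading hna ħ ε)) g.deg
    (completionPart.of (tildeGen hna ħ ε g) (mem_degreePart (tildeGen hna ħ ε) Gen.deg g))

/-- The further relations defining the extended Yangian as a quotient of `Ŷ^a_{ħ,ε}(ŝl(n))`. Here
`v` runs over the positions `n + 1, …, a`. If the position `j ≤ n` does not belong to the node `i`,
then `H_{i,1}` has the same commutator with `e_{v,j} t^w` and with `e_{j,v} t^w` as the evaluation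
element of `H_{i,1}`; for cyclically consecutive nodes `i'` and `i`, which share one position `j`, the
same holds for the sum of the two commutators. -/
inductive ExtRel : HatYangian hna ħ ε → HatYangian hna ħ ε → Prop
  | lower (i : Fin n) (v : Fin a) (hv : n ≤ v.val) (j : Fin n) (hl : up hna j ≠ lft hna i)
      (hr : up hna j ≠ rgt hna i) (w : ℤ) :
      ExtRel ⁅hatGen hna ħ ε (.H i 1), hatGen hna ħ ε (.e v (up hna j) w)⁆
        ⁅(tildeCurrents hna ħ ε).evH hna ħ i, hatGen hna ħ ε (.e v (up hna j) w)⁆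
  | upper (i : Fin n) (v : Fin a) (hv : n ≤ v.val) (j : Fin n) (hl : up hna j ≠ lft hna i)
      (hr : up hna j ≠ rgt hna i) (w : ℤ) :
      ExtRel ⁅hatGen hna ħ ε (.H i 1), hatGen hna ħ ε (.e (up hna j) v w)⁆
        ⁅(tildeCurrents hna ħ ε).evH hna ħ i, hatGen hna ħ ε (.e (up hna j) v w)⁆
  | lower_sum (i' i : Fin n) (hi : rgt hna i' = lft hna i) (v : Fin a) (hv : n ≤ v.val) (w : ℤ) :
      ExtRel
        (⁅hatGen hna ħ ε (.H i' 1), hatGen hna ħ ε (.e v (lft hna i) w)⁆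
          + ⁅hatGen hna ħ ε (.H i 1), hatGen hna ħ ε (.e v (lft hna i) w)⁆)
        (⁅(tildeCurrents hna ħ ε).evH hna ħ i', hatGen hna ħ ε (.e v (lft hna i) w)⁆
          + ⁅(tildeCurrents hna ħ ε).evH hna ħ i, hatGen hna ħ ε (.e v (lft hna i) w)⁆)
  | upper_sum (i' i : Fin n) (hi : rgt hna i' = lft hna i) (v : Fin a) (hv : n ≤ v.val) (w : ℤ) :
      ExtRel
        (⁅hatGen hna ħ ε (.H i' 1), hatGen hna ħ ε (.e (lft hna i) v w)⁆
          + ⁅hatGen hna ħ ε (.H i 1), hatGen hna ħ ε (.e (lft hna i) v w)⁆)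
        (⁅(tildeCurrents hna ħ ε).evH hna ħ i', hatGen hna ħ ε (.e (lft hna i) v w)⁆
          + ⁅(tildeCurrents hna ħ ε).evH hna ħ i, hatGen hna ħ ε (.e (lft hna i) v w)⁆)

/-- The extended Yangian `Y^a_{ħ,ε}(ŝl(n))`. -/
abbrev ExtYangian : Type := RingQuot (ExtRel hna ħ ε)

/-- The quotient map `Ŷ^a_{ħ,ε}(ŝl(n)) → Y^a_{ħ,ε}(ŝl(n))`. -/
def extMk : HatYangian hna ħ ε →ₐ[ℂ] ExtYangian hna ħ ε := RingQuot.mkAlgHom ℂ (ExtRel hna ħ ε)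

/-- A generator as an element of `Y^a_{ħ,ε}(ŝl(n))`. -/
def extGen (g : Gen n a) : ExtYangian hna ħ ε := extMk hna ħ ε (hatGen hna ħ ε g)

end Yangian

/-! ### The target of the evaluation map -/

section Target

variable (a : ℕ) (κ : ℂ)

/-- The relations `z = 1` and `c = κ`. -/
inductive LevelRel : UniversalEnvelopingAlgebra ℂ (AffineGl a) →
    UniversalEnvelopingAlgebra ℂ (AffineGl a) → Prop
  | z : LevelRel (UniversalEnvelopingAlgebra.ι ℂ (AffineGl.z a)) 1
  | c : LevelRel (UniversalEnvelopingAlgebra.ι ℂ (AffineGl.c a)) (algebraMap ℂ _ κ)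

/-- The enveloping algebra of the affine Lie algebra of `gl(a)` with `z = 1` and `c = κ`. -/
abbrev LevelU : Type := RingQuot (LevelRel a κ)

/-- `E_{i,j} t^s` as an element of the enveloping algebra; the index is the triple `(i, j, s)`. -/
def levelE (p : Fin a × Fin a × ℤ) : LevelU a κ :=
  RingQuot.mkAlgHom ℂ (LevelRel a κ) (UniversalEnvelopingAlgebra.ι ℂ (AffineGl.E p.1 p.2.1 p.2.2))

/-- The grading by `deg (E_{i,j} t^s) = s`. -/
abbrev levelGrading : ℤ → Submodule ℂ (LevelU a κ) := degreePart (levelE a κ) fun p => p.2.2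

/-- The elements `E_{i,j} t^s` and `c = κ`. -/
def levelCurrents : Currents (levelGrading a κ) a where
  e i j s := levelE a κ (i, j, s)
  c := algebraMap ℂ _ κ
  e_mem i j s := mem_degreePart (levelE a κ) (fun p => p.2.2) (i, j, s)
  c_mem := by
    rw [Algebra.algebraMap_eq_smul_one]
    exact Submodule.smul_mem _ κ SetLike.GradedOne.one_mem

/-- The degreewise completion of the enveloping algebra with `z = 1` and `c = κ`. -/
abbrev CompletedU : Type := Completion (levelGrading a κ)

end Target

/-- A map between degreewise completions that preserves degrees and is continuous, in each degree,
for the inverse limit topologies. -/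
structure IsGradedContinuous {A B : Type*} [Ring A] [Algebra ℂ A] [Ring B] [Algebra ℂ B]
    {𝒜 : ℤ → Submodule ℂ A} {ℬ : ℤ → Submodule ℂ B} (φ : Completion 𝒜 → Completion ℬ) : Prop where
  graded : ∀ (d : ℤ) (f : completionPart 𝒜 d), ∃ g : completionPart ℬ d,
    φ (DirectSum.of (completionPart 𝒜) d f) = DirectSum.of (completionPart ℬ) d g
  continuous : ∀ (d : ℤ) (N : ℕ), ∃ M : ℕ, ∀ (f : completionPart 𝒜 d) (g : completionPart ℬ d),
    φ (DirectSum.of (completionPart 𝒜) d f) = DirectSum.of (completionPart ℬ) d g →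
      f.1 M = 0 → g.1 N = 0

end ExtendedYangian

end

/-!
The evaluation elements become uniform in the node once the matrix units are indexed by integers. Put
`e p q = E_{p̄,q̄} t^{⌊q/n⌋ - ⌊p/n⌋}` for `p q : ℤ`, where bars denote residues modulo `n`, corrected on
the diagonal by the constants `-⌊p/n⌋ κ`. Then `x_i^+ = e (i-1) i`, `x_i^- = e i (i-1)` and
`h_i = e (i-1) (i-1) - e i i` for every node, the node `0` included, and splitting the summation
variable of `Q i p q = ∑_{m < i} e p m * e m q` by its residue modulo `n` shows that the evaluation
elements are `ħ` times
`(t - i/2) x_i^+ + Q i (i-1) i`, `(t - i/2) x_i^- + Q i i (i-1)` and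
`(t - i/2) h_i - e (i-1) (i-1) * e i i + Q i (i-1) (i-1) - Q i i i`, with `t = x / ħ`.
This is `smul_raise1_eq_evXPlus`, `smul_lower1_eq_evXMinus` and `smul_cartan1_eq_evH`; the terms with `c`
at the node `0` come from the diagonal corrections.

The commutators of the `Q i p q` with the `e (j-1) j` and `e j (j-1)` telescope
(`PeriodicUnits.Q_lie_raise`, `PeriodicUnits.Q_lie_lower`). From them follow all relations of the affine
Yangian except the commutativity of the `H_{i,1}`. The exceptional relations between the nodes `0` and
`n - 1` are the ordinary ones between the integers `-1` and `0`, because replacing `i` by `i + n` changes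
the elements by the explicit multiple `n/2 + κ` of `x_i^±`; this is where `ħ κ = -(n ħ + ε)` enters. The
commutativity of the `H_{i,1}` reduces to that of the diagonal series `Q i i i` and `Q j j j`, which is
proved by expanding and rearranging a double series (`PeriodicUnits.commute_Q_of_not_dvd`). All this is
collected in `PeriodicUnits.guayRel`.

To speak of sums, the completion is given the topology in which the left ideals of elements vanishing at
level `N` in every degree are a basis of neighbourhoods of zero. A degree preserving homomorphism from
a graded algebra to a completion carries `A_{d-r} A_r` with `r > N` into the ideal at level `N`, hence
extends to the completion (`extend`) and commutes with convergent sums. This yields the homomorphism on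
the completed algebra; that it respects the further relations of the extended Yangian reduces to the
fact that `x h_i` commutes with the currents in question (`hatEv_rel`). Uniqueness holds because a graded
continuous homomorphism is determined by its values on monomials in the generators
(`hatYangian_algHom_ext`).
-/

noncomputable section

namespace ExtendedYangian

attribute [local instance 100] LieRing.ofAssociativeRing

/-! ### Periodic matrix units and their quadratic series -/

theorem hasSum_of_eq {ι M : Type*} [AddCommMonoid M] [TopologicalSpace M] {f g : ι → M} {x : M}
    (h : HasSum f x) (hfg : ∀ i, f i = g i) : HasSum g x :=
  funext hfg ▸ h

section Below

variable {M : Type*} [AddCommGroup M]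

/-- `f` cut off at `i`: the function equal to `f` below `i` and zero from `i` on. -/
def below (i : ℤ) (f : ℤ → M) (m : ℤ) : M := if m < i then f m else 0

theorem below_add_one (i : ℤ) (f : ℤ → M) :
    below (i + 1) f = fun m => below i f m + if m = i then f i else 0 := by
  funext m
  unfold below
  by_cases h : m < i
  · rw [if_pos h, if_pos (by omega), if_neg (by omega), add_zero]
  · by_cases h' : m = i
    · subst h'; simp
    · rw [if_neg h, if_neg (by omega), if_neg h', add_zero]

theorem hasSum_below_sub_shift [TopologicalSpace M] [IsTopologicalAddGroup M] {i : ℤ} {g : ℤ → M}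
    (h : Summable (below i g)) : HasSum (below i fun m => g m - g (m - 1)) (g (i - 1)) := by
  have h1 : HasSum (below (i - 1) g) (∑' m, below i g m - g (i - 1)) := by
    have := below_add_one (i - 1) g
    rw [sub_add_cancel] at this
    have h2 := h.hasSum.sub (hasSum_ite_eq (i - 1) (g (i - 1)))
    rw [this] at h2 ⊢
    simpa using h2
  have h2 := h.hasSum.sub ((Equiv.subRight (1 : ℤ)).hasSum_iff.mpr h1)
  rw [sub_sub_cancel] at h2
  refine hasSum_of_eq h2 fun m => ?_
  by_cases hm : m < i
  · simp [below, hm]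
  · simp [below, hm]

theorem hasSum_below_sub_shift' [TopologicalSpace M] [IsTopologicalAddGroup M] {i : ℤ} {g : ℤ → M}
    (h : Summable (below i g)) : HasSum (below i fun m => g m - g (m + 1)) (-g i) := by
  have h1 : HasSum (below (i + 1) g) (∑' m, below i g m + g i) := by
    rw [below_add_one]
    exact h.hasSum.add (hasSum_ite_eq i (g i))
  have h2 := h.hasSum.sub ((Equiv.addRight (1 : ℤ)).hasSum_iff.mpr h1)
  rw [sub_add_cancel_left] at h2
  refine hasSum_of_eq h2 fun m => ?_
  by_cases hm : m < i
  · simp [below, hm]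
  · simp [below, hm]

end Below

/-- Periodic matrix units: elements `e p q` of a topological algebra, indexed by integers, which
satisfy the commutation relations of `gl(n)[t, t⁻¹]` with its two central elements (of which one
acts by `1` and the other by `level`) when `e p q` is read as
`E_{p̄,q̄} t^{⌊q/n⌋ - ⌊p/n⌋}`, with bars denoting residues modulo `n`. The diagonal elements are
normalized by constants so that the central element of value `level` does not occur in the
commutators; it occurs instead in `e_shift`, as the failure of exact periodicity.

The fields `small`, `grade` and `summable` carry what is needed of the topology: the `small N` are
left ideals, any `e p q` with `q - p` large is small, and a homogeneous family is summable as soon as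
for every `N` all but finitely many of its members lie in `small N`. -/
structure PeriodicUnits (n : ℕ) (R : Type*) [Ring R] [Algebra ℂ R] [TopologicalSpace R] where
  e : ℤ → ℤ → R
  level : ℂ
  e_shift : ∀ p q, e (p + n) (q + n) = e p q - if p = q then algebraMap ℂ R level else 0
  e_lie : ∀ p q r s, ⁅e p q, e r s⁆ =
    (if (n : ℤ) ∣ q - r then e p (s + q - r) else 0)
    - (if (n : ℤ) ∣ s - p then e (r + p - s) q else 0)
    + if (n : ℤ) ∣ q - p ∧ q - p + (s - r) = 0 then algebraMap ℂ R (((q - p) / n : ℤ) : ℂ) else 0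
  small : ℕ → Submodule R R
  mul_small : ∀ (N : ℕ) (x : R), ∃ M : ℕ, ∀ y ∈ small M, y * x ∈ small N
  e_small : ∀ N : ℕ, ∃ K : ℤ, ∀ p q : ℤ, K ≤ q - p → e p q ∈ small N
  grade : ℤ → Submodule ℂ R
  mul_grade : ∀ {d d' : ℤ} {x y : R}, x ∈ grade d → y ∈ grade d' → x * y ∈ grade (d + d')
  e_grade : ∀ p q : ℤ, e p q ∈ grade (q / n - p / n)
  summable : ∀ {ι : Type} (d : ℤ) (f : ι → R), (∀ i, f i ∈ grade d) →
    (∀ N, {i | f i ∉ small N}.Finite) → Summable f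

namespace PeriodicUnits

variable {n : ℕ} {R : Type*} [Ring R] [Algebra ℂ R] [TopologicalSpace R]
  (P : PeriodicUnits n R)

theorem e_shift_of_ne {p q : ℤ} (h : p ≠ q) : P.e (p + n) (q + n) = P.e p q := by
  rw [P.e_shift, if_neg h, sub_zero]

theorem e_shift_mul (k : ℤ) {p q : ℤ} (h : p ≠ q) : P.e (p + n * k) (q + n * k) = P.e p q := by
  induction k with
  | zero => simp
  | succ k ih =>
    rw [← ih, ← P.e_shift_of_ne (p := p + n * k) (q := q + n * k) (by omega)]
    congr 1 <;> ring
  | pred k ih =>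
    rw [← ih, ← P.e_shift_of_ne (p := p + n * (-k - 1)) (q := q + n * (-k - 1)) (by omega)]
    congr 1 <;> ring

theorem e_shift_mul_diag (k p : ℤ) :
    P.e (p + n * k) (p + n * k) = P.e p p - algebraMap ℂ R (k * P.level) := by
  induction k with
  | zero => simp
  | succ k ih =>
    have h := P.e_shift (p + n * k) (p + n * k)
    rw [if_pos rfl, ih] at h
    rw [show p + (n : ℤ) * (k + 1) = p + n * k + n by ring, h]
    rw [Int.cast_add, Int.cast_one, add_mul, map_add, one_mul]; abel
  | pred k ih =>
    have h := P.e_shift (p + n * (-k - 1)) (p + n * (-k - 1))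
    rw [if_pos rfl, show p + (n : ℤ) * (-k - 1) + n = p + n * (-k) by ring, ih] at h
    rw [eq_sub_iff_add_eq] at h
    rw [← h]
    rw [Int.cast_sub, Int.cast_one, sub_mul, map_sub, one_mul]; abel

/-- Off the diagonal, only the difference of the indices and a residue class matter. -/
theorem e_congr {p q p' q' : ℤ} (h : p ≠ q) (hp : (n : ℤ) ∣ p' - p) (hq : q' - p' = q - p) :
    P.e p' q' = P.e p q := by
  obtain ⟨k, hk⟩ := hp
  rw [← P.e_shift_mul k h]
  congr 1 <;> linarith

/-- The commutator when the central terms vanish. -/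
theorem e_lie_of_not_dvd {p q r s : ℤ} (h : ¬ (n : ℤ) ∣ s - r) : ⁅P.e p q, P.e r s⁆ =
    (if (n : ℤ) ∣ q - r then P.e p (s + q - r) else 0)
      - (if (n : ℤ) ∣ s - p then P.e (r + p - s) q else 0) := by
  rw [P.e_lie, if_neg (c := (n : ℤ) ∣ q - p ∧ _), add_zero]
  rintro ⟨h1, h2⟩
  exact h (by rw [show s - r = -(q - p) by linarith]; exact (dvd_neg.mpr h1))

/-- The diagonal elements act on the matrix units by weights. -/
theorem e_lie_diag (p q j : ℤ) : ⁅P.e p q, P.e j j⁆ =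
    (if (n : ℤ) ∣ q - j then P.e p q else 0) - (if (n : ℤ) ∣ j - p then P.e p q else 0) := by
  rw [P.e_lie]
  have : (if (n : ℤ) ∣ q - p ∧ q - p + (j - j) = 0 then
      algebraMap ℂ R (((q - p) / n : ℤ) : ℂ) else 0) = 0 := by
    split_ifs with h
    · rw [show q - p = 0 by linarith [h.2]]; simp
    · rfl
  rw [this, add_zero, show j + q - j = q by ring, show j + p - j = p by ring]

theorem summable_below {d : ℤ} {f : ℤ → R} (i : ℤ) (hd : ∀ m < i, f m ∈ P.grade d)
    (h : ∀ N, ∃ K, ∀ m ≤ K, f m ∈ P.small N) : Summable (below i f) := by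
  refine P.summable d _ (fun m => ?_) fun N => ?_
  · unfold below
    split_ifs with hm
    · exact hd m hm
    · exact zero_mem _
  · obtain ⟨K, hK⟩ := h N
    refine (Set.finite_Icc K i).subset fun m hm => ?_
    by_contra hc
    apply hm
    unfold below
    split_ifs with hmi
    · exact hK m (by by_contra h'; exact hc ⟨by omega, by omega⟩)
    · exact zero_mem _

theorem summable_quad (i p q : ℤ) : Summable (below i fun m => P.e p m * P.e m q) := by
  refine P.summable_below (d := q / n - p / n) i (fun m _ => ?_) fun N => ?_
  · have := P.mul_grade (P.e_grade p m) (P.e_grade m q)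
    rwa [show m / (n : ℤ) - p / n + (q / n - m / n) = q / n - p / n by ring] at this
  · obtain ⟨K, hK⟩ := P.e_small N
    exact ⟨q - K, fun m hm => (P.small N).smul_mem (P.e p m) (hK m q (by omega))⟩

/-- The convergent sum `∑_{m < i} e(p,m) e(m,q)`. -/
def Q (i p q : ℤ) : R := ∑' m, below i (fun m => P.e p m * P.e m q) m

theorem hasSum_Q (i p q : ℤ) : HasSum (below i fun m => P.e p m * P.e m q) (P.Q i p q) :=
  (P.summable_quad i p q).hasSum

/-- The terms that survive inside the product when `Q i p q` is commuted with `e(r,u)`. -/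
def inner (p q r u m : ℤ) : R := if (n : ℤ) ∣ m - r then P.e p (u + m - r) * P.e m q else 0

theorem summable_inner (i p q r u : ℤ) : Summable (below i (P.inner p q r u)) := by
  refine P.summable_below (d := u / n - p / n + (q / n - r / n)) i (fun m _ => ?_) fun N => ?_
  · unfold inner
    split_ifs with h
    · have := P.mul_grade (P.e_grade p (u + m - r)) (P.e_grade m q)
      rcases eq_or_ne (n : ℤ) 0 with h0 | h0
      · simpa [h0] using this
      obtain ⟨k, hk⟩ := h
      rw [show u + m - r = u + n * k by linarith, show m = r + n * k by linarith,
        Int.add_mul_ediv_left _ _ h0, Int.add_mul_ediv_left _ _ h0] at this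
      rw [show u + m - r = u + n * k by linarith, show m = r + n * k by linarith]
      rwa [show u / (n : ℤ) + k - p / n + (q / n - (r / n + k)) = u / n - p / n + (q / n - r / n)
        by ring] at this
    · exact zero_mem _
  · obtain ⟨K, hK⟩ := P.e_small N
    refine ⟨q - K, fun m hm => ?_⟩
    unfold inner
    split_ifs
    · exact (P.small N).smul_mem (P.e p _) (hK m q (by omega))
    · exact zero_mem _

variable [IsTopologicalRing R] [T2Space R]

theorem Q_add_one (i p q : ℤ) : P.Q (i + 1) p q = P.Q i p q + P.e p i * P.e i q := by
  have h := P.hasSum_Q (i + 1) p q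
  rw [below_add_one] at h
  exact h.unique ((P.hasSum_Q i p q).add (hasSum_ite_eq i _))

omit [T2Space R] in
/-- In the commutator of `Q i p q` with an element off the diagonal, the terms fall into two series
which are shifts of one another by `u - r`. -/
theorem hasSum_Q_lie (i p q : ℤ) {r u : ℤ} (hur : ¬ (n : ℤ) ∣ u - r) :
    HasSum (below i fun m => P.inner p q r u m - P.inner p q r u (m + r - u))
      (⁅P.Q i p q, P.e r u⁆ - (if (n : ℤ) ∣ q - r then P.Q i p (u + q - r) else 0)
        + if (n : ℤ) ∣ u - p then P.Q i (r + p - u) q else 0) := by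
  have h0 := P.hasSum_Q i p q
  have h1 : HasSum (fun m => ⁅below i (fun m => P.e p m * P.e m q) m, P.e r u⁆)
      ⁅P.Q i p q, P.e r u⁆ := (h0.mul_right _).sub (h0.mul_left _)
  have h2 : HasSum (fun m => if (n : ℤ) ∣ q - r then
      below i (fun m => P.e p m * P.e m (u + q - r)) m else 0)
      (if (n : ℤ) ∣ q - r then P.Q i p (u + q - r) else 0) := by
    split_ifs
    · exact P.hasSum_Q ..
    · exact hasSum_zero
  have h3 : HasSum (fun m => if (n : ℤ) ∣ u - p then
      below i (fun m => P.e (r + p - u) m * P.e m q) m else 0)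
      (if (n : ℤ) ∣ u - p then P.Q i (r + p - u) q else 0) := by
    split_ifs
    · exact P.hasSum_Q ..
    · exact hasSum_zero
  refine hasSum_of_eq ((h1.sub h2).add h3) fun m => ?_
  by_cases hm : m < i
  · simp only [below, if_pos hm]
    have hl : ⁅P.e p m * P.e m q, P.e r u⁆ =
        P.e p m * ⁅P.e m q, P.e r u⁆ + ⁅P.e p m, P.e r u⁆ * P.e m q := by
      simp only [Ring.lie_def]; noncomm_ring
    rw [hl, P.e_lie_of_not_dvd hur, P.e_lie_of_not_dvd hur]
    simp only [inner]
    have hc : ((n : ℤ) ∣ m + r - u - r) ↔ (n : ℤ) ∣ u - m := by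
      rw [← dvd_neg]; ring_nf
    rw [if_congr hc rfl rfl, show u + (m + r - u) - r = m by ring, show m + r - u = r + m - u by ring]
    split_ifs <;> noncomm_ring
  · simp [below, hm, Ring.lie_def]

theorem Q_lie_raise (hn : 3 ≤ n) (i p q j : ℤ) : ⁅P.Q i p q, P.e (j - 1) j⁆ =
    (if (n : ℤ) ∣ q + 1 - j then P.Q i p (q + 1) else 0)
      - (if (n : ℤ) ∣ j - p then P.Q i (p - 1) q else 0)
      + if (n : ℤ) ∣ i - j then P.e p i * P.e (i - 1) q else 0 := by
  have hj : ¬ (n : ℤ) ∣ j - (j - 1) := by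
    rw [sub_sub_cancel]; exact fun h => by have := Int.le_of_dvd one_pos h; omega
  have h1 := P.hasSum_Q_lie i p q hj
  have h2 := hasSum_below_sub_shift (P.summable_inner i p q (j - 1) j)
  have h3 := h1.unique (hasSum_of_eq h2 fun m => ?_)
  · simp only [inner, show i - 1 - (j - 1) = i - j by ring, show j + (i - 1) - (j - 1) = i by ring,
      show q - (j - 1) = q + 1 - j by ring, show j + q - (j - 1) = q + 1 by ring,
      show j - 1 + p - j = p - 1 by ring] at h3
    rw [← h3]; abel
  · simp only [below, show m + (j - 1) - j = m - 1 by ring]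

theorem Q_lie_lower (hn : 3 ≤ n) (i p q j : ℤ) : ⁅P.Q i p q, P.e j (j - 1)⁆ =
    (if (n : ℤ) ∣ q - j then P.Q i p (q - 1) else 0)
      - (if (n : ℤ) ∣ j - 1 - p then P.Q i (p + 1) q else 0)
      - if (n : ℤ) ∣ i - j then P.e p (i - 1) * P.e i q else 0 := by
  have hj : ¬ (n : ℤ) ∣ j - 1 - j := by
    rw [sub_sub_cancel_left, dvd_neg]; exact fun h => by have := Int.le_of_dvd one_pos h; omega
  have h1 := P.hasSum_Q_lie i p q hj
  have h2 := hasSum_below_sub_shift' (P.summable_inner i p q j (j - 1))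
  have h3 := h1.unique (hasSum_of_eq h2 fun m => ?_)
  · simp only [inner, show j - 1 + i - j = i - 1 by ring, show j - 1 + q - j = q - 1 by ring,
      show j + p - (j - 1) = p + 1 by ring] at h3
    have h4 := congrArg Neg.neg h3
    rw [neg_neg] at h4
    rw [← h4]; abel
  · simp only [below, show m + j - (j - 1) = m + 1 by ring]

theorem Q_lie_diag (i p q j : ℤ) : ⁅P.Q i p q, P.e j j⁆ =
    (if (n : ℤ) ∣ q - j then P.Q i p q else 0) - (if (n : ℤ) ∣ j - p then P.Q i p q else 0) := by
  have h0 := P.hasSum_Q i p q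
  have h1 : HasSum (fun m => ⁅below i (fun m => P.e p m * P.e m q) m, P.e j j⁆)
      ⁅P.Q i p q, P.e j j⁆ := (h0.mul_right _).sub (h0.mul_left _)
  have hw : ∀ c : Prop, [Decidable c] → HasSum (fun m => if c then
      below i (fun m => P.e p m * P.e m q) m else 0) (if c then P.Q i p q else 0) := by
    intro c _
    split_ifs
    · exact h0
    · exact hasSum_zero
  refine h1.unique (hasSum_of_eq ((hw _).sub (hw _)) fun m => ?_)
  by_cases hm : m < i
  · simp only [below, if_pos hm]
    have hl : ⁅P.e p m * P.e m q, P.e j j⁆ =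
        P.e p m * ⁅P.e m q, P.e j j⁆ + ⁅P.e p m, P.e j j⁆ * P.e m q := by
      simp only [Ring.lie_def]; noncomm_ring
    rw [hl, P.e_lie_diag, P.e_lie_diag, if_congr (dvd_sub_comm (b := j) (c := m)) rfl rfl]
    split_ifs <;> noncomm_ring
  · simp [below, hm, Ring.lie_def]

end PeriodicUnits

/-! ### Commutators with the Chevalley generators -/

theorem mul_lie_ring {R : Type*} [Ring R] (a b c : R) :
    ⁅a * b, c⁆ = a * ⁅b, c⁆ + ⁅a, c⁆ * b := by
  simp only [Ring.lie_def]; noncomm_ring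

/-- The commutator of half the square of an element with one of its eigenvectors. -/
theorem half_sq_lie {R : Type*} [Ring R] [Algebra ℂ R] {A x : R} {α : ℂ} (h : ⁅A, x⁆ = α • x) :
    ⁅(1 / 2 : ℂ) • A ^ 2, x⁆ = α • (x * A) + (α ^ 2 / 2) • x := by
  have h' : A * x = x * A + α • x := by rw [← h, Ring.lie_def]; abel
  rw [smul_lie, pow_two, mul_lie_ring, h, mul_smul_comm, smul_mul_assoc, h']
  module

namespace PeriodicUnits

variable {n : ℕ} {R : Type*} [Ring R] [Algebra ℂ R] [TopologicalSpace R]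
  (P : PeriodicUnits n R)

theorem not_dvd_one (hn : 3 ≤ n) : ¬ (n : ℤ) ∣ 1 := fun h => by
  have := Int.le_of_dvd one_pos h; omega

theorem not_dvd_two (hn : 3 ≤ n) : ¬ (n : ℤ) ∣ 2 := fun h => by
  have := Int.le_of_dvd two_pos h; omega

theorem diag_commute (i j : ℤ) : Commute (P.e i i) (P.e j j) := by
  have := P.e_lie_diag i i j
  rw [if_congr (dvd_sub_comm (b := i) (c := j)) rfl rfl, sub_self, Ring.lie_def, sub_eq_zero] at this
  exact this

theorem diag_lie (p q j : ℤ) : ⁅P.e j j, P.e p q⁆ =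
    ((if (n : ℤ) ∣ j - p then 1 else 0) - (if (n : ℤ) ∣ q - j then 1 else 0) : ℂ) • P.e p q := by
  rw [← lie_skew, P.e_lie_diag]
  split_ifs <;> simp

/-- The Cartan element `h_i` of a node `i`. All integers serve as nodes; `i + n` gives the same
element as `i`. -/
def cartan0 (i : ℤ) : R := P.e (i - 1) (i - 1) - P.e i i

/-- The value of `X_{i,1}^+` divided by `ħ`, where `t` is the parameter `x` of the evaluation map
divided by `ħ`. -/
def raise1 (t : ℂ) (i : ℤ) : R := (t - i / 2) • P.e (i - 1) i + P.Q i (i - 1) i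

/-- The value of `X_{i,1}^-` divided by `ħ`; see `raise1`. -/
def lower1 (t : ℂ) (i : ℤ) : R := (t - i / 2) • P.e i (i - 1) + P.Q i i (i - 1)

/-- The value of `H_{i,1}` divided by `ħ`; see `raise1`. -/
def cartan1 (t : ℂ) (i : ℤ) : R :=
  (t - i / 2) • P.cartan0 i - P.e (i - 1) (i - 1) * P.e i i + P.Q i (i - 1) (i - 1) - P.Q i i i

theorem cartan0_congr {i j : ℤ} (h : (n : ℤ) ∣ i - j) : P.cartan0 j = P.cartan0 i := by
  obtain ⟨k, hk⟩ := h
  rw [show i = j + n * k by linarith, cartan0, cartan0,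
    show j + n * k - 1 = j - 1 + n * k by ring, e_shift_mul_diag, e_shift_mul_diag,
    sub_sub_sub_cancel_right]

/-- Subtracting the square of `h_i` removes the mixed product `e (i - 1) (i - 1) * e i i`, and leaves
an expression in which the indices `i - 1` and `i` are separated. -/
theorem cartan1_sub_sq (t : ℂ) (i : ℤ) : P.cartan1 t i - (1 / 2 : ℂ) • P.cartan0 i ^ 2 =
    (t - i / 2) • P.cartan0 i - (1 / 2 : ℂ) • P.e (i - 1) (i - 1) ^ 2 - (1 / 2 : ℂ) • P.e i i ^ 2
      + P.Q i (i - 1) (i - 1) - P.Q i i i := by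
  have h : P.cartan0 i ^ 2 = P.e (i - 1) (i - 1) ^ 2 - P.e (i - 1) (i - 1) * P.e i i
      - P.e (i - 1) (i - 1) * P.e i i + P.e i i ^ 2 := by
    rw [cartan0, pow_two, sub_mul, mul_sub, mul_sub, (P.diag_commute i (i - 1)).eq, pow_two, pow_two]
    abel
  rw [h, cartan1]
  module

theorem raise_lie_lower (hn : 3 ≤ n) (i j : ℤ) : ⁅P.e (i - 1) i, P.e j (j - 1)⁆ =
    if (n : ℤ) ∣ i - j then P.cartan0 i else 0 := by
  rw [P.e_lie_of_not_dvd (by rw [sub_sub_cancel_left, dvd_neg]; exact not_dvd_one hn),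
    if_congr (show ((n : ℤ) ∣ j - 1 - (i - 1)) ↔ (n : ℤ) ∣ i - j by
      rw [sub_sub_sub_cancel_right, dvd_sub_comm]) rfl rfl]
  rw [show j - 1 + i - j = i - 1 by ring, show j + (i - 1) - (j - 1) = i by ring]
  unfold cartan0
  split_ifs <;> simp

theorem raise_lie_raise (hn : 3 ≤ n) (i j : ℤ) : ⁅P.e (i - 1) i, P.e (j - 1) j⁆ =
    (if (n : ℤ) ∣ i + 1 - j then P.e (i - 1) (i + 1) else 0)
      - if (n : ℤ) ∣ i - 1 - j then P.e (i - 1 - 1) i else 0 := by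
  rw [P.e_lie_of_not_dvd (by rw [sub_sub_cancel]; exact not_dvd_one hn),
    if_congr (dvd_sub_comm (b := j) (c := i - 1)) rfl rfl, show i - (j - 1) = i + 1 - j by ring,
    show j + i - (j - 1) = i + 1 by ring, show j - 1 + (i - 1) - j = i - 1 - 1 by ring]

theorem lower_lie_lower (hn : 3 ≤ n) (i j : ℤ) : ⁅P.e i (i - 1), P.e j (j - 1)⁆ =
    (if (n : ℤ) ∣ i - 1 - j then P.e i (i - 1 - 1) else 0)
      - if (n : ℤ) ∣ i + 1 - j then P.e (i + 1) (i - 1) else 0 := by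
  rw [P.e_lie_of_not_dvd (by rw [sub_sub_cancel_left, dvd_neg]; exact not_dvd_one hn),
    if_congr (dvd_sub_comm (b := j - 1) (c := i)) rfl rfl, show i - (j - 1) = i + 1 - j by ring,
    show j - 1 + (i - 1) - j = i - 1 - 1 by ring, show j + i - (j - 1) = i + 1 by ring]

variable [IsTopologicalRing R] [T2Space R]

theorem diag_lie_Q (i p q j : ℤ) : ⁅P.e j j, P.Q i p q⁆ =
    ((if (n : ℤ) ∣ j - p then 1 else 0) - (if (n : ℤ) ∣ q - j then 1 else 0) : ℂ) • P.Q i p q := by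
  rw [← lie_skew, P.Q_lie_diag]
  split_ifs <;> simp

theorem cartan0_lie_raise1 (t : ℂ) (i j : ℤ) : ⁅P.cartan0 i, P.raise1 t j⁆ =
    (2 * (if (n : ℤ) ∣ i - j then 1 else 0) - (if (n : ℤ) ∣ i + 1 - j then 1 else 0)
      - (if (n : ℤ) ∣ i - 1 - j then 1 else 0) : ℂ) • P.raise1 t j := by
  simp only [cartan0, raise1, sub_lie, lie_add, lie_smul, diag_lie, diag_lie_Q,
    show i - 1 - (j - 1) = i - j by ring, show i - (j - 1) = i + 1 - j by ring,
    dvd_sub_comm (b := j) (c := i), dvd_sub_comm (b := j) (c := i - 1)]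
  module

theorem cartan0_lie_lower1 (t : ℂ) (i j : ℤ) : ⁅P.cartan0 i, P.lower1 t j⁆ =
    -(2 * (if (n : ℤ) ∣ i - j then 1 else 0) - (if (n : ℤ) ∣ i + 1 - j then 1 else 0)
      - (if (n : ℤ) ∣ i - 1 - j then 1 else 0) : ℂ) • P.lower1 t j := by
  simp only [cartan0, lower1, sub_lie, lie_add, lie_smul, diag_lie, diag_lie_Q,
    dvd_sub_comm (b := j - 1) (c := i), dvd_sub_comm (b := j - 1) (c := i - 1),
    show i - 1 - (j - 1) = i - j by ring, show i - (j - 1) = i + 1 - j by ring]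
  module

theorem raise1_lie_lower (hn : 3 ≤ n) (t : ℂ) (i j : ℤ) : ⁅P.raise1 t i, P.e j (j - 1)⁆ =
    if (n : ℤ) ∣ i - j then P.cartan1 t i else 0 := by
  rw [raise1, add_lie, smul_lie, P.raise_lie_lower hn, P.Q_lie_lower hn,
    if_congr (show ((n : ℤ) ∣ j - 1 - (i - 1)) ↔ (n : ℤ) ∣ i - j by
      rw [sub_sub_sub_cancel_right, dvd_sub_comm]) rfl rfl, sub_add_cancel]
  unfold cartan1
  split_ifs
  · abel
  · simp

theorem raise_lie_lower1 (hn : 3 ≤ n) (t : ℂ) (i j : ℤ) : ⁅P.e (j - 1) j, P.lower1 t i⁆ =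
    if (n : ℤ) ∣ i - j then P.cartan1 t i else 0 := by
  rw [lower1, lie_add, lie_smul, P.raise_lie_lower hn, ← lie_skew, P.Q_lie_raise hn,
    sub_add_cancel, if_congr (dvd_sub_comm (b := j) (c := i)) rfl rfl,
    if_congr (dvd_sub_comm (b := j) (c := i)) rfl rfl]
  by_cases h : (n : ℤ) ∣ i - j
  · simp only [if_pos h]
    rw [P.cartan0_congr h, cartan1, (P.diag_commute _ _).eq]
    abel
  · simp [h]

theorem cartan1_lie_raise (hn : 3 ≤ n) (t : ℂ) (i : ℤ) :
    ⁅P.cartan1 t i - (1 / 2 : ℂ) • P.cartan0 i ^ 2, P.e (i - 1) i⁆ = (2 : ℂ) • P.raise1 t i := by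
  have hA : ⁅P.e (i - 1) (i - 1), P.e (i - 1) i⁆ = (1 : ℂ) • P.e (i - 1) i := by
    rw [diag_lie]; simp [not_dvd_one hn]
  have hB : ⁅P.e i i, P.e (i - 1) i⁆ = (-1 : ℂ) • P.e (i - 1) i := by
    rw [diag_lie]; simp [not_dvd_one hn]
  have hB' : P.e i i * P.e (i - 1) i = P.e (i - 1) i * P.e i i + (-1 : ℂ) • P.e (i - 1) i := by
    rw [← hB, Ring.lie_def]; abel
  rw [cartan1_sub_sq, sub_lie, add_lie, sub_lie, sub_lie, smul_lie, cartan0, sub_lie,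
    half_sq_lie hA, half_sq_lie hB, hA, hB, P.Q_lie_raise hn, P.Q_lie_raise hn, raise1]
  simp only [sub_add_cancel, sub_self, dvd_zero, if_true, sub_sub_cancel, not_dvd_one hn, if_false,
    add_sub_cancel_left, hB']
  module

theorem cartan1_lie_raise_succ (hn : 3 ≤ n) (t : ℂ) (i : ℤ) :
    ⁅P.cartan1 t i - (1 / 2 : ℂ) • P.cartan0 i ^ 2, P.e i (i + 1)⁆ = -P.raise1 t (i + 1) := by
  have hA : ⁅P.e (i - 1) (i - 1), P.e i (i + 1)⁆ = (0 : ℂ) • P.e i (i + 1) := by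
    rw [diag_lie, show i + 1 - (i - 1) = 2 by ring]; simp [not_dvd_one hn, not_dvd_two hn]
  have hB : ⁅P.e i i, P.e i (i + 1)⁆ = (1 : ℂ) • P.e i (i + 1) := by
    rw [diag_lie]; simp [not_dvd_one hn]
  have hB' : P.e i i * P.e i (i + 1) = P.e i (i + 1) * P.e i i + (1 : ℂ) • P.e i (i + 1) := by
    rw [← hB, Ring.lie_def]; abel
  have h1 := P.Q_lie_raise hn i (i - 1) (i - 1) (i + 1)
  have h2 := P.Q_lie_raise hn i i i (i + 1)
  rw [add_sub_cancel_right] at h1 h2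
  rw [cartan1_sub_sq, sub_lie, add_lie, sub_lie, sub_lie, smul_lie, cartan0, sub_lie,
    half_sq_lie hA, half_sq_lie hB, hA, hB, h1, h2, raise1, add_sub_cancel_right, Q_add_one]
  simp only [sub_add_cancel, show i + 1 - (i - 1) = 2 by ring, sub_self, dvd_zero, if_true, if_false,
    not_dvd_one hn, not_dvd_two hn, add_sub_cancel_left, hB', sub_add_cancel_left, dvd_neg]
  push_cast
  module

theorem cartan1_lie_raise_pred (hn : 3 ≤ n) (t : ℂ) (i : ℤ) :
    ⁅P.cartan1 t i - (1 / 2 : ℂ) • P.cartan0 i ^ 2, P.e (i - 1 - 1) (i - 1)⁆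
      = -P.raise1 t (i - 1) := by
  have hA : ⁅P.e (i - 1) (i - 1), P.e (i - 1 - 1) (i - 1)⁆
      = (-1 : ℂ) • P.e (i - 1 - 1) (i - 1) := by
    rw [diag_lie]; simp [not_dvd_one hn]
  have hB : ⁅P.e i i, P.e (i - 1 - 1) (i - 1)⁆ = (0 : ℂ) • P.e (i - 1 - 1) (i - 1) := by
    rw [diag_lie, show i - (i - 1 - 1) = 2 by ring]; simp [not_dvd_one hn, not_dvd_two hn]
  have hQ := P.Q_add_one (i - 1) (i - 1 - 1) (i - 1)
  rw [sub_add_cancel] at hQ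
  rw [cartan1_sub_sq, sub_lie, add_lie, sub_lie, sub_lie, smul_lie, cartan0, sub_lie,
    half_sq_lie hA, half_sq_lie hB, hA, hB, P.Q_lie_raise hn, P.Q_lie_raise hn, raise1, hQ]
  simp only [sub_add_cancel, show i + 1 - (i - 1) = 2 by ring, sub_self, dvd_zero, if_true, if_false,
    not_dvd_one hn, not_dvd_two hn, sub_sub_cancel, sub_sub_cancel_left, dvd_neg]
  push_cast
  module

theorem cartan1_lie_raise_far (hn : 3 ≤ n) (t : ℂ) {i j : ℤ} (h0 : ¬ (n : ℤ) ∣ i - j)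
    (h1 : ¬ (n : ℤ) ∣ i + 1 - j) (h2 : ¬ (n : ℤ) ∣ i - 1 - j) :
    ⁅P.cartan1 t i - (1 / 2 : ℂ) • P.cartan0 i ^ 2, P.e (j - 1) j⁆ = 0 := by
  have h0' : ¬ (n : ℤ) ∣ j - i := by rwa [dvd_sub_comm]
  have h2' : ¬ (n : ℤ) ∣ j - (i - 1) := by rwa [dvd_sub_comm]
  have h3 : ¬ (n : ℤ) ∣ i - (j - 1) := by rwa [show i - (j - 1) = i + 1 - j by ring]
  have hA : ⁅P.e (i - 1) (i - 1), P.e (j - 1) j⁆ = (0 : ℂ) • P.e (j - 1) j := by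
    rw [diag_lie]; simp [h0, h2']
  have hB : ⁅P.e i i, P.e (j - 1) j⁆ = (0 : ℂ) • P.e (j - 1) j := by
    rw [diag_lie]; simp [h3, h0']
  rw [cartan1_sub_sq, sub_lie, add_lie, sub_lie, sub_lie, smul_lie, cartan0, sub_lie,
    half_sq_lie hA, half_sq_lie hB, hA, hB, P.Q_lie_raise hn, P.Q_lie_raise hn]
  simp [h0, h1, h0', h2']

theorem cartan1_lie_lower (hn : 3 ≤ n) (t : ℂ) (i : ℤ) :
    ⁅P.cartan1 t i - (1 / 2 : ℂ) • P.cartan0 i ^ 2, P.e i (i - 1)⁆ = (-2 : ℂ) • P.lower1 t i := by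
  have hA : ⁅P.e (i - 1) (i - 1), P.e i (i - 1)⁆ = (-1 : ℂ) • P.e i (i - 1) := by
    rw [diag_lie]; simp [not_dvd_one hn]
  have hB : ⁅P.e i i, P.e i (i - 1)⁆ = (1 : ℂ) • P.e i (i - 1) := by
    rw [diag_lie]; simp [not_dvd_one hn]
  have hA' : P.e (i - 1) (i - 1) * P.e i (i - 1)
      = P.e i (i - 1) * P.e (i - 1) (i - 1) + (-1 : ℂ) • P.e i (i - 1) := by
    rw [← hA, Ring.lie_def]; abel
  rw [cartan1_sub_sq, sub_lie, add_lie, sub_lie, sub_lie, smul_lie, cartan0, sub_lie,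
    half_sq_lie hA, half_sq_lie hB, hA, hB, P.Q_lie_lower hn, P.Q_lie_lower hn, lower1]
  simp only [sub_add_cancel, sub_self, dvd_zero, if_true, sub_sub_cancel_left, not_dvd_one hn,
    if_false, dvd_neg, hA']
  module

theorem cartan1_lie_lower_succ (hn : 3 ≤ n) (t : ℂ) (i : ℤ) :
    ⁅P.cartan1 t i - (1 / 2 : ℂ) • P.cartan0 i ^ 2, P.e (i + 1) i⁆ = P.lower1 t (i + 1) := by
  have hA : ⁅P.e (i - 1) (i - 1), P.e (i + 1) i⁆ = (0 : ℂ) • P.e (i + 1) i := by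
    rw [diag_lie, show i - 1 - (i + 1) = -2 by ring]; simp [not_dvd_one hn, not_dvd_two hn]
  have hB : ⁅P.e i i, P.e (i + 1) i⁆ = (-1 : ℂ) • P.e (i + 1) i := by
    rw [diag_lie]; simp [not_dvd_one hn]
  have h1 := P.Q_lie_lower hn i (i - 1) (i - 1) (i + 1)
  have h2 := P.Q_lie_lower hn i i i (i + 1)
  rw [add_sub_cancel_right] at h1 h2
  rw [cartan1_sub_sq, sub_lie, add_lie, sub_lie, sub_lie, smul_lie, cartan0, sub_lie,
    half_sq_lie hA, half_sq_lie hB, hA, hB, h1, h2, lower1, add_sub_cancel_right, Q_add_one]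
  simp only [sub_add_cancel, show i - 1 - (i + 1) = -2 by ring, sub_self, dvd_zero, if_true, if_false,
    not_dvd_one hn, not_dvd_two hn, sub_add_cancel_left, dvd_neg, sub_sub_cancel]
  push_cast
  module

theorem cartan1_lie_lower_pred (hn : 3 ≤ n) (t : ℂ) (i : ℤ) :
    ⁅P.cartan1 t i - (1 / 2 : ℂ) • P.cartan0 i ^ 2, P.e (i - 1) (i - 1 - 1)⁆
      = P.lower1 t (i - 1) := by
  have hA : ⁅P.e (i - 1) (i - 1), P.e (i - 1) (i - 1 - 1)⁆
      = (1 : ℂ) • P.e (i - 1) (i - 1 - 1) := by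
    rw [diag_lie]; simp [not_dvd_one hn]
  have hA' : P.e (i - 1) (i - 1) * P.e (i - 1) (i - 1 - 1)
      = P.e (i - 1) (i - 1 - 1) * P.e (i - 1) (i - 1) + (1 : ℂ) • P.e (i - 1) (i - 1 - 1) := by
    rw [← hA, Ring.lie_def]; abel
  have hB : ⁅P.e i i, P.e (i - 1) (i - 1 - 1)⁆ = (0 : ℂ) • P.e (i - 1) (i - 1 - 1) := by
    rw [diag_lie, show i - 1 - 1 - i = -2 by ring]; simp [not_dvd_one hn, not_dvd_two hn]
  have hQ := P.Q_add_one (i - 1) (i - 1) (i - 1 - 1)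
  rw [sub_add_cancel] at hQ
  rw [cartan1_sub_sq, sub_lie, add_lie, sub_lie, sub_lie, smul_lie, cartan0, sub_lie,
    half_sq_lie hA, half_sq_lie hB, hA, hB, P.Q_lie_lower hn, P.Q_lie_lower hn, lower1, hQ]
  simp only [sub_add_cancel, show i - 1 - 1 - i = -2 by ring, sub_self, dvd_zero, if_true, if_false,
    not_dvd_one hn, not_dvd_two hn, sub_sub_cancel, sub_sub_cancel_left, dvd_neg, hA']
  push_cast
  module

theorem cartan1_lie_lower_far (hn : 3 ≤ n) (t : ℂ) {i j : ℤ} (h0 : ¬ (n : ℤ) ∣ i - j)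
    (h1 : ¬ (n : ℤ) ∣ i + 1 - j) (h2 : ¬ (n : ℤ) ∣ i - 1 - j) :
    ⁅P.cartan1 t i - (1 / 2 : ℂ) • P.cartan0 i ^ 2, P.e j (j - 1)⁆ = 0 := by
  have h0' : ¬ (n : ℤ) ∣ j - i := by rwa [dvd_sub_comm]
  have h3 : ¬ (n : ℤ) ∣ j - 1 - i := by rwa [dvd_sub_comm, show i - (j - 1) = i + 1 - j by ring]
  have hA : ⁅P.e (i - 1) (i - 1), P.e j (j - 1)⁆ = (0 : ℂ) • P.e j (j - 1) := by
    rw [diag_lie]; simp [h0', h2]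
  have hB : ⁅P.e i i, P.e j (j - 1)⁆ = (0 : ℂ) • P.e j (j - 1) := by
    rw [diag_lie]; simp [h3, h0]
  rw [cartan1_sub_sq, sub_lie, add_lie, sub_lie, sub_lie, smul_lie, cartan0, sub_lie,
    half_sq_lie hA, half_sq_lie hB, hA, hB, P.Q_lie_lower hn, P.Q_lie_lower hn]
  simp [h0, h2, h0', h3]

theorem raise1_lie_raise (hn : 3 ≤ n) (t : ℂ) (i : ℤ) :
    ⁅P.raise1 t i, P.e (i - 1) i⁆ = P.e (i - 1) i * P.e (i - 1) i := by
  rw [raise1, add_lie, smul_lie, lie_self, P.Q_lie_raise hn]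
  simp [not_dvd_one hn]

theorem raise1_lie_raise_succ (hn : 3 ≤ n) (t : ℂ) (i : ℤ) :
    ⁅P.raise1 t i, P.e i (i + 1)⁆ + ⁅P.raise1 t (i + 1), P.e (i - 1) i⁆ =
      (-(1 / 2) : ℂ) • (P.e (i - 1) i * P.e i (i + 1) + P.e i (i + 1) * P.e (i - 1) i) := by
  have h1 := P.Q_lie_raise hn i (i - 1) i (i + 1)
  rw [add_sub_cancel_right] at h1
  have h3 : ⁅P.e i (i + 1), P.e (i - 1) i⁆ = - ⁅P.e (i - 1) i, P.e i (i + 1)⁆ := by rw [lie_skew]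
  rw [raise1, raise1, add_lie, add_lie, smul_lie, smul_lie, add_sub_cancel_right, h3, h1,
    P.Q_lie_raise hn, P.Q_add_one i (i - 1) (i + 1)]
  simp only [show i + 1 + 1 - i = 2 by ring, show i + 1 - (i - 1) = 2 by ring, sub_self, dvd_zero,
    if_true, if_false, not_dvd_one hn, not_dvd_two hn, sub_add_cancel_left, dvd_neg, add_sub_cancel_left, sub_zero,
    Ring.lie_def]
  push_cast
  module

theorem raise1_lie_raise_far (hn : 3 ≤ n) (t : ℂ) {i j : ℤ} (h0 : ¬ (n : ℤ) ∣ i - j)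
    (h1 : ¬ (n : ℤ) ∣ i + 1 - j) (h2 : ¬ (n : ℤ) ∣ i - 1 - j) :
    ⁅P.raise1 t i, P.e (j - 1) j⁆ = 0 := by
  have h2' : ¬ (n : ℤ) ∣ j - (i - 1) := by rwa [dvd_sub_comm]
  rw [raise1, add_lie, smul_lie, P.raise_lie_raise hn, P.Q_lie_raise hn]
  simp [h0, h1, h2, h2']

theorem lower1_lie_lower (hn : 3 ≤ n) (t : ℂ) (i : ℤ) :
    ⁅P.lower1 t i, P.e i (i - 1)⁆ = -(P.e i (i - 1) * P.e i (i - 1)) := by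
  rw [lower1, add_lie, smul_lie, lie_self, P.Q_lie_lower hn]
  simp [not_dvd_one hn]

theorem lower1_lie_lower_succ (hn : 3 ≤ n) (t : ℂ) (i : ℤ) :
    ⁅P.lower1 t i, P.e (i + 1) i⁆ + ⁅P.lower1 t (i + 1), P.e i (i - 1)⁆ =
      (1 / 2 : ℂ) • (P.e i (i - 1) * P.e (i + 1) i + P.e (i + 1) i * P.e i (i - 1)) := by
  have h1 := P.Q_lie_lower hn i i (i - 1) (i + 1)
  rw [add_sub_cancel_right] at h1
  have h3 : ⁅P.e (i + 1) i, P.e i (i - 1)⁆ = - ⁅P.e i (i - 1), P.e (i + 1) i⁆ := by rw [lie_skew]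
  rw [lower1, lower1, add_lie, add_lie, smul_lie, smul_lie, add_sub_cancel_right, h3, h1,
    P.Q_lie_lower hn, Q_add_one]
  simp only [show i - 1 - (i + 1) = -2 by ring, sub_self, dvd_zero, if_true, if_false,
    not_dvd_one hn, not_dvd_two hn, sub_add_cancel_left, dvd_neg, add_sub_cancel_left, zero_sub,
    Ring.lie_def]
  push_cast
  module

theorem lower1_lie_lower_far (hn : 3 ≤ n) (t : ℂ) {i j : ℤ} (h0 : ¬ (n : ℤ) ∣ i - j)
    (h1 : ¬ (n : ℤ) ∣ i + 1 - j) (h2 : ¬ (n : ℤ) ∣ i - 1 - j) :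
    ⁅P.lower1 t i, P.e j (j - 1)⁆ = 0 := by
  have h3 : ¬ (n : ℤ) ∣ j - 1 - i := by rwa [dvd_sub_comm, show i - (j - 1) = i + 1 - j by ring]
  rw [lower1, add_lie, smul_lie, P.lower_lie_lower hn, P.Q_lie_lower hn]
  simp [h0, h1, h2, h3]

end PeriodicUnits

/-! ### Commutativity of the diagonal series -/

theorem mul_lie_mul_ring {R : Type*} [Ring R] (a b c d : R) : ⁅a * b, c * d⁆ =
    a * ⁅b, c⁆ * d + ⁅a, c⁆ * b * d + c * a * ⁅b, d⁆ + c * ⁅a, d⁆ * b := by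
  simp only [Ring.lie_def]; noncomm_ring

namespace PeriodicUnits

variable {n : ℕ} {R : Type*} [Ring R] [Algebra ℂ R] [TopologicalSpace R]
  (P : PeriodicUnits n R)

/-- The terms of a double series over the pairs with `p < i` and `m < j` that satisfy `c`. -/
def pairBelow (i j : ℤ) (c : ℤ → ℤ → Prop) [∀ p m, Decidable (c p m)] (g : ℤ → ℤ → R)
    (x : ℤ × ℤ) : R :=
  if x.1 < i ∧ x.2 < j ∧ c x.1 x.2 then g x.1 x.2 else 0

variable {i j : ℤ} {c : ℤ → ℤ → Prop} [∀ p m, Decidable (c p m)] {g : ℤ → ℤ → R}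

theorem summable_pairBelow {d : ℤ}
    (hd : ∀ p < i, ∀ m < j, c p m → g p m ∈ P.grade d)
    (h1 : ∀ N, ∃ A, ∀ p < i, ∀ m ≤ A, c p m → g p m ∈ P.small N)
    (h2 : ∀ N, ∀ m < j, ∃ A, ∀ p ≤ A, c p m → g p m ∈ P.small N) :
    Summable (pairBelow i j c g) := by
  refine P.summable d _ (fun x => ?_) fun N => ?_
  · unfold pairBelow
    split_ifs with h
    · exact hd _ h.1 _ h.2.1 h.2.2
    · exact zero_mem _
  · obtain ⟨A, hA⟩ := h1 N
    choose! A' hA' using h2 N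
    refine ((Set.finite_Icc A j).biUnion fun m _ =>
      (Set.finite_Icc (A' m) i).image fun p => (p, m)).subset ?_
    rintro ⟨p, m⟩ hx
    have hx' : ¬ pairBelow i j c g (p, m) ∈ P.small N := hx
    unfold pairBelow at hx'
    split_ifs at hx' with h
    · simp only [Set.mem_iUnion]
      refine ⟨m, ⟨?_, h.2.1.le⟩, p, ⟨?_, h.1.le⟩, rfl⟩
      · by_contra hc; exact hx' (hA p h.1 m (by omega) h.2.2)
      · by_contra hc; exact hx' (hA' m h.2.1 p (by omega) h.2.2)
    · exact absurd (zero_mem _) hx'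

theorem summable_pairBelow' {d : ℤ}
    (hd : ∀ p < i, ∀ m < j, c p m → g p m ∈ P.grade d)
    (h1 : ∀ N, ∃ A, ∀ m < j, ∀ p ≤ A, c p m → g p m ∈ P.small N)
    (h2 : ∀ N, ∀ p < i, ∃ A, ∀ m ≤ A, c p m → g p m ∈ P.small N) :
    Summable (pairBelow i j c g) := by
  have := P.summable_pairBelow (d := d) (i := j) (j := i) (g := fun m p => g p m)
    (c := fun m p => c p m) (fun m hm p hp => hd p hp m hm) h1 h2
  refine ((Equiv.prodComm ℤ ℤ).summable_iff.mpr this).congr fun x => ?_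
  exact if_congr and_left_comm rfl rfl

theorem exists_e_mul_small (N : ℕ) (x : R) :
    ∃ K : ℤ, ∀ y p q, K ≤ q - p → y * P.e p q * x ∈ P.small N := by
  obtain ⟨M, hM⟩ := P.mul_small N x
  obtain ⟨K, hK⟩ := P.e_small M
  exact ⟨K, fun y p q h => hM _ ((P.small M).smul_mem y (hK p q h))⟩

theorem exists_mul_e_small (N : ℕ) : ∃ K : ℤ, ∀ y p q, K ≤ q - p → y * P.e p q ∈ P.small N := by
  obtain ⟨K, hK⟩ := P.e_small N
  exact ⟨K, fun y p q h => (P.small N).smul_mem y (hK p q h)⟩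

theorem triple_mem_grade {p q r s u v : ℤ}
    (h : q / (n : ℤ) - p / n + (s / n - r / n) + (v / n - u / n) = 0) :
    P.e p q * P.e r s * P.e u v ∈ P.grade 0 := by
  have := P.mul_grade (P.mul_grade (P.e_grade p q) (P.e_grade r s)) (P.e_grade u v)
  rwa [h] at this

/-- For `p < i` and `m < j` put `a = e i p`, `b = e p i`, `c = e j m`, `d = e m j`. The commutator of
`a b` with `c d` is `a [b, c] d + [a, c] b d + c a [b, d] + c [a, d] b`. The triple products in it are
summable separately; this one comes from `[b, c]`. In each of them the factor `c` or `d` outside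
the bracket is rewritten, by periodicity, in terms of the indices that the bracket produces. -/
theorem summable_bracket_bc (i j : ℤ) : Summable (pairBelow i j (fun p m => (n : ℤ) ∣ p - m) fun p m =>
    P.e i p * P.e (j + p - m) i * P.e p (j + p - m)) := by
  refine P.summable_pairBelow (d := 0) (fun p _ m _ _ => P.triple_mem_grade (by ring))
    (fun N => ?_) fun N m hm => ?_
  · obtain ⟨K, hK⟩ := P.exists_mul_e_small N
    exact ⟨j - K, fun p _ m hm _ => hK _ _ _ (by omega)⟩
  · obtain ⟨K, hK⟩ := P.exists_e_mul_small N (P.e m j)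
    refine ⟨i - j + m - K, fun p hp h => ?_⟩
    rw [P.e_congr hm.ne h (by ring)]
    exact hK _ _ _ (by omega)

theorem summable_bracket_ac_inner (i j : ℤ) : Summable (pairBelow i j (fun p m => (n : ℤ) ∣ p - j) fun p m =>
    P.e i (m + p - j) * P.e p i * P.e (m + p - j) p) := by
  refine P.summable_pairBelow (d := 0) (fun p _ m _ _ => P.triple_mem_grade (by ring))
    (fun N => ?_) fun N m hm => ?_
  · obtain ⟨K, hK⟩ := P.exists_mul_e_small N
    exact ⟨j - K, fun p _ m hm _ => hK _ _ _ (by omega)⟩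
  · obtain ⟨K, hK⟩ := P.exists_e_mul_small N (P.e m j)
    refine ⟨i - K, fun p hp h => ?_⟩
    rw [P.e_congr (p' := m + p - j) hm.ne (by rwa [show m + p - j - m = p - j by ring]) (by ring)]
    exact hK _ _ _ (by omega)

theorem summable_bracket_ac_outer (i j : ℤ) : Summable (pairBelow i j (fun p m => (n : ℤ) ∣ i - m) fun p m =>
    P.e (j + i - m) p * P.e p i * P.e i (j + i - m)) := by
  refine P.summable_pairBelow (d := 0) (fun p _ m _ _ => P.triple_mem_grade (by ring))
    (fun N => ?_) fun N m hm => ?_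
  · obtain ⟨K, hK⟩ := P.exists_mul_e_small N
    exact ⟨j - K, fun p _ m hm _ => hK _ _ _ (by omega)⟩
  · obtain ⟨K, hK⟩ := P.exists_e_mul_small N (P.e i (j + i - m))
    exact ⟨i - K, fun p hp h => hK _ _ _ (by omega)⟩

theorem summable_bracket_bd_outer (i j : ℤ) : Summable (pairBelow i j (fun p m => (n : ℤ) ∣ p - j) fun p m =>
    P.e p (m + p - j) * P.e i p * P.e (m + p - j) i) := by
  refine P.summable_pairBelow (d := 0) (fun p _ m _ _ => P.triple_mem_grade (by ring))
    (fun N => ?_) fun N m hm => ?_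
  · obtain ⟨K, hK⟩ := P.exists_mul_e_small N
    exact ⟨j - K, fun p _ m hm _ => hK _ _ _ (by omega)⟩
  · obtain ⟨K, hK⟩ := P.exists_mul_e_small N
    exact ⟨i - m + j - K, fun p hp h => hK _ _ _ (by omega)⟩

theorem summable_bracket_bd_inner (i j : ℤ) : Summable (pairBelow i j (fun p m => (n : ℤ) ∣ i - m) fun p m =>
    P.e (j + i - m) i * P.e i p * P.e p (j + i - m)) := by
  refine P.summable_pairBelow (d := 0) (fun p _ m _ _ => P.triple_mem_grade (by ring))
    (fun N => ?_) fun N m hm => ?_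
  · obtain ⟨K, hK⟩ := P.exists_mul_e_small N
    exact ⟨j - K, fun p _ m hm _ => hK _ _ _ (by omega)⟩
  · obtain ⟨K, hK⟩ := P.exists_mul_e_small N
    exact ⟨j + i - m - K, fun p hp h => hK _ _ _ (by omega)⟩

theorem summable_bracket_ad (i j : ℤ) : Summable (pairBelow i j (fun p m => (n : ℤ) ∣ p - m) fun p m =>
    P.e (j + p - m) p * P.e i (j + p - m) * P.e p i) := by
  refine P.summable_pairBelow' (d := 0) (fun p _ m _ _ => P.triple_mem_grade (by ring))
    (fun N => ?_) fun N p hp => ?_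
  · obtain ⟨K, hK⟩ := P.exists_mul_e_small N
    exact ⟨i - K, fun m _ p hp _ => hK _ _ _ (by omega)⟩
  · obtain ⟨K, hK⟩ := P.exists_e_mul_small N (P.e p i)
    exact ⟨j + p - i - K, fun m hm h => hK _ _ _ (by omega)⟩

/-- The difference of products by which the central terms of the brackets `[b, c]` and `[a, d]`
contribute to the commutator of two quadratic series. -/
def currentPair (i j D : ℤ) : R :=
  P.e i (i - D) * P.e (j - D) j - P.e j (j - D) * P.e (i - D) i

theorem mul_mem_grade_zero {p q r s : ℤ} (h : q / (n : ℤ) - p / n + (s / n - r / n) = 0) :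
    P.e p q * P.e r s ∈ P.grade 0 := by
  have := P.mul_grade (P.e_grade p q) (P.e_grade r s)
  rwa [h] at this

theorem sub_ediv_self {D : ℤ} (i : ℤ) (hD : (n : ℤ) ∣ D) : (i - D) / (n : ℤ) = i / n - D / n := by
  rw [Int.sub_ediv_of_dvd _ hD]

/-- The central contributions: a product of two matrix units with opposite shifts `-D` and `D`, with
coefficient `D / n` where `D = i - p`. -/
theorem summable_bracket_central (i j : ℤ) : Summable (pairBelow i j
    (fun p m => (n : ℤ) ∣ i - p ∧ j - m = i - p) fun p _ =>
      (((i - p) / n : ℤ) : ℂ) • P.currentPair i j (i - p)) := by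
  have key : ∀ p m, ((n : ℤ) ∣ i - p ∧ j - m = i - p) → ∀ N, ∀ K : ℤ,
      (∀ y p q, K ≤ q - p → y * P.e p q ∈ P.small N) → m ≤ j - K →
      (((i - p) / n : ℤ) : ℂ) • P.currentPair i j (i - p) ∈ P.small N := by
    intro p m h N K hK hm
    rw [← algebraMap_smul R, smul_eq_mul]
    refine (P.small N).smul_mem _ (sub_mem (hK _ _ _ (by omega)) (hK _ _ _ (by omega)))
  refine P.summable_pairBelow (d := 0) (fun p _ m _ h => ?_) (fun N => ?_) fun N m hm => ?_
  · refine Submodule.smul_mem _ _ (sub_mem (P.mul_mem_grade_zero ?_) (P.mul_mem_grade_zero ?_)) <;>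
    · rw [sub_ediv_self _ h.1, sub_ediv_self _ h.1]; ring
  · obtain ⟨K, hK⟩ := P.exists_mul_e_small N
    exact ⟨j - K, fun p _ m hm h => key p m h N K hK hm⟩
  · obtain ⟨K, hK⟩ := P.exists_mul_e_small N
    exact ⟨i - K, fun p hp h => key p m h N K hK (by omega)⟩

/-- The commutator of two terms of the diagonal series at `i` and at `j`, written as six triple products
and a central contribution. -/
theorem pair_lie (hij : ¬ (n : ℤ) ∣ i - j) (p m : ℤ) (hp : p < i) (hm : m < j) :
    ⁅P.e i p * P.e p i, P.e j m * P.e m j⁆ =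
      -(if (n : ℤ) ∣ p - m then P.e i p * P.e (j + p - m) i * P.e p (j + p - m) else 0)
      + (if (n : ℤ) ∣ p - j then P.e i (m + p - j) * P.e p i * P.e (m + p - j) p else 0)
      - (if (n : ℤ) ∣ i - m then P.e (j + i - m) p * P.e p i * P.e i (j + i - m) else 0)
      - (if (n : ℤ) ∣ p - j then P.e p (m + p - j) * P.e i p * P.e (m + p - j) i else 0)
      + (if (n : ℤ) ∣ i - m then P.e (j + i - m) i * P.e i p * P.e p (j + i - m) else 0)
      + (if (n : ℤ) ∣ p - m then P.e (j + p - m) p * P.e i (j + p - m) * P.e p i else 0)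
      + (if (n : ℤ) ∣ i - p ∧ j - m = i - p then
          (((i - p) / n : ℤ) : ℂ) • P.currentPair i j (i - p) else 0) := by
  have hji : ¬ (n : ℤ) ∣ j - i := by rwa [dvd_sub_comm]
  have bc : ⁅P.e p i, P.e j m⁆ = -(if (n : ℤ) ∣ p - m then P.e (j + p - m) i else 0)
      + if (n : ℤ) ∣ i - p ∧ j - m = i - p then algebraMap ℂ R (((i - p) / n : ℤ) : ℂ) else 0 := by
    rw [P.e_lie, if_neg hij, zero_sub, if_congr (dvd_sub_comm (b := m) (c := p)) rfl rfl]
    congr 1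
    refine if_congr (and_congr_right fun _ => by omega) rfl rfl
  have ac : ⁅P.e i p, P.e j m⁆ = (if (n : ℤ) ∣ p - j then P.e i (m + p - j) else 0)
      - (if (n : ℤ) ∣ i - m then P.e (j + i - m) p else 0) := by
    rw [P.e_lie, if_neg (c := (n : ℤ) ∣ p - i ∧ _) (by omega), add_zero,
      if_congr (dvd_sub_comm (b := m) (c := i)) rfl rfl]
  have bd : ⁅P.e p i, P.e m j⁆ = (if (n : ℤ) ∣ i - m then P.e p (j + i - m) else 0)
      - (if (n : ℤ) ∣ p - j then P.e (m + p - j) i else 0) := by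
    rw [P.e_lie, if_neg (c := (n : ℤ) ∣ i - p ∧ _) (by omega), add_zero,
      if_congr (dvd_sub_comm (b := j) (c := p)) rfl rfl]
  have ad : ⁅P.e i p, P.e m j⁆ = (if (n : ℤ) ∣ p - m then P.e i (j + p - m) else 0)
      - if (n : ℤ) ∣ i - p ∧ j - m = i - p then algebraMap ℂ R (((i - p) / n : ℤ) : ℂ) else 0 := by
    rw [P.e_lie, if_neg hji, sub_zero]
    refine (congrArg _ ?_).trans (sub_eq_add_neg _ _).symm
    by_cases h : (n : ℤ) ∣ i - p ∧ j - m = i - p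
    · rw [if_pos h, if_pos (c := (n : ℤ) ∣ p - i ∧ _) ⟨dvd_sub_comm.mp h.1, by omega⟩,
        show p - i = -(i - p) by ring, Int.neg_ediv_of_dvd h.1]
      simp
    · rw [if_neg h, if_neg (c := (n : ℤ) ∣ p - i ∧ _), neg_zero]
      exact fun h' => h ⟨dvd_sub_comm.mp h'.1, by omega⟩
  rw [mul_lie_mul_ring, bc, ac, bd, ad]
  have e1 : (if (n : ℤ) ∣ p - m then P.e i p * P.e (j + p - m) i * P.e p (j + p - m) else 0)
      = P.e i p * (if (n : ℤ) ∣ p - m then P.e (j + p - m) i else 0) * P.e m j := by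
    split_ifs with h
    · rw [P.e_congr hm.ne h (by ring)]
    · simp
  have e2 : (if (n : ℤ) ∣ p - j then P.e i (m + p - j) * P.e p i * P.e (m + p - j) p else 0)
      = (if (n : ℤ) ∣ p - j then P.e i (m + p - j) else 0) * P.e p i * P.e m j := by
    split_ifs with h
    · rw [P.e_congr (p' := m + p - j) hm.ne (by rwa [show m + p - j - m = p - j by ring]) (by ring)]
    · simp
  have e3 : (if (n : ℤ) ∣ i - m then P.e (j + i - m) p * P.e p i * P.e i (j + i - m) else 0)
      = (if (n : ℤ) ∣ i - m then P.e (j + i - m) p else 0) * P.e p i * P.e m j := by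
    split_ifs with h
    · rw [P.e_congr hm.ne h (by ring)]
    · simp
  have e4 : (if (n : ℤ) ∣ p - j then P.e p (m + p - j) * P.e i p * P.e (m + p - j) i else 0)
      = P.e j m * P.e i p * (if (n : ℤ) ∣ p - j then P.e (m + p - j) i else 0) := by
    split_ifs with h
    · rw [P.e_congr hm.ne' h (by ring)]
    · simp
  have e5 : (if (n : ℤ) ∣ i - m then P.e (j + i - m) i * P.e i p * P.e p (j + i - m) else 0)
      = P.e j m * P.e i p * (if (n : ℤ) ∣ i - m then P.e p (j + i - m) else 0) := by
    split_ifs with h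
    · rw [P.e_congr (p' := j + i - m) hm.ne' (by rwa [show j + i - m - j = i - m by ring]) (by ring)]
    · simp
  have e6 : (if (n : ℤ) ∣ p - m then P.e (j + p - m) p * P.e i (j + p - m) * P.e p i else 0)
      = P.e j m * (if (n : ℤ) ∣ p - m then P.e i (j + p - m) else 0) * P.e p i := by
    split_ifs with h
    · rw [P.e_congr (p' := j + p - m) hm.ne' (by rwa [show j + p - m - j = p - m by ring]) (by ring)]
    · simp
  have e7 : (if (n : ℤ) ∣ i - p ∧ j - m = i - p then
          (((i - p) / n : ℤ) : ℂ) • P.currentPair i j (i - p) else 0)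
      = P.e i p * (if (n : ℤ) ∣ i - p ∧ j - m = i - p then
          algebraMap ℂ R (((i - p) / n : ℤ) : ℂ) else 0) * P.e m j
        - P.e j m * (if (n : ℤ) ∣ i - p ∧ j - m = i - p then
          algebraMap ℂ R (((i - p) / n : ℤ) : ℂ) else 0) * P.e p i := by
    split_ifs with h
    · rw [currentPair, show i - (i - p) = p by ring, show j - (i - p) = m by omega,
        Algebra.algebraMap_eq_smul_one]
      simp only [mul_smul_comm, smul_mul_assoc, mul_one, smul_sub]
    · simp
  rw [e1, e2, e3, e4, e5, e6, e7]
  noncomm_ring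

variable [IsTopologicalRing R] [T2Space R]

omit [Algebra ℂ R] [IsTopologicalRing R] [T2Space R] in
theorem hasSum_reindex {f g : ℤ × ℤ → R} {s : R} (e : ℤ × ℤ ≃ ℤ × ℤ) (h : HasSum f s)
    (hf : ∀ x, f x = g (e x)) : HasSum g s :=
  e.hasSum_iff.mp (hasSum_of_eq h hf)

omit [IsTopologicalRing R] [T2Space R] in
theorem summable_Q_mul_Q (i j : ℤ) : Summable fun x : ℤ × ℤ =>
    below i (fun p => P.e i p * P.e p i) x.1 * below j (fun m => P.e j m * P.e m j) x.2 := by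
  have := P.summable_pairBelow (d := 0) (i := i) (j := j) (c := fun _ _ => True)
    (g := fun p m => P.e i p * P.e p i * (P.e j m * P.e m j)) (fun p _ m _ _ => ?_)
    (fun N => ?_) fun N m hm => ?_
  · refine this.congr fun x => ?_
    unfold pairBelow below
    split_ifs <;> simp_all
  · have := P.mul_grade (P.mul_mem_grade_zero (p := i) (q := p) (r := p) (s := i) (by ring))
      (P.mul_mem_grade_zero (p := j) (q := m) (r := m) (s := j) (by ring))
    rwa [add_zero] at this
  · obtain ⟨K, hK⟩ := P.exists_mul_e_small N
    refine ⟨j - K, fun p _ m hm _ => ?_⟩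
    rw [← mul_assoc]
    exact hK _ _ _ (by omega)
  · obtain ⟨K, hK⟩ := P.exists_e_mul_small N (P.e j m * P.e m j)
    exact ⟨i - K, fun p hp h => hK _ _ _ (by omega)⟩

omit [IsTopologicalRing R] [T2Space R] in
/-- Among the integers `J` of the residue class of `j`, which does not contain `i`, exactly `D / n` have
`i` strictly between `J - D` and `J`. -/
theorem card_between {D : ℤ} (hn : 0 < n) (hij : ¬ (n : ℤ) ∣ i - j) (hD : (n : ℤ) ∣ D) (h0 : 0 < D)
    (x : R) : HasSum (fun J : ℤ => if (n : ℤ) ∣ J - j ∧ J - D < i ∧ i < J then x else 0)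
      ((((D / n : ℤ)) : ℂ) • x) := by
  obtain ⟨r, rfl⟩ := hD
  have hn' : (0 : ℤ) < n := by exact_mod_cast hn
  have hr : 0 < r := by
    by_contra h
    exact absurd h0 (not_lt.mpr (mul_nonpos_of_nonneg_of_nonpos hn'.le (not_lt.mp h)))
  set a := (i - j) / (n : ℤ) with ha
  have h1 := Int.emod_add_mul_ediv (i - j) n
  have h2 := Int.emod_nonneg (i - j) hn'.ne'
  have h3 := Int.emod_lt_of_pos (i - j) hn'
  have h4 : (i - j) % n ≠ 0 := fun h => hij (Int.dvd_of_emod_eq_zero h)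
  have hinj : Function.Injective fun k : ℤ => j + n * k := fun k l hkl =>
    mul_left_cancel₀ hn'.ne' (add_left_cancel hkl)
  have hs : HasSum (fun J : ℤ => if (n : ℤ) ∣ J - j ∧ J - n * r < i ∧ i < J then x else 0)
      (∑ J ∈ (Finset.Ioc a (a + r)).image fun k => j + n * k,
        if (n : ℤ) ∣ J - j ∧ J - n * r < i ∧ i < J then x else 0) := by
    refine hasSum_sum_of_ne_finset_zero fun J hJ => if_neg ?_
    rintro ⟨⟨k, hk⟩, hlt, hgt⟩
    refine hJ (Finset.mem_image.mpr ⟨k, Finset.mem_Ioc.mpr ⟨?_, ?_⟩, by linarith⟩)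
    · by_contra h
      nlinarith
    · by_contra h
      nlinarith
  rw [Finset.sum_image hinj.injOn, Finset.sum_congr rfl (g := fun _ => x)] at hs
  · rw [Finset.sum_const, Int.card_Ioc, add_sub_cancel_left] at hs
    rw [Int.mul_ediv_cancel_left _ hn'.ne']
    convert hs using 1
    rw [← Nat.cast_smul_eq_nsmul ℂ]
    congr 1
    exact_mod_cast (Int.toNat_of_nonneg hr.le).symm
  · intro k hk
    rw [Finset.mem_Ioc] at hk
    refine if_pos ⟨⟨k, by ring⟩, ?_, ?_⟩
    · have := mul_le_mul_of_nonneg_left hk.2 hn'.le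
      have h4' := lt_of_le_of_ne h2 h4.symm
      rw [mul_add] at this
      linarith
    · have := mul_le_mul_of_nonneg_left (Int.add_one_le_of_lt hk.1) hn'.le
      rw [mul_add] at this
      linarith

/-- The diagonal series at `i` and `j` commute when `i` and `j` have different residues. In suitable
coordinates `(M, J)`, with `J` in the residue class of `j`, the six triple products cancel except for
`M < i < J`, where they combine to commutators which are again products of two matrix units; these
depend on `D = J - M` only, and counting the possible `J` for a given `D` shows that they cancel the
central contributions. -/
theorem commute_Q_of_not_dvd (hn : 0 < n) (hij : ¬ (n : ℤ) ∣ i - j) :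
    Commute (P.Q i i i) (P.Q j j j) := by
  have hf := P.hasSum_Q i i i
  have hg := P.hasSum_Q j j j
  have hF1 := hf.mul hg (P.summable_Q_mul_Q i j)
  have hF2 := (Equiv.prodComm ℤ ℤ).hasSum_iff.mpr (hg.mul hf (P.summable_Q_mul_Q j i))
  have hF := hF1.sub hF2
  have h1 := (P.summable_bracket_bc i j).hasSum
  have h2 := (P.summable_bracket_ac_inner i j).hasSum
  have h3 := (P.summable_bracket_ac_outer i j).hasSum
  have h4 := (P.summable_bracket_bd_outer i j).hasSum
  have h5 := (P.summable_bracket_bd_inner i j).hasSum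
  have h6 := (P.summable_bracket_ad i j).hasSum
  have h7 := (P.summable_bracket_central i j).hasSum
  generalize tsum (pairBelow i j (fun p m => (n : ℤ) ∣ p - m) fun p m =>
    P.e i p * P.e (j + p - m) i * P.e p (j + p - m)) = s1 at h1
  generalize tsum (pairBelow i j (fun p m => (n : ℤ) ∣ p - j) fun p m =>
    P.e i (m + p - j) * P.e p i * P.e (m + p - j) p) = s2 at h2
  generalize tsum (pairBelow i j (fun p m => (n : ℤ) ∣ i - m) fun p m =>
    P.e (j + i - m) p * P.e p i * P.e i (j + i - m)) = s3 at h3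
  generalize tsum (pairBelow i j (fun p m => (n : ℤ) ∣ p - j) fun p m =>
    P.e p (m + p - j) * P.e i p * P.e (m + p - j) i) = s4 at h4
  generalize tsum (pairBelow i j (fun p m => (n : ℤ) ∣ i - m) fun p m =>
    P.e (j + i - m) i * P.e i p * P.e p (j + i - m)) = s5 at h5
  generalize tsum (pairBelow i j (fun p m => (n : ℤ) ∣ p - m) fun p m =>
    P.e (j + p - m) p * P.e i (j + p - m) * P.e p i) = s6 at h6
  generalize tsum (pairBelow i j (fun p m => (n : ℤ) ∣ i - p ∧ j - m = i - p) fun p _ =>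
      (((i - p) / n : ℤ) : ℂ) • P.currentPair i j (i - p)) = s7 at h7
  have hsum := (((((h1.neg.add h2).sub h3).sub h4).add h5).add h6).add h7
  have heq := hF.unique (hasSum_of_eq hsum fun x => ?_)
  swap
  · obtain ⟨p, m⟩ := x
    by_cases hx : p < i ∧ m < j
    · have := P.pair_lie hij p m hx.1 hx.2
      simp only [Ring.lie_def] at this
      simp only [below, pairBelow, hx.1, hx.2, true_and, if_true, Function.comp_apply,
        Equiv.prodComm_apply, Prod.swap_prod_mk]
      rw [this]
    · have hx' : ∀ q : Prop, ¬ (p < i ∧ m < j ∧ q) := fun q hq => hx ⟨hq.1, hq.2.1⟩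
      simp only [below, pairBelow, hx', if_false, Function.comp_apply,
        Equiv.prodComm_apply, Prod.swap_prod_mk]
      by_cases hp : p < i
      · have hm : ¬ m < j := fun hm => hx ⟨hp, hm⟩
        simp [hm]
      · simp [hp]
  -- the six triple products in the coordinates `(M, J)`
  have k1 : HasSum (fun y : ℤ × ℤ => if (n : ℤ) ∣ y.2 - j ∧ y.1 < i ∧ y.1 < y.2 then
      P.e i y.1 * P.e y.2 i * P.e y.1 y.2 else 0) s1 := by
    refine hasSum_reindex ⟨fun x => (x.1, j + x.1 - x.2), fun y => (y.1, j + y.1 - y.2),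
      fun x => by ext <;> simp, fun x => by ext <;> simp⟩ h1 fun x => if_congr ?_ rfl rfl
    simp only [Equiv.coe_fn_mk, show j + x.1 - x.2 - j = x.1 - x.2 by ring]
    constructor
    · rintro ⟨a, b, c⟩; exact ⟨c, a, by omega⟩
    · rintro ⟨a, b, c⟩; exact ⟨b, by omega, a⟩
  have k6 : HasSum (fun y : ℤ × ℤ => if (n : ℤ) ∣ y.2 - j ∧ y.1 < i ∧ y.1 < y.2 then
      P.e y.2 y.1 * P.e i y.2 * P.e y.1 i else 0) s6 := by
    refine hasSum_reindex ⟨fun x => (x.1, j + x.1 - x.2), fun y => (y.1, j + y.1 - y.2),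
      fun x => by ext <;> simp, fun x => by ext <;> simp⟩ h6 fun x => if_congr ?_ rfl rfl
    simp only [Equiv.coe_fn_mk, show j + x.1 - x.2 - j = x.1 - x.2 by ring]
    constructor
    · rintro ⟨a, b, c⟩; exact ⟨c, a, by omega⟩
    · rintro ⟨a, b, c⟩; exact ⟨b, by omega, a⟩
  have k2 : HasSum (fun y : ℤ × ℤ => if (n : ℤ) ∣ y.2 - j ∧ y.2 < i ∧ y.1 < y.2 then
      P.e i y.1 * P.e y.2 i * P.e y.1 y.2 else 0) s2 := by
    refine hasSum_reindex ⟨fun x => (x.2 + x.1 - j, x.1), fun y => (y.2, y.1 + j - y.2),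
      fun x => by ext <;> simp, fun x => by ext <;> simp⟩ h2 fun x => if_congr ?_ rfl rfl
    simp only [Equiv.coe_fn_mk]
    constructor
    · rintro ⟨a, b, c⟩; exact ⟨c, a, by omega⟩
    · rintro ⟨a, b, c⟩; exact ⟨b, by omega, a⟩
  have k4 : HasSum (fun y : ℤ × ℤ => if (n : ℤ) ∣ y.2 - j ∧ y.2 < i ∧ y.1 < y.2 then
      P.e y.2 y.1 * P.e i y.2 * P.e y.1 i else 0) s4 := by
    refine hasSum_reindex ⟨fun x => (x.2 + x.1 - j, x.1), fun y => (y.2, y.1 + j - y.2),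
      fun x => by ext <;> simp, fun x => by ext <;> simp⟩ h4 fun x => if_congr ?_ rfl rfl
    simp only [Equiv.coe_fn_mk]
    constructor
    · rintro ⟨a, b, c⟩; exact ⟨c, a, by omega⟩
    · rintro ⟨a, b, c⟩; exact ⟨b, by omega, a⟩
  have k3 : HasSum (fun y : ℤ × ℤ => if (n : ℤ) ∣ y.2 - j ∧ y.1 < i ∧ i < y.2 then
      P.e y.2 y.1 * P.e y.1 i * P.e i y.2 else 0) s3 := by
    refine hasSum_reindex ⟨fun x => (x.1, j + i - x.2), fun y => (y.1, j + i - y.2),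
      fun x => by ext <;> simp, fun x => by ext <;> simp⟩ h3 fun x => if_congr ?_ rfl rfl
    simp only [Equiv.coe_fn_mk, show j + i - x.2 - j = i - x.2 by ring]
    constructor
    · rintro ⟨a, b, c⟩; exact ⟨c, a, by omega⟩
    · rintro ⟨a, b, c⟩; exact ⟨b, by omega, a⟩
  have k5 : HasSum (fun y : ℤ × ℤ => if (n : ℤ) ∣ y.2 - j ∧ y.1 < i ∧ i < y.2 then
      P.e y.2 i * P.e i y.1 * P.e y.1 y.2 else 0) s5 := by
    refine hasSum_reindex ⟨fun x => (x.1, j + i - x.2), fun y => (y.1, j + i - y.2),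
      fun x => by ext <;> simp, fun x => by ext <;> simp⟩ h5 fun x => if_congr ?_ rfl rfl
    simp only [Equiv.coe_fn_mk, show j + i - x.2 - j = i - x.2 by ring]
    constructor
    · rintro ⟨a, b, c⟩; exact ⟨c, a, by omega⟩
    · rintro ⟨a, b, c⟩; exact ⟨b, by omega, a⟩
  have ksum := ((((k1.neg.add k2).sub k3).sub k4).add k5).add k6
  -- the ranges of the six products differ by the strip `M < i < J`; here `y` is `(J - M, J)`
  have hcancel : HasSum (fun y : ℤ × ℤ =>
      if (n : ℤ) ∣ y.2 - j ∧ (n : ℤ) ∣ y.1 ∧ y.2 - y.1 < i ∧ i < y.2 then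
        P.currentPair i j y.1 else 0) (-(-s1 + s2 - s3 - s4 + s5 + s6)) := by
    refine hasSum_reindex ⟨fun x => (x.2 - x.1, x.2), fun y => (y.2 - y.1, y.2),
      fun x => by ext <;> simp, fun x => by ext <;> simp⟩ ksum.neg fun y => ?_
    obtain ⟨M, J⟩ := y
    simp only [Equiv.coe_fn_mk, sub_sub_cancel]
    by_cases hJ : (n : ℤ) ∣ J - j
    swap
    · simp [hJ]
    have hJi : J ≠ i := by
      rintro rfl; exact hij hJ
    by_cases hM : M < i
    swap
    · have h' : ¬ (J < i ∧ M < J) := by omega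
      simp [hM, h']
    by_cases hiJ : i < J
    swap
    · have h' : J < i := by omega
      simp [hiJ, h', hM]
    have hMJ : M < J := by omega
    have hni : ¬ J < i := by omega
    have hiJ' : ¬ (n : ℤ) ∣ i - J := fun h => hij (by simpa using dvd_add h hJ)
    have hJi' : ¬ (n : ℤ) ∣ J - i := by rwa [dvd_sub_comm]
    have b1 : ⁅P.e J i, P.e i M⁆ =
        P.e J M - if (n : ℤ) ∣ J - M then P.e i (i - (J - M)) else 0 := by
      rw [P.e_lie, if_pos (by simp), if_neg (c := (n : ℤ) ∣ i - J ∧ _) (fun h => hiJ' h.1), add_zero,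
        add_sub_cancel_right, if_congr (dvd_sub_comm (b := M) (c := J)) rfl rfl]
      split_ifs with h
      · rw [P.e_congr (p := i) (q := i - (J - M)) (p' := i + J - M) (q' := i) (by omega)
          (by rwa [show i + J - M - i = J - M by ring]) (by ring)]
      · rfl
    have b2 : ⁅P.e i J, P.e M i⁆ =
        (if (n : ℤ) ∣ J - M then P.e (i - (J - M)) i else 0) - P.e M J := by
      rw [P.e_lie, if_pos (c := (n : ℤ) ∣ i - i) (by simp),
        if_neg (c := (n : ℤ) ∣ J - i ∧ _) (fun h => hJi' h.1), add_zero,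
        add_sub_cancel_right]
      split_ifs with h
      · rw [P.e_congr (p := i - (J - M)) (q := i) (p' := i) (q' := i + J - M) (by omega)
          (by rwa [show i - (i - (J - M)) = J - M by ring]) (by ring)]
      · rfl
    simp only [hJ, hM, hiJ, hMJ, hni, true_and, and_true, if_true, if_false]
    have b3 : (if (n : ℤ) ∣ J - M then P.currentPair i j (J - M) else 0) =
        (if (n : ℤ) ∣ J - M then P.e i (i - (J - M)) else 0) * P.e M J
        - P.e J M * if (n : ℤ) ∣ J - M then P.e (i - (J - M)) i else 0 := by
      split_ifs with h
      · rw [currentPair, P.e_congr (p := M) (q := J) hMJ.ne (p' := j - (J - M))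
          (by rw [show j - (J - M) - M = -(J - j) by ring]; exact (dvd_neg.mpr hJ)) (by ring),
          P.e_congr (p := J) (q := M) hMJ.ne' (p' := j)
          (by rwa [dvd_sub_comm]) (by ring)]
      · simp
    rw [b3, eq_sub_of_add_eq' (eq_sub_iff_add_eq.mp b1.symm), eq_add_of_sub_eq b2.symm]
    simp only [Ring.lie_def]
    noncomm_ring
  -- the remaining terms only depend on the difference `D`
  have hD : HasSum (fun D : ℤ => if (n : ℤ) ∣ D ∧ 0 < D then
      ((D / n : ℤ) : ℂ) • P.currentPair i j D else 0) (-(-s1 + s2 - s3 - s4 + s5 + s6)) := by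
    refine hcancel.prod_fiberwise fun D => ?_
    split_ifs with h
    · refine hasSum_of_eq (card_between hn hij h.1 h.2 _) fun J => if_congr ?_ rfl rfl
      simp [h.1]
    · refine hasSum_of_eq hasSum_zero fun J => (if_neg ?_).symm
      rintro ⟨-, h1, h2, h3⟩
      exact h ⟨h1, by linarith⟩
  have hZ : HasSum (fun D : ℤ => if (n : ℤ) ∣ D ∧ 0 < D then
      ((D / n : ℤ) : ℂ) • P.currentPair i j D else 0) s7 := by
    have h7' : HasSum (fun y : ℤ × ℤ => if y.2 = j - y.1 ∧ (n : ℤ) ∣ y.1 ∧ 0 < y.1 then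
      ((y.1 / n : ℤ) : ℂ) • P.currentPair i j y.1 else 0) s7 := by
      refine hasSum_reindex ⟨fun x => (i - x.1, x.2), fun y => (i - y.1, y.2),
        fun x => by ext <;> simp, fun x => by ext <;> simp⟩ h7 fun x => if_congr ?_ rfl rfl
      simp only [Equiv.coe_fn_mk]
      constructor
      · rintro ⟨a, b, c, d⟩; exact ⟨by omega, c, by omega⟩
      · rintro ⟨a, b, c⟩; exact ⟨by omega, by omega, b, by omega⟩
    refine h7'.prod_fiberwise fun D => ?_
    refine hasSum_of_eq (hasSum_ite_eq (j - D) _) fun m => ?_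
    by_cases hm : m = j - D <;> simp [hm]
  have h0 := hD.unique hZ
  have : P.Q i i i * P.Q j j j - P.Q j j j * P.Q i i i = 0 := by
    rw [heq, ← h0, add_neg_cancel]
  exact sub_eq_zero.mp this

end PeriodicUnits

/-! ### The relations of the affine Yangian -/

namespace PeriodicUnits

variable {n : ℕ} {R : Type*} [Ring R] [Algebra ℂ R] [TopologicalSpace R]
  (P : PeriodicUnits n R)

theorem hasSum_Q_add_period (i p q : ℤ) :
    HasSum (below i fun m => P.e (p + n) (m + n) * P.e (m + n) (q + n))
      (P.Q (i + n) (p + n) (q + n)) := by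
  refine hasSum_of_eq ((Equiv.addRight (n : ℤ)).hasSum_iff.mpr
    (P.hasSum_Q (i + n) (p + n) (q + n))) fun m => ?_
  simp [below]

theorem raise_lie_raise_lie_raise (hn : 3 ≤ n) (i j : ℤ) :
    ⁅P.e (i - 1) i, ⁅P.e (i - 1) i, P.e (j - 1) j⁆⁆ = 0 := by
  have h2 : ∀ k : ℤ, k + 1 - (k - 1) = 2 := fun k => by ring
  have h2' : ∀ k : ℤ, k - (k - 1 - 1) = 2 := fun k => by ring
  have a1 : ⁅P.e (i - 1) i, P.e (i - 1) (i + 1)⁆ = 0 := by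
    rw [P.e_lie_of_not_dvd (by rw [h2]; exact not_dvd_two hn), h2]
    simp [not_dvd_one hn, not_dvd_two hn]
  have a2 : ⁅P.e (i - 1) i, P.e (i - 1 - 1) i⁆ = 0 := by
    rw [P.e_lie_of_not_dvd (by rw [h2']; exact not_dvd_two hn), h2']
    simp [not_dvd_one hn, not_dvd_two hn]
  rw [P.raise_lie_raise hn, lie_sub]
  split_ifs <;> simp [a1, a2]

theorem lower_lie_lower_lie_lower (hn : 3 ≤ n) (i j : ℤ) :
    ⁅P.e i (i - 1), ⁅P.e i (i - 1), P.e j (j - 1)⁆⁆ = 0 := by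
  have h2 : ∀ k : ℤ, k - 1 - (k + 1) = -2 := fun k => by ring
  have h2' : ∀ k : ℤ, k - 1 - 1 - k = -2 := fun k => by ring
  have a1 : ⁅P.e i (i - 1), P.e (i + 1) (i - 1)⁆ = 0 := by
    rw [P.e_lie_of_not_dvd (by rw [h2, dvd_neg]; exact not_dvd_two hn), h2]
    simp [not_dvd_one hn, not_dvd_two hn]
  have a2 : ⁅P.e i (i - 1), P.e i (i - 1 - 1)⁆ = 0 := by
    rw [P.e_lie_of_not_dvd (by rw [h2', dvd_neg]; exact not_dvd_two hn), h2']
    simp [not_dvd_one hn, not_dvd_two hn]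
  rw [P.lower_lie_lower hn, lie_sub]
  split_ifs <;> simp [a1, a2]

theorem cartan0_commute_cartan0 (i j : ℤ) : Commute (P.cartan0 i) (P.cartan0 j) :=
  ((P.diag_commute _ _).sub_left (P.diag_commute _ _)).sub_right
    ((P.diag_commute _ _).sub_left (P.diag_commute _ _))

variable [IsTopologicalRing R] [T2Space R]

omit [IsTopologicalRing R] in
theorem Q_self_add_period (i : ℤ) : P.Q (i + n) (i + n) (i + n) = P.Q i i i := by
  refine (P.hasSum_Q_add_period i i i).unique (hasSum_of_eq (P.hasSum_Q i i i) fun m => ?_)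
  unfold below
  split_ifs with h
  · beta_reduce
    rw [P.e_shift_of_ne h.ne, P.e_shift_of_ne h.ne']
  · rfl

/-- The term with `m = i - 1` of the series contains the diagonal element `e (i - 1) (i - 1)`, which is
not periodic. -/
theorem Q_raise_add_period (i : ℤ) :
    P.Q (i + n) (i - 1 + n) (i + n) = P.Q i (i - 1) i - P.level • P.e (i - 1) i := by
  refine (P.hasSum_Q_add_period i (i - 1) i).unique (hasSum_of_eq ((P.hasSum_Q i (i - 1) i).sub
    (hasSum_ite_eq (i - 1) (P.level • P.e (i - 1) i))) fun m => ?_)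
  unfold below
  by_cases h : m < i
  · rw [if_pos h, if_pos h]
    beta_reduce
    rw [P.e_shift_of_ne h.ne, P.e_shift]
    by_cases hm : m = i - 1
    · subst hm
      rw [if_pos rfl, if_pos rfl, sub_mul, Algebra.algebraMap_eq_smul_one, smul_mul_assoc, one_mul]
    · rw [if_neg hm, if_neg (Ne.symm hm), sub_zero, sub_zero]
  · rw [if_neg h, if_neg h, if_neg (by omega), sub_zero]

theorem Q_lower_add_period (i : ℤ) :
    P.Q (i + n) (i + n) (i - 1 + n) = P.Q i i (i - 1) - P.level • P.e i (i - 1) := by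
  refine (P.hasSum_Q_add_period i i (i - 1)).unique (hasSum_of_eq ((P.hasSum_Q i i (i - 1)).sub
    (hasSum_ite_eq (i - 1) (P.level • P.e i (i - 1)))) fun m => ?_)
  unfold below
  by_cases h : m < i
  · rw [if_pos h, if_pos h]
    beta_reduce
    rw [P.e_shift_of_ne h.ne', P.e_shift]
    by_cases hm : m = i - 1
    · subst hm
      rw [if_pos rfl, if_pos rfl, mul_sub, Algebra.algebraMap_eq_smul_one, mul_smul_comm, mul_one]
    · rw [if_neg hm, if_neg hm, sub_zero, sub_zero]
  · rw [if_neg h, if_neg h, if_neg (by omega), sub_zero]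

theorem raise1_add_period (t : ℂ) (i : ℤ) :
    P.raise1 t (i + n) = P.raise1 t i - (n / 2 + P.level) • P.e (i - 1) i := by
  rw [raise1, raise1, show i + (n : ℤ) - 1 = i - 1 + n by ring, Q_raise_add_period,
    P.e_shift_of_ne (by omega)]
  push_cast
  module

theorem lower1_add_period (t : ℂ) (i : ℤ) :
    P.lower1 t (i + n) = P.lower1 t i - (n / 2 + P.level) • P.e i (i - 1) := by
  rw [lower1, lower1, show i + (n : ℤ) - 1 = i - 1 + n by ring, Q_lower_add_period,
    P.e_shift_of_ne (by omega)]
  push_cast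
  module

theorem Q_self_add_mul (i k : ℤ) : P.Q (i + n * k) (i + n * k) (i + n * k) = P.Q i i i := by
  induction k with
  | zero => simp
  | succ k ih => rw [← ih, ← P.Q_self_add_period (i + n * k)]; congr 1 <;> ring
  | pred k ih => rw [← ih, ← P.Q_self_add_period (i + n * (-k - 1))]; congr 1 <;> ring

theorem commute_Q (hn : 0 < n) (i j : ℤ) : Commute (P.Q i i i) (P.Q j j j) := by
  by_cases h : (n : ℤ) ∣ i - j
  · obtain ⟨k, hk⟩ := h
    rw [show i = j + n * k by linarith, Q_self_add_mul]
  · exact P.commute_Q_of_not_dvd hn h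

theorem diag_commute_Q (i j : ℤ) : Commute (P.e j j) (P.Q i i i) := by
  have := P.diag_lie_Q i i i j
  rw [if_congr (dvd_sub_comm (b := j) (c := i)) rfl rfl, sub_self, zero_smul, Ring.lie_def,
    sub_eq_zero] at this
  exact this

/-- What commutes with the diagonal elements and the diagonal series commutes with `cartan1`: by
`Q_add_one`, the series `Q i (i - 1) (i - 1)` is the diagonal series at `i - 1` up to a product of
diagonal elements. -/
theorem cartan1_commute_of {t : ℂ} {i : ℤ} {y : R} (h1 : ∀ k, Commute (P.e k k) y)
    (h2 : ∀ k, Commute (P.Q k k k) y) : Commute (P.cartan1 t i) y := by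
  have hQ := P.Q_add_one (i - 1) (i - 1) (i - 1)
  rw [sub_add_cancel] at hQ
  rw [cartan1, cartan0, hQ]
  exact (((((h1 _).sub_left (h1 _)).smul_left _).sub_left ((h1 _).mul_left (h1 _))).add_left
    ((h2 _).add_left ((h1 _).mul_left (h1 _)))).sub_left (h2 _)

theorem cartan1_commute_diag (t : ℂ) (i j : ℤ) : Commute (P.cartan1 t i) (P.e j j) :=
  P.cartan1_commute_of (fun k => P.diag_commute k j) fun k => (P.diag_commute_Q k j).symm

theorem cartan1_commute_cartan0 (t : ℂ) (i j : ℤ) : Commute (P.cartan1 t i) (P.cartan0 j) :=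
  (P.cartan1_commute_diag t i _).sub_right (P.cartan1_commute_diag t i _)

theorem cartan1_commute_cartan1 (hn : 0 < n) (t : ℂ) (i j : ℤ) :
    Commute (P.cartan1 t i) (P.cartan1 t j) :=
  P.cartan1_commute_of (fun k => (P.cartan1_commute_diag t j k).symm) fun k =>
    (P.cartan1_commute_of (fun l => P.diag_commute_Q k l) fun l => P.commute_Q hn l k).symm

/-- The values of the generators `H_{i,r}` under the evaluation map, with `t` as in `raise1`. -/
def genH (ħ t : ℂ) (i : Fin n) (r : Fin 2) : R :=
  if r = 0 then P.cartan0 i.val else ħ • P.cartan1 t i.val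

/-- The values of the generators `X_{i,r}^±` under the evaluation map, with `t` as in `raise1`. -/
def genX (ħ t : ℂ) (σ : ℤˣ) (i : Fin n) (r : Fin 2) : R :=
  if σ = 1 then
    if r = 0 then P.e (i.val - 1) i.val else ħ • P.raise1 t i.val
  else
    if r = 0 then P.e i.val (i.val - 1) else ħ • P.lower1 t i.val

end PeriodicUnits

section Nodes

variable {n : ℕ}

theorem dvd_iff_of_bounds {x : ℤ} (h1 : -(n : ℤ) < x) (h2 : x ≤ n) :
    (n : ℤ) ∣ x ↔ x = 0 ∨ x = n := by
  constructor
  · intro h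
    rcases lt_trichotomy x 0 with h0 | h0 | h0
    · have := Int.le_of_dvd (by omega) ((dvd_neg (α := ℤ)).mpr h)
      omega
    · exact Or.inl h0
    · have := Int.le_of_dvd h0 h
      omega
  · rintro (rfl | rfl) <;> simp

theorem dvd_sub_iff (i j : Fin n) : (n : ℤ) ∣ (i.val : ℤ) - j.val ↔ i = j := by
  have := i.isLt; have := j.isLt
  rw [dvd_iff_of_bounds (by omega) (by omega), Fin.ext_iff]
  omega

theorem dvd_add_one_sub_iff (i j : Fin n) : (n : ℤ) ∣ (i.val : ℤ) + 1 - j.val ↔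
    i.val + 1 = j.val ∨ (i.val + 1 = n ∧ j.val = 0) := by
  have := i.isLt; have := j.isLt
  rw [dvd_iff_of_bounds (by omega) (by omega)]
  omega

theorem dvd_sub_one_sub_iff (i j : Fin n) : (n : ℤ) ∣ (i.val : ℤ) - 1 - j.val ↔
    j.val + 1 = i.val ∨ (i.val = 0 ∧ j.val + 1 = n) := by
  have := i.isLt; have := j.isLt
  rw [dvd_sub_comm, dvd_iff_of_bounds (by omega) (by omega)]
  omega

theorem cartan_eq (hn : 3 ≤ n) (i j : Fin n) : (cartan i j : ℂ) =
    2 * (if (n : ℤ) ∣ (i.val : ℤ) - j.val then 1 else 0)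
      - (if (n : ℤ) ∣ (i.val : ℤ) + 1 - j.val then 1 else 0)
      - (if (n : ℤ) ∣ (i.val : ℤ) - 1 - j.val then 1 else 0) := by
  simp only [dvd_sub_iff, dvd_add_one_sub_iff, dvd_sub_one_sub_iff, cartan, Fin.ext_iff]
  have := i.isLt; have := j.isLt
  split_ifs <;> first | omega | norm_num

end Nodes

theorem units_cast_complex (σ : ℤˣ) : ((σ : ℤ) : ℂ) = if σ = 1 then 1 else -1 := by
  rcases Int.units_eq_one_or σ with rfl | rfl <;> simp

theorem cartan_cases (i j : Fin n) : (i = j ∧ cartan i j = 2) ∨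
    ((i.val + 1 = j.val ∨ j.val + 1 = i.val ∨ IsEndPair i j) ∧ cartan i j = -1) ∨
    ((¬ (n : ℤ) ∣ (i.val : ℤ) - j.val ∧ ¬ (n : ℤ) ∣ (i.val : ℤ) + 1 - j.val ∧
      ¬ (n : ℤ) ∣ (i.val : ℤ) - 1 - j.val) ∧ cartan i j = 0) := by
  simp only [dvd_sub_iff, dvd_add_one_sub_iff, dvd_sub_one_sub_iff, cartan, Fin.ext_iff, IsEndPair]
  have := i.isLt; have := j.isLt
  split_ifs <;> simp <;> omega

namespace PeriodicUnits

variable {R : Type*} [Ring R] [Algebra ℂ R] [TopologicalSpace R] (P : PeriodicUnits n R)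
  [IsTopologicalRing R] [T2Space R]

omit [IsTopologicalRing R] [T2Space R] in
theorem cartan1_sub_half_sq (ħ t : ℂ) (i : ℤ) :
    ħ • P.cartan1 t i - (ħ / 2) • P.cartan0 i ^ 2
      = ħ • (P.cartan1 t i - (1 / 2 : ℂ) • P.cartan0 i ^ 2) := by
  module

/-- The evaluation elements satisfy the relations of the affine Yangian. The relations between the nodes
`0` and `n - 1` are those between the consecutive integers `-1` and `0`: passing from the node `n - 1`
to `-1` changes `X_{n-1,1}^±` by the multiple of `X_{n-1,0}^±` computed in `raise1_add_period`, which is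
where the value of the level is used. -/
theorem guayRel (hn : 3 ≤ n) {ħ ε t : ℂ} (hl : ħ * P.level = -(n * ħ + ε)) {u v : R}
    (h : GuayRel ħ ε (P.genH ħ t) (P.genX ħ t) u v) : u = v := by
  have h10 : ¬ (1 : Fin 2) = 0 := by decide
  have hm1 : ¬ (-1 : ℤˣ) = 1 := by decide
  have hR : ∀ k : ℤ, ħ • P.raise1 t (k + n)
      = ħ • P.raise1 t k + (ε + n / 2 * ħ) • P.e (k - 1) k := fun k => by
    rw [P.raise1_add_period, smul_sub, smul_smul, sub_eq_add_neg, ← neg_smul]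
    congr 2; linear_combination -hl
  have hL : ∀ k : ℤ, ħ • P.lower1 t (k + n)
      = ħ • P.lower1 t k + (ε + n / 2 * ħ) • P.e k (k - 1) := fun k => by
    rw [P.lower1_add_period, smul_sub, smul_smul, sub_eq_add_neg, ← neg_smul]
    congr 2; linear_combination -hl
  induction h with
  | H_H i j r s =>
    have h1 := P.cartan0_commute_cartan0 i.val j.val
    have h2 := P.cartan1_commute_cartan0 t i.val j.val
    have h3 := P.cartan1_commute_cartan0 t j.val i.val
    have h4 := P.cartan1_commute_cartan1 (by omega) t i.val j.val
    rw [Ring.lie_def, sub_eq_zero]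
    change Commute _ _
    unfold genH
    split_ifs
    · exact h1
    · exact h3.symm.smul_right ħ
    · exact h2.smul_left ħ
    · exact (h4.smul_left ħ).smul_right ħ
  | X_X_zero i j =>
    simp only [genX, genH, if_true, hm1, if_false]
    rw [P.raise_lie_lower hn, if_congr (dvd_sub_iff i j) rfl rfl]
  | X_X_left i j =>
    simp only [genX, genH, if_true, hm1, if_false, h10]
    rw [smul_lie, P.raise1_lie_lower hn, if_congr (dvd_sub_iff i j) rfl rfl]
    split_ifs <;> simp
  | X_X_right i j =>
    simp only [genX, genH, if_true, hm1, if_false, h10]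
    rw [lie_smul, P.raise_lie_lower1 hn, if_congr ((dvd_sub_iff j i).trans eq_comm) rfl rfl]
    split_ifs with h
    · rw [h]
    · simp
  | H_X_zero σ i j r =>
    rw [cartan_eq hn, units_cast_complex]
    have h1 : ∀ k : ℤ, k - 1 - (j.val - 1) = k - j.val := fun k => by ring
    have h2 : ∀ k : ℤ, k - (j.val - 1) = k + 1 - j.val := fun k => by ring
    by_cases hσ : σ = 1 <;> by_cases hr : r = 0 <;> simp only [genX, genH, hσ, hr, if_true, if_false]
    · simp only [cartan0, sub_lie, diag_lie, h1, h2, dvd_sub_comm (b := (j.val : ℤ)) (c := i.val),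
        dvd_sub_comm (b := (j.val : ℤ)) (c := i.val - 1)]
      module
    · rw [lie_smul, cartan0_lie_raise1]
      module
    · simp only [cartan0, sub_lie, diag_lie, h1, h2,
        dvd_sub_comm (b := (j.val : ℤ) - 1) (c := i.val),
        dvd_sub_comm (b := (j.val : ℤ) - 1) (c := i.val - 1)]
      module
    · rw [lie_smul, cartan0_lie_lower1]
      module
  | H_X_one σ i j hij =>
    have hs := P.cartan1_sub_half_sq ħ t i.val
    rw [units_cast_complex]
    rcases cartan_cases i j with ⟨rfl, hc⟩ | ⟨h | h | h, hc⟩ | ⟨⟨ha, hb, hc'⟩, hc⟩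
    · by_cases hσ : σ = 1 <;> simp only [genX, genH, hσ, hc, if_true, if_false, h10] <;>
        rw [hs, smul_lie]
      · rw [P.cartan1_lie_raise hn]; push_cast; module
      · rw [P.cartan1_lie_lower hn]; push_cast; module
    · by_cases hσ : σ = 1 <;> simp only [genX, genH, hσ, hc, if_true, if_false, h10, ← h] <;>
        rw [hs, smul_lie, Int.natCast_succ, add_sub_cancel_right]
      · rw [P.cartan1_lie_raise_succ hn]; push_cast; module
      · rw [P.cartan1_lie_lower_succ hn]; push_cast; module
    · have hj : (j.val : ℤ) = i.val - 1 := by omega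
      by_cases hσ : σ = 1 <;> simp only [genX, genH, hσ, hc, if_true, if_false, h10, hj] <;>
        rw [hs, smul_lie]
      · rw [P.cartan1_lie_raise_pred hn]; push_cast; module
      · rw [P.cartan1_lie_lower_pred hn]; push_cast; module
    · exact absurd h hij
    · by_cases hσ : σ = 1 <;> simp only [genX, genH, hσ, hc, if_true, if_false, h10] <;>
        rw [hs, smul_lie]
      · rw [P.cartan1_lie_raise_far hn t ha hb hc']; simp
      · rw [P.cartan1_lie_lower_far hn t ha hb hc']; simp
  | H_X_first_last σ i j hi hj =>
    have hs := P.cartan1_sub_half_sq ħ t i.val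
    have hj' : (j.val : ℤ) = i.val - 1 + n := by omega
    have hj'' : (i.val : ℤ) - 1 + n - 1 = i.val - 1 - 1 + n := by ring
    rw [units_cast_complex]
    by_cases hσ : σ = 1 <;> simp only [genX, genH, hσ, if_true, if_false, h10, hj'] <;>
      rw [hs, smul_lie, hj'', P.e_shift_of_ne (by omega)]
    · rw [P.cartan1_lie_raise_pred hn, hR]; module
    · rw [P.cartan1_lie_lower_pred hn, hL]; module
  | H_X_last_first σ i j hi hj =>
    have hs := P.cartan1_sub_half_sq ħ t i.val
    have hi' : (i.val : ℤ) + 1 = j.val + n := by omega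
    have hi0 : (i.val : ℤ) = j.val - 1 + n := by omega
    have hj0 : P.e (j.val - 1) j.val = P.e i.val (i.val + 1) := by
      rw [hi', hi0, P.e_shift_of_ne (by omega)]
    have hj1 : P.e j.val (j.val - 1) = P.e (i.val + 1) i.val := by
      rw [hi', hi0, P.e_shift_of_ne (by omega)]
    rw [units_cast_complex]
    by_cases hσ : σ = 1 <;> simp only [genX, genH, hσ, if_true, if_false, h10] <;>
      rw [hs, smul_lie]
    · have h1 := hR j.val
      rw [← hi'] at h1
      rw [hj0, P.cartan1_lie_raise_succ hn, smul_neg, h1, hj0]; module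
    · have h1 := hL j.val
      rw [← hi'] at h1
      rw [hj1, P.cartan1_lie_lower_succ hn, h1, hj1]; module
  | X_X_same σ i j hij =>
    rw [units_cast_complex]
    have hr : ∀ k l : ℤ, ⁅ħ • P.raise1 t k, P.e (l - 1) l⁆ - ⁅P.e (k - 1) k, ħ • P.raise1 t l⁆ =
        ħ • (⁅P.raise1 t k, P.e (l - 1) l⁆ + ⁅P.raise1 t l, P.e (k - 1) k⁆) := fun k l => by
      rw [smul_lie, lie_smul, ← lie_skew (P.e (k - 1) k)]; module
    have hl : ∀ k l : ℤ, ⁅ħ • P.lower1 t k, P.e l (l - 1)⁆ - ⁅P.e k (k - 1), ħ • P.lower1 t l⁆ =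
        ħ • (⁅P.lower1 t k, P.e l (l - 1)⁆ + ⁅P.lower1 t l, P.e k (k - 1)⁆) := fun k l => by
      rw [smul_lie, lie_smul, ← lie_skew (P.e k (k - 1))]; module
    rcases cartan_cases i j with ⟨rfl, hc⟩ | ⟨h | h | h, hc⟩ | ⟨⟨ha, hb, hc'⟩, hc⟩
    · by_cases hσ : σ = 1 <;> simp only [genX, hσ, hc, if_true, if_false, h10]
      · rw [hr, P.raise1_lie_raise hn]; push_cast; module
      · rw [hl, P.lower1_lie_lower hn]; push_cast; module
    · by_cases hσ : σ = 1 <;> simp only [genX, hσ, hc, if_true, if_false, h10, ← h]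
      · rw [hr, Int.natCast_succ, add_sub_cancel_right, P.raise1_lie_raise_succ hn]; push_cast; module
      · rw [hl, Int.natCast_succ, add_sub_cancel_right, P.lower1_lie_lower_succ hn]; push_cast; module
    · by_cases hσ : σ = 1 <;> simp only [genX, hσ, hc, if_true, if_false, h10, ← h]
      · rw [hr, Int.natCast_succ, add_sub_cancel_right, add_comm ⁅_, _⁆, P.raise1_lie_raise_succ hn]
        push_cast; module
      · rw [hl, Int.natCast_succ, add_sub_cancel_right, add_comm ⁅_, _⁆, P.lower1_lie_lower_succ hn]
        push_cast; module
    · exact absurd h hij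
    · have ha' : ¬ (n : ℤ) ∣ (j.val : ℤ) - i.val := by rwa [dvd_sub_comm]
      have hb' : ¬ (n : ℤ) ∣ (j.val : ℤ) + 1 - i.val := by
        rwa [dvd_sub_comm, show (i.val : ℤ) - (j.val + 1) = i.val - 1 - j.val by ring]
      have hc'' : ¬ (n : ℤ) ∣ (j.val : ℤ) - 1 - i.val := by
        rwa [dvd_sub_comm, show (i.val : ℤ) - (j.val - 1) = i.val + 1 - j.val by ring]
      by_cases hσ : σ = 1 <;> simp only [genX, hσ, hc, if_true, if_false, h10]
      · rw [hr, P.raise1_lie_raise_far hn t ha hb hc', P.raise1_lie_raise_far hn t ha' hb' hc'']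
        simp
      · rw [hl, P.lower1_lie_lower_far hn t ha hb hc', P.lower1_lie_lower_far hn t ha' hb' hc'']
        simp
  | X_X_first_last σ i j hi hj =>
    have hj' : (j.val : ℤ) = i.val - 1 + n := by omega
    have hj'' : (i.val : ℤ) - 1 + n - 1 = i.val - 1 - 1 + n := by ring
    have h1 := P.raise1_lie_raise_succ hn t (i.val - 1)
    have h2 := P.lower1_lie_lower_succ hn t (i.val - 1)
    rw [sub_add_cancel] at h1 h2
    rw [units_cast_complex]
    by_cases hσ : σ = 1 <;> simp only [genX, hσ, if_true, if_false, h10, hj'] <;>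
      rw [hj'', P.e_shift_of_ne (by omega)]
    · rw [hR, smul_lie, lie_add, lie_smul, lie_smul,
        eq_sub_of_add_eq' h1, ← lie_skew (P.raise1 t (i.val - 1))]
      module
    · rw [hL, smul_lie, lie_add, lie_smul, lie_smul,
        eq_sub_of_add_eq' h2, ← lie_skew (P.lower1 t (i.val - 1))]
      module
  | serre σ i j hij =>
    rcases cartan_cases i j with ⟨rfl, hc⟩ | ⟨h, hc⟩ | ⟨⟨ha, hb, hc'⟩, hc⟩
    · exact absurd rfl hij
    · rw [hc, show (1 - -1 : ℤ).toNat = 2 by rfl]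
      by_cases hσ : σ = 1 <;> simp only [genX, hσ, if_true, if_false, Function.iterate_succ,
        Function.iterate_zero, Function.comp_apply, id_eq]
      · exact P.raise_lie_raise_lie_raise hn _ _
      · exact P.lower_lie_lower_lie_lower hn _ _
    · rw [hc, show (1 - 0 : ℤ).toNat = 1 by rfl]
      by_cases hσ : σ = 1 <;> simp only [genX, hσ, if_true, if_false, Function.iterate_one]
      · rw [P.raise_lie_raise hn, if_neg hb, if_neg hc', sub_zero]
      · rw [P.lower_lie_lower hn, if_neg hb, if_neg hc', sub_zero]

end PeriodicUnits

/-! ### The topology of a degreewise completion -/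

section CompletionTopology

variable {A : Type*} [Ring A] [Algebra ℂ A] {𝒜 : ℤ → Submodule ℂ A}

namespace completionPart

/-- The projection of an inverse limit to its term at level `N`. -/
def proj (d : ℤ) (N : ℕ) : completionPart 𝒜 d →ₗ[ℂ] A ⧸ tail 𝒜 N d where
  toFun f := f.1 N
  map_add' _ _ := rfl
  map_smul' _ _ := rfl

theorem ext_proj {d : ℤ} {f g : completionPart 𝒜 d} (h : ∀ N, proj d N f = proj d N g) : f = g :=
  Subtype.ext (funext h)

theorem proj_of {d : ℤ} (x : A) (hx : x ∈ 𝒜 d) (N : ℕ) :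
    proj d N (of x hx) = Submodule.Quotient.mk x := rfl

theorem proj_eq_mk_rep {d : ℤ} (f : completionPart 𝒜 d) {M N : ℕ} (h : M ≤ N) :
    proj d M f = Submodule.Quotient.mk (rep f N) :=
  mk_rep f h

theorem proj_of_eq_zero {d : ℤ} {x : A} {hx : x ∈ 𝒜 d} {N : ℕ} :
    proj d N (of x hx) = 0 ↔ x ∈ tail 𝒜 N d :=
  Submodule.Quotient.mk_eq_zero _

theorem proj_eq_zero_of_le {d : ℤ} {f : completionPart 𝒜 d} {M N : ℕ} (h : M ≤ N)
    (hf : proj d N f = 0) : proj d M f = 0 := by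
  rw [proj_eq_mk_rep f le_rfl, Submodule.Quotient.mk_eq_zero] at hf
  rw [proj_eq_mk_rep f h, Submodule.Quotient.mk_eq_zero]
  exact tail_anti 𝒜 h d hf

theorem proj_sub_of_rep {d : ℤ} (f : completionPart 𝒜 d) (N : ℕ) :
    proj d N (f - of (rep f N) (rep_mem f N)) = 0 := by
  rw [map_sub, proj_of, proj_eq_mk_rep f le_rfl, sub_self]

variable [SetLike.GradedMonoid 𝒜]

theorem proj_mul_of_right {d e : ℤ} (f : completionPart 𝒜 d) {g : completionPart 𝒜 e} {N : ℕ}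
    (hg : proj e N g = 0) : proj (d + e) N (mul f g) = 0 := by
  refine (mul_apply f g (K := (N - e).toNat) (by omega) (rep_mem f _) (zero_mem _)
    (mk_rep f le_rfl) hg).trans ?_
  rw [mul_zero, Submodule.Quotient.mk_zero]

theorem proj_mul_of_left {d e : ℤ} {f : completionPart 𝒜 d} (g : completionPart 𝒜 e) {N K : ℕ}
    (hK : (N : ℤ) ≤ K + e) (hf : proj d K f = 0) : proj (d + e) N (mul f g) = 0 := by
  refine (mul_apply f g hK (zero_mem _) (rep_mem g N) hf (mk_rep g le_rfl)).trans ?_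
  rw [zero_mul, Submodule.Quotient.mk_zero]

end completionPart

open completionPart

theorem proj_of_apply_eq_zero {d k : ℤ} {f : completionPart 𝒜 d} {N : ℕ} (hf : proj d N f = 0) :
    proj k N (DirectSum.of (completionPart 𝒜) d f k) = 0 := by
  by_cases h : d = k
  · subst h
    rwa [DirectSum.of_eq_same]
  · rw [DirectSum.of_eq_of_ne _ _ _ (Ne.symm h), map_zero]

variable [SetLike.GradedMonoid 𝒜]

/-- The left ideal of the elements of a completion that vanish at level `N` in every degree. -/
def vanish (𝒜 : ℤ → Submodule ℂ A) [SetLike.GradedMonoid 𝒜] (N : ℕ) :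
    Submodule (Completion 𝒜) (Completion 𝒜) where
  carrier := {f | ∀ d, proj d N (f d) = 0}
  add_mem' hf hg d := by rw [DirectSum.add_apply, map_add, hf d, hg d, add_zero]
  zero_mem' d := by rw [DirectSum.zero_apply, map_zero]
  smul_mem' c f hf := by
    classical
    intro k
    rw [smul_eq_mul]
    induction c using DirectSum.induction_on with
    | zero => rw [zero_mul, DirectSum.zero_apply, map_zero]
    | add x y hx hy => rw [add_mul, DirectSum.add_apply, map_add, hx, hy, add_zero]
    | of d x =>
      rw [← DirectSum.sum_support_of f, Finset.mul_sum, DFinsupp.finsetSum_apply, map_sum]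
      refine Finset.sum_eq_zero fun e _ => ?_
      rw [DirectSum.of_mul_of]
      exact proj_of_apply_eq_zero (proj_mul_of_right x (hf e))

theorem of_mem_vanish {d : ℤ} {f : completionPart 𝒜 d} {N : ℕ} :
    DirectSum.of (completionPart 𝒜) d f ∈ vanish 𝒜 N ↔ proj d N f = 0 := by
  refine ⟨fun h => ?_, fun h k => proj_of_apply_eq_zero h⟩
  have := h d
  rwa [DirectSum.of_eq_same] at this

theorem vanish_anti {M N : ℕ} (h : M ≤ N) : vanish 𝒜 N ≤ vanish 𝒜 M :=
  fun _ hf d => proj_eq_zero_of_le h (hf d)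

theorem exists_vanish_mul (N : ℕ) (x : Completion 𝒜) :
    ∃ M, ∀ y ∈ vanish 𝒜 M, y * x ∈ vanish 𝒜 N := by
  classical
  induction x using DirectSum.induction_on with
  | zero => exact ⟨0, fun y _ => by rw [mul_zero]; exact zero_mem _⟩
  | add u v hu hv =>
    obtain ⟨K, hK⟩ := hu
    obtain ⟨L, hL⟩ := hv
    refine ⟨max K L, fun y hy => ?_⟩
    rw [mul_add]
    exact add_mem (hK y (vanish_anti (le_max_left K L) hy)) (hL y (vanish_anti (le_max_right K L) hy))
  | of e g =>
    refine ⟨(N - e).toNat, fun y hy => ?_⟩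
    rw [← DirectSum.sum_support_of y, Finset.sum_mul]
    refine sum_mem fun d _ => ?_
    rw [DirectSum.of_mul_of, of_mem_vanish]
    exact proj_mul_of_left g (by omega) (hy d)

theorem vanish_ringSubgroupsBasis :
    RingSubgroupsBasis fun N => (vanish 𝒜 N).toAddSubgroup where
  inter M N := ⟨max M N, le_inf (vanish_anti (le_max_left M N)) (vanish_anti (le_max_right M N))⟩
  mul N := ⟨N, by
    rintro _ ⟨x, -, y, hy, rfl⟩
    exact (vanish 𝒜 N).smul_mem x hy⟩
  leftMul x N := ⟨N, fun y hy => (vanish 𝒜 N).smul_mem x hy⟩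
  rightMul x N := exists_vanish_mul N x

/-- The topology of a completion for which the left ideals `vanish 𝒜 N` are a basis of
neighbourhoods of zero. On each homogeneous part it is the inverse limit topology. -/
instance : TopologicalSpace (Completion 𝒜) := (vanish_ringSubgroupsBasis (𝒜 := 𝒜)).topology

instance : IsTopologicalRing (Completion 𝒜) :=
  (vanish_ringSubgroupsBasis (𝒜 := 𝒜)).toRingFilterBasis.isTopologicalRing

theorem completion_hasBasis_nhds (x : Completion 𝒜) :
    (nhds x).HasBasis (fun _ => True) fun N => {y | y - x ∈ vanish 𝒜 N} :=
  (vanish_ringSubgroupsBasis (𝒜 := 𝒜)).hasBasis_nhds x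

theorem eq_zero_of_mem_vanish {x : Completion 𝒜} (h : ∀ N, x ∈ vanish 𝒜 N) : x = 0 :=
  DFinsupp.ext fun d => ext_proj fun N => (h N d).trans (map_zero _).symm

instance : T2Space (Completion 𝒜) := by
  refine IsTopologicalAddGroup.t2Space_of_zero_sep fun x hx => ?_
  by_contra! h
  refine hx (eq_zero_of_mem_vanish fun N => ?_)
  have := h _ ((completion_hasBasis_nhds (0 : Completion 𝒜)).mem_of_mem (i := N) trivial)
  simpa using this

theorem hasSum_completion_iff {ι : Type*} {f : ι → Completion 𝒜} {x : Completion 𝒜} :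
    HasSum f x ↔ ∀ N, ∃ s : Finset ι, ∀ t, s ⊆ t → ∑ i ∈ t, f i - x ∈ vanish 𝒜 N := by
  classical
  rw [HasSum, SummationFilter.unconditional_filter,
    Filter.atTop_basis.tendsto_iff (completion_hasBasis_nhds x)]
  simp

/-- The homogeneous elements of degree `d` in a completion. -/
def homogeneousPart (𝒜 : ℤ → Submodule ℂ A) (d : ℤ) : Submodule ℂ (Completion 𝒜) :=
  LinearMap.range (DirectSum.lof ℂ ℤ (completionPart 𝒜) d)

omit [SetLike.GradedMonoid 𝒜] in
theorem of_mem_homogeneousPart {d : ℤ} (f : completionPart 𝒜 d) :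
    DirectSum.of (completionPart 𝒜) d f ∈ homogeneousPart 𝒜 d :=
  ⟨f, rfl⟩

omit [SetLike.GradedMonoid 𝒜] in
theorem exists_of_eq {d : ℤ} {x : Completion 𝒜} (hx : x ∈ homogeneousPart 𝒜 d) :
    ∃ f, DirectSum.of (completionPart 𝒜) d f = x :=
  hx

theorem mul_mem_homogeneousPart {d e : ℤ} {x y : Completion 𝒜} (hx : x ∈ homogeneousPart 𝒜 d)
    (hy : y ∈ homogeneousPart 𝒜 e) : x * y ∈ homogeneousPart 𝒜 (d + e) := by
  obtain ⟨f, rfl⟩ := exists_of_eq hx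
  obtain ⟨g, rfl⟩ := exists_of_eq hy
  rw [DirectSum.of_mul_of]
  exact of_mem_homogeneousPart _

/-- A homogeneous family is summable once all but finitely many of its members vanish at each
level: the sum is computed level by level. -/
theorem summable_of_finite_not_mem_vanish {ι : Type*} (d : ℤ) (f : ι → Completion 𝒜)
    (hd : ∀ i, f i ∈ homogeneousPart 𝒜 d) (hf : ∀ N, {i | f i ∉ vanish 𝒜 N}.Finite) :
    Summable f := by
  classical
  choose g hg using fun i => exists_of_eq (hd i)
  have hz : ∀ N i, i ∉ (hf N).toFinset → proj d N (g i) = 0 := by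
    intro N i hi
    rw [Set.Finite.mem_toFinset, Set.mem_ofPred_eq, not_not, ← hg i] at hi
    exact of_mem_vanish.mp hi
  let L : completionPart 𝒜 d := ⟨fun N => ∑ i ∈ (hf N).toFinset, proj d N (g i), fun N =>
    ⟨∑ i ∈ (hf N).toFinset, rep (g i) N, sum_mem fun i _ => rep_mem _ _, fun M hM => by
      have h1 : (Submodule.Quotient.mk (∑ i ∈ (hf N).toFinset, rep (g i) N) : A ⧸ tail 𝒜 M d) =
          ∑ i ∈ (hf N).toFinset, proj d M (g i) := by
        rw [← Submodule.mkQ_apply, map_sum]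
        exact Finset.sum_congr rfl fun i _ => (proj_eq_mk_rep (g i) hM).symm
      rw [h1]
      refine Finset.sum_subset (fun i hi => ?_) fun i _ hi => hz M i hi
      rw [Set.Finite.mem_toFinset, Set.mem_ofPred_eq] at hi ⊢
      exact fun h => hi (vanish_anti hM h)⟩⟩
  refine ⟨DirectSum.of _ d L, hasSum_completion_iff.mpr fun N => ⟨(hf N).toFinset, fun t ht => ?_⟩⟩
  have : ∑ i ∈ t, f i = DirectSum.of (completionPart 𝒜) d (∑ i ∈ t, g i) := by
    rw [map_sum]
    exact Finset.sum_congr rfl fun i _ => (hg i).symm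
  rw [this, ← map_sub, of_mem_vanish, map_sub, map_sum, sub_eq_zero]
  exact (Finset.sum_subset ht fun i _ hi => hz N i hi).symm

theorem hasSum_series {d : ℤ} (y : ℕ → A) (hd : ∀ s, y s ∈ 𝒜 d)
    (hy : ∀ s : ℕ, ∃ r : ℤ, (s : ℤ) ≤ r ∧ y s ∈ 𝒜 (d - r) * 𝒜 r) :
    HasSum (fun s => DirectSum.of (completionPart 𝒜) d (of (y s) (hd s)))
      (DirectSum.of (completionPart 𝒜) d (series y hd hy)) := by
  refine hasSum_completion_iff.mpr fun N => ⟨Finset.range (N + 1), fun t ht => ?_⟩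
  rw [← map_sum, ← map_sub, of_mem_vanish, map_sub, map_sum, sub_eq_zero]
  have h1 : proj d N (series y hd hy) =
      ∑ s ∈ Finset.range (N + 1), proj d N (of (y s) (hd s)) :=
    map_sum (Submodule.mkQ (tail 𝒜 N d)) y (Finset.range (N + 1))
  rw [h1]
  refine (Finset.sum_subset ht fun s _ hs => ?_).symm
  obtain ⟨r, hr, hmem⟩ := hy s
  rw [Finset.mem_range] at hs
  refine proj_of_eq_zero.mpr ((le_iSup₂_of_le (f := fun (r : ℤ) (_ : (N : ℤ) < r) =>
    𝒜 (d - r) * 𝒜 r) r (by omega) le_rfl) hmem)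

/-- A homogeneous element of a graded algebra as an element of the completion. -/
def toCompletion (d : ℤ) (x : A) (hx : x ∈ 𝒜 d) : Completion 𝒜 :=
  DirectSum.of (completionPart 𝒜) d (of x hx)

omit [SetLike.GradedMonoid 𝒜] in
theorem toCompletion_congr {d e : ℤ} (hde : d = e) {x y : A} (hxy : x = y) (hx : x ∈ 𝒜 d)
    (hy : y ∈ 𝒜 e) : toCompletion d x hx = toCompletion e y hy := by
  subst hde hxy
  rfl

theorem toCompletion_add {d : ℤ} {x y : A} (hx : x ∈ 𝒜 d) (hy : y ∈ 𝒜 d) :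
    toCompletion d (x + y) (add_mem hx hy) = toCompletion d x hx + toCompletion d y hy :=
  map_add (DirectSum.of (completionPart 𝒜) d) (of x hx) (of y hy)

theorem toCompletion_sub {d : ℤ} {x y : A} (hx : x ∈ 𝒜 d) (hy : y ∈ 𝒜 d) :
    toCompletion d (x - y) (sub_mem hx hy) = toCompletion d x hx - toCompletion d y hy :=
  map_sub (DirectSum.of (completionPart 𝒜) d) (of x hx) (of y hy)

theorem toCompletion_zero {d : ℤ} : toCompletion d (0 : A) (zero_mem (𝒜 d)) = 0 :=
  map_zero (DirectSum.of (completionPart 𝒜) d)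

omit [SetLike.GradedMonoid 𝒜] in
theorem toCompletion_smul {d : ℤ} (r : ℂ) {x : A} (hx : x ∈ 𝒜 d) :
    toCompletion d (r • x) (Submodule.smul_mem _ r hx) = r • toCompletion d x hx :=
  map_smul (DirectSum.lof ℂ ℤ (completionPart 𝒜) d) r (of x hx)

theorem toCompletion_algebraMap (r : ℂ) (h : algebraMap ℂ A r ∈ 𝒜 0) :
    toCompletion 0 (algebraMap ℂ A r) h = algebraMap ℂ (Completion 𝒜) r := by
  rw [Algebra.algebraMap_eq_smul_one (A := Completion 𝒜),
    toCompletion_congr rfl (Algebra.algebraMap_eq_smul_one r) h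
      (Submodule.smul_mem _ r SetLike.GradedOne.one_mem), toCompletion_smul]
  rfl

theorem toCompletion_mul {d e : ℤ} {x y : A} (hx : x ∈ 𝒜 d) (hy : y ∈ 𝒜 e) :
    toCompletion d x hx * toCompletion e y hy =
      toCompletion (d + e) (x * y) (SetLike.mul_mem_graded hx hy) := by
  rw [toCompletion, toCompletion, DirectSum.of_mul_of]
  exact congrArg _ (ext_proj fun N => mul_apply _ _ (K := (N - e).toNat) (by omega) hx hy rfl rfl)

theorem toCompletion_mem_homogeneousPart {d : ℤ} {x : A} (hx : x ∈ 𝒜 d) :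
    toCompletion d x hx ∈ homogeneousPart 𝒜 d :=
  of_mem_homogeneousPart _

theorem toCompletion_mem_vanish {d : ℤ} {x : A} {hx : x ∈ 𝒜 d} {N : ℕ} :
    toCompletion d x hx ∈ vanish 𝒜 N ↔ x ∈ tail 𝒜 N d :=
  of_mem_vanish.trans proj_of_eq_zero

theorem Currents.hasSum_quad {a : ℕ} (F : Currents 𝒜 a) (i k j : Fin a) (α β : ℕ) :
    HasSum (fun s : ℕ => F.E i k (-s - α) * F.E k j (s + β)) (F.quad i k j α β) := by
  refine hasSum_of_eq (hasSum_series _ _ _) fun s => ?_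
  refine Eq.trans ?_ (toCompletion_mul (F.e_mem i k (-s - α)) (F.e_mem k j (s + β))).symm
  exact toCompletion_congr (by ring) rfl _ _

end CompletionTopology

/-! ### Currents of a given level as periodic matrix units -/

section Level

variable (a : ℕ) (κ : ℂ)

theorem levelE_lie (p q i j : Fin a) (s u : ℤ) :
    ⁅levelE a κ (p, q, s), levelE a κ (i, j, u)⁆ =
      (if i = q then levelE a κ (p, j, s + u) else 0)
        - (if p = j then levelE a κ (i, q, s + u) else 0)
        + (if i = q ∧ p = j ∧ s + u = 0 then algebraMap ℂ _ (s * κ) else 0)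
        + (if p = q ∧ i = j ∧ s + u = 0 then algebraMap ℂ _ (s : ℂ) else 0) := by
  let f : UniversalEnvelopingAlgebra ℂ (AffineGl a) →ₐ[ℂ] LevelU a κ :=
    RingQuot.mkAlgHom ℂ (LevelRel a κ)
  have hc : f (UniversalEnvelopingAlgebra.ι ℂ (AffineGl.c a)) = algebraMap ℂ _ κ :=
    (RingQuot.mkAlgHom_rel ℂ LevelRel.c).trans (AlgHom.commutes f κ)
  have hz : f (UniversalEnvelopingAlgebra.ι ℂ (AffineGl.z a)) = 1 :=
    (RingQuot.mkAlgHom_rel ℂ LevelRel.z).trans (map_one f)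
  have hl : ∀ y w : UniversalEnvelopingAlgebra ℂ (AffineGl a), f ⁅y, w⁆ = ⁅f y, f w⁆ := by
    intro y w
    rw [Ring.lie_def, map_sub, map_mul, map_mul, Ring.lie_def]
  let G : AffineGl a →ₗ[ℂ] LevelU a κ :=
    f.toLinearMap ∘ₗ (UniversalEnvelopingAlgebra.ι ℂ : AffineGl a →ₗ⁅ℂ⁆ _).toLinearMap
  have h : G ⁅AffineGl.E p q s, AffineGl.E i j u⁆ =
      ⁅levelE a κ (p, q, s), levelE a κ (i, j, u)⁆ :=
    (congrArg f (LieHom.map_lie _ _ _)).trans (hl _ _)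
  have hGc : G (AffineGl.c a) = algebraMap ℂ _ κ := hc
  have hGz : G (AffineGl.z a) = 1 := hz
  rw [← h, AffineGl.E_lie_E, map_add, map_add, map_sub, apply_ite G, apply_ite G, apply_ite G,
    apply_ite G, map_smul, map_smul, hGc, hGz, map_zero, map_mul, ← Algebra.smul_def,
    ← Algebra.algebraMap_eq_smul_one]
  rfl

theorem algebraMap_mem_level (r : ℂ) : algebraMap ℂ (LevelU a κ) r ∈ levelGrading a κ 0 := by
  rw [Algebra.algebraMap_eq_smul_one]
  exact Submodule.smul_mem _ r SetLike.GradedOne.one_mem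

theorem levelCurrents_E_lie (p q i j : Fin a) (s u : ℤ) :
    ⁅(levelCurrents a κ).E p q s, (levelCurrents a κ).E i j u⁆ =
      (if i = q then (levelCurrents a κ).E p j (s + u) else 0)
        - (if p = j then (levelCurrents a κ).E i q (s + u) else 0)
        + (if i = q ∧ p = j ∧ s + u = 0 then algebraMap ℂ _ (s * κ) else 0)
        + (if p = q ∧ i = j ∧ s + u = 0 then algebraMap ℂ _ (s : ℂ) else 0) := by
  have hx := (levelCurrents a κ).e_mem p q s
  have hy := (levelCurrents a κ).e_mem i j u
  have hd : ∀ k l : Fin a, levelE a κ (k, l, s + u) ∈ levelGrading a κ (s + u) :=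
    fun k l => (levelCurrents a κ).e_mem k l (s + u)
  have hr : ∀ (P : Prop) [Decidable P] (r : ℂ), (P → s + u = 0) →
      (if P then algebraMap ℂ (LevelU a κ) r else 0) ∈ levelGrading a κ (s + u) := by
    intro P _ r hP
    split_ifs with hh
    · rw [hP hh]
      exact algebraMap_mem_level a κ r
    · exact zero_mem _
  have h1 : (if i = q then levelE a κ (p, j, s + u) else 0) ∈ levelGrading a κ (s + u) := by
    split_ifs
    exacts [hd p j, zero_mem _]
  have h2 : (if p = j then levelE a κ (i, q, s + u) else 0) ∈ levelGrading a κ (s + u) := by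
    split_ifs
    exacts [hd i q, zero_mem _]
  have h3 := hr (i = q ∧ p = j ∧ s + u = 0) (s * κ) fun h => h.2.2
  have h4 := hr (p = q ∧ i = j ∧ s + u = 0) s fun h => h.2.2
  have hC : ∀ (P : Prop) [Decidable P] (r : ℂ) (hP : P → s + u = 0),
      toCompletion (s + u) (if P then algebraMap ℂ (LevelU a κ) r else 0) (hr P r hP) =
        if P then algebraMap ℂ (CompletedU a κ) r else 0 := by
    intro P _ r hP
    by_cases hh : P
    · refine Eq.trans ?_ (if_pos hh).symm
      rw [← toCompletion_algebraMap r (algebraMap_mem_level a κ r)]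
      exact toCompletion_congr (hP hh) (if_pos hh) _ _
    · refine Eq.trans ?_ (if_neg hh).symm
      exact (toCompletion_congr rfl (if_neg hh) _ (zero_mem _)).trans toCompletion_zero
  have hE : ∀ (P : Prop) [Decidable P] (k l : Fin a)
      (hP : (if P then levelE a κ (k, l, s + u) else 0) ∈ levelGrading a κ (s + u)),
      toCompletion (s + u) (if P then levelE a κ (k, l, s + u) else 0) hP =
        if P then (levelCurrents a κ).E k l (s + u) else 0 := by
    intro P _ k l hP
    by_cases hh : P
    · refine Eq.trans ?_ (if_pos hh).symm
      exact toCompletion_congr rfl (if_pos hh) _ (hd k l)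
    · refine Eq.trans ?_ (if_neg hh).symm
      exact (toCompletion_congr rfl (if_neg hh) _ (zero_mem _)).trans toCompletion_zero
  calc ⁅(levelCurrents a κ).E p q s, (levelCurrents a κ).E i j u⁆
      = toCompletion (s + u) _ (SetLike.mul_mem_graded hx hy)
        - toCompletion (u + s) _ (SetLike.mul_mem_graded hy hx) :=
        congrArg₂ (· - ·) (toCompletion_mul hx hy) (toCompletion_mul hy hx)
    _ = toCompletion (s + u) _ (add_mem (add_mem (sub_mem h1 h2) h3) h4) := by
        rw [toCompletion_congr (add_comm u s) rfl _ (add_comm u s ▸ SetLike.mul_mem_graded hy hx),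
          ← toCompletion_sub]
        exact toCompletion_congr rfl (levelE_lie a κ p q i j s u) _ _
    _ = _ := by
        rw [toCompletion_add (add_mem (sub_mem h1 h2) h3) h4,
          toCompletion_add (sub_mem h1 h2) h3, toCompletion_sub h1 h2, hE, hE, hC _ _ fun h => h.2.2,
          hC _ _ fun h => h.2.2]

theorem levelCurrents_E_mem_homogeneousPart (p q : Fin a) (s : ℤ) :
    (levelCurrents a κ).E p q s ∈ homogeneousPart (levelGrading a κ) s :=
  of_mem_homogeneousPart _

theorem levelCurrents_E_mem_vanish (p q : Fin a) {s : ℤ} {N : ℕ} (hs : (N : ℤ) < s) :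
    (levelCurrents a κ).E p q s ∈ vanish (levelGrading a κ) N := by
  have hx := (levelCurrents a κ).e_mem p q s
  refine (toCompletion_mem_vanish (hx := hx)).mpr ?_
  rw [← one_mul ((levelCurrents a κ).e p q s)]
  exact mul_mem_tail _ hs (by rw [sub_self]; exact SetLike.GradedOne.one_mem) hx

end Level

section LevelUnits

theorem algebraMap_lie_eq_zero {R : Type*} [Ring R] [Algebra ℂ R] (r : ℂ) (x : R) :
    ⁅algebraMap ℂ R r, x⁆ = 0 :=
  Ring.lie_def (algebraMap ℂ R r) x ▸ sub_eq_zero.mpr (Algebra.commutes r x)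

theorem lie_algebraMap_eq_zero {R : Type*} [Ring R] [Algebra ℂ R] (r : ℂ) (x : R) :
    ⁅x, algebraMap ℂ R r⁆ = 0 :=
  Ring.lie_def x (algebraMap ℂ R r) ▸ sub_eq_zero.mpr (Algebra.commutes r x).symm

variable {n : ℕ} (hn : 0 < n)

theorem add_mul_ediv {n : ℕ} (hn : 0 < n) {p k : ℤ} : (p + n * k) / n = p / n + k :=
  Int.add_mul_ediv_left p k (by omega)

/-- The element of `Fin n` representing the class of an integer modulo `n`. -/
def residue (p : ℤ) : Fin n := ⟨(p % n).toNat, by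
  have h1 := Int.emod_nonneg p (b := n) (by omega)
  have h2 := Int.emod_lt_of_pos p (b := n) (by omega)
  omega⟩

theorem residue_val (p : ℤ) : ((residue hn p).val : ℤ) = p % n :=
  Int.toNat_of_nonneg (Int.emod_nonneg p (by omega))

theorem residue_eq_iff {p q : ℤ} : residue hn p = residue hn q ↔ (n : ℤ) ∣ q - p := by
  rw [← Int.modEq_iff_dvd, Int.ModEq, ← residue_val hn, ← residue_val hn, Fin.ext_iff]
  omega

variable {a : ℕ} (hna : n ≤ a) (κ : ℂ)

theorem up_residue_eq_iff {p q : ℤ} :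
    up hna (residue hn p) = up hna (residue hn q) ↔ (n : ℤ) ∣ q - p := by
  rw [← residue_eq_iff hn]
  exact (Fin.castLE_injective hna).eq_iff

/-- The element `E_{p̄,q̄} t^{⌊q/n⌋ - ⌊p/n⌋}` attached to two integers `p` and `q` with residues `p̄`
and `q̄` modulo `n`. -/
def loopUnit (p q : ℤ) : CompletedU a κ :=
  (levelCurrents a κ).E (up hna (residue hn p)) (up hna (residue hn q)) (q / n - p / n)

theorem loopUnit_congr {p q p' q' : ℤ} (hp : (n : ℤ) ∣ p' - p) (hq : (n : ℤ) ∣ q' - q)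
    (h : q' / n - p' / n = q / n - p / n) : loopUnit hn hna κ p q = loopUnit hn hna κ p' q' := by
  rw [loopUnit, loopUnit, (residue_eq_iff hn).mpr hp, (residue_eq_iff hn).mpr hq, h]

theorem loopUnit_lie (p q r s : ℤ) :
    ⁅loopUnit hn hna κ p q, loopUnit hn hna κ r s⁆ =
      (if (n : ℤ) ∣ q - r then loopUnit hn hna κ p (s + q - r) else 0)
        - (if (n : ℤ) ∣ s - p then loopUnit hn hna κ (r + p - s) q else 0)
        + (if (n : ℤ) ∣ q - r ∧ p = s + q - r then
            algebraMap ℂ _ (((q / n - p / n : ℤ) : ℂ) * κ) else 0)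
        + (if (n : ℤ) ∣ q - p ∧ q - p + (s - r) = 0 then
            algebraMap ℂ _ (((q - p) / n : ℤ) : ℂ) else 0) := by
  rw [loopUnit, loopUnit, levelCurrents_E_lie]
  simp only [up_residue_eq_iff]
  congr 1
  · congr 1
    · congr 1
      · by_cases h : (n : ℤ) ∣ q - r
        · rw [if_pos h, if_pos h, loopUnit]
          obtain ⟨k, hk⟩ := h
          rw [show s + q - r = s + n * k by linarith, add_mul_ediv hn,
            (residue_eq_iff hn (p := s) (q := s + n * k)).mpr ⟨k, by ring⟩,
            show q = r + n * k by linarith, add_mul_ediv hn]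
          congr 1
          ring
        · rw [if_neg h, if_neg h]
      · by_cases h : (n : ℤ) ∣ s - p
        · rw [if_pos h, if_pos h, loopUnit]
          obtain ⟨k, hk⟩ := h
          rw [show r + p - s = r + n * (-k) by linarith, add_mul_ediv hn,
            (residue_eq_iff hn (p := r) (q := r + n * (-k))).mpr ⟨-k, by ring⟩,
            show s = p + n * k by linarith, add_mul_ediv hn]
          congr 1
          ring
        · rw [if_neg h, if_neg h]
    · refine if_congr ⟨?_, ?_⟩ rfl rfl
      · rintro ⟨⟨k, hk⟩, ⟨l, hl⟩, h⟩
        refine ⟨⟨k, hk⟩, ?_⟩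
        rw [show q = r + n * k by linarith, show s = p + n * l by linarith, add_mul_ediv hn,
          add_mul_ediv hn] at h
        have : l = -k := by linarith
        subst this
        linarith
      · rintro ⟨⟨k, hk⟩, h⟩
        refine ⟨⟨k, hk⟩, ⟨-k, by linarith⟩, ?_⟩
        rw [show q = r + n * k by linarith, show s = p + n * (-k) by linarith, add_mul_ediv hn,
          add_mul_ediv hn]
        ring
  · by_cases h : (n : ℤ) ∣ q - p
    · obtain ⟨k, hk⟩ := h
      have hq : q = p + n * k := by linarith
      have h0 : (n : ℤ) ≠ 0 := by omega
      rw [hk, Int.mul_ediv_cancel_left k h0, hq, add_mul_ediv hn]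
      refine if_congr ⟨?_, ?_⟩ (by congr 2; ring) rfl
      · rintro ⟨-, ⟨l, hl⟩, h⟩
        refine ⟨⟨k, rfl⟩, ?_⟩
        rw [show s = r + n * l by linarith, add_mul_ediv hn] at h
        have : l = -k := by linarith
        subst this
        linarith
      · rintro ⟨-, h⟩
        refine ⟨⟨k, by ring⟩, ⟨-k, by linarith⟩, ?_⟩
        rw [show s = r + n * (-k) by linarith, add_mul_ediv hn]
        ring
    · rw [if_neg fun hh => h hh.1, if_neg fun hh => h hh.1]

/-- The periodic matrix units formed by the currents at level `κ`. The constants subtracted on the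
diagonal turn the central term of level `κ` into the failure of exact periodicity. -/
def levelUnits : PeriodicUnits n (CompletedU a κ) where
  e p q := loopUnit hn hna κ p q - if p = q then algebraMap ℂ _ (((p / n : ℤ) : ℂ) * κ) else 0
  level := κ
  e_shift p q := by
    have h : ∀ p : ℤ, (p + n) / n = p / n + 1 := fun p => by
      have := add_mul_ediv (p := p) (k := 1) hn
      rwa [mul_one] at this
    rw [loopUnit_congr hn hna κ (p := p) (q := q) (p' := p + n) (q' := q + n) (by simp) (by simp)
      (by rw [h, h]; ring)]
    by_cases hpq : p = q
    · subst hpq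
      rw [if_pos rfl, if_pos rfl, if_pos rfl, h, Int.cast_add, add_mul, map_add, Int.cast_one,
        one_mul, sub_sub]
    · rw [if_neg hpq, if_neg hpq, if_neg (by omega), sub_zero, sub_zero]
  e_lie p q r s := by
    have hz : ∀ (P : Prop) [Decidable P] (z : ℂ) (x : CompletedU a κ),
        ⁅if P then algebraMap ℂ (CompletedU a κ) z else 0, x⁆ = 0 := by
      intro P _ z x
      split_ifs
      exacts [algebraMap_lie_eq_zero z x, zero_lie x]
    have hz' : ∀ (P : Prop) [Decidable P] (z : ℂ) (x : CompletedU a κ),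
        ⁅x, if P then algebraMap ℂ (CompletedU a κ) z else 0⁆ = 0 := by
      intro P _ z x
      split_ifs
      exacts [lie_algebraMap_eq_zero z x, lie_zero x]
    rw [sub_lie, lie_sub, hz, hz', sub_zero, sub_zero, loopUnit_lie]
    congr 1
    by_cases h : p = s + q - r
    · rw [if_pos h, if_pos (show r + p - s = q by omega)]
      by_cases h1 : (n : ℤ) ∣ q - r
      · have h2 : (n : ℤ) ∣ s - p := by
          rw [← dvd_neg, show -(s - p) = q - r by omega]
          exact h1
        rw [if_pos h1, if_pos h1, if_pos h2, if_pos h2, if_pos ⟨h1, h⟩,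
          show r + p - s = q by omega]
        rw [Int.cast_sub, sub_mul, map_sub]
        abel
      · have h2 : ¬ (n : ℤ) ∣ s - p := by
          rw [← dvd_neg, show -(s - p) = q - r by omega]
          exact h1
        rw [if_neg h1, if_neg h1, if_neg h2, if_neg h2, if_neg fun hh => h1 hh.1]
        abel
    · rw [if_neg h, if_neg (show ¬ r + p - s = q by omega), if_neg fun hh : _ ∧ _ => h hh.2, sub_zero, sub_zero,
        add_zero]
  small := vanish (levelGrading a κ)
  mul_small N x := exists_vanish_mul N x
  e_small N := by
    refine ⟨n * (N + 2), fun p q h => ?_⟩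
    have h1 : (p + n * (N + 2)) / n ≤ q / n := Int.ediv_le_ediv (by omega) (by linarith)
    rw [add_mul_ediv hn] at h1
    have h2 : (0 : ℤ) < n * (N + 2) := by positivity
    rw [if_neg (by linarith : ¬ p = q), sub_zero]
    exact levelCurrents_E_mem_vanish a κ _ _ (s := q / n - p / n) (by linarith)
  grade := homogeneousPart (levelGrading a κ)
  mul_grade := mul_mem_homogeneousPart
  e_grade p q := by
    refine sub_mem (levelCurrents_E_mem_homogeneousPart a κ _ _ (q / n - p / n)) ?_
    split_ifs with h
    · rw [h, sub_self, ← toCompletion_algebraMap _ (algebraMap_mem_level a κ _)]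
      exact toCompletion_mem_homogeneousPart _
    · exact zero_mem _
  summable d f := summable_of_finite_not_mem_vanish d f

end LevelUnits

/-! ### The evaluation elements as quadratic series -/

section Matching

theorem neg_one_ediv {n : ℕ} (hn : 0 < n) : (-1 : ℤ) / n = -1 := by
  rw [Int.ediv_eq_iff_of_pos (by omega)]
  omega

variable {n a : ℕ} (hn : 0 < n) (hna : n ≤ a) (κ : ℂ)

theorem residue_fin (k : Fin n) : residue hn (k : ℤ) = k :=
  Fin.ext (by
    have := residue_val hn (k : ℤ)
    rw [Int.emod_eq_of_lt (by omega) (by omega)] at this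
    omega)

theorem ediv_fin (k : Fin n) : (k : ℤ) / n = 0 :=
  Int.ediv_eq_zero_of_lt (by omega) (by omega)

theorem fin_sub_one_ediv (i : Fin n) : ((i : ℤ) - 1) / n = -delta0 i := by
  have hi := i.isLt
  have hn : 0 < n := by omega
  unfold delta0
  split_ifs with h
  · rw [h, show ((0 : ℕ) : ℤ) - 1 = (n - 1 : ℤ) + n * (-1) by push_cast; ring, add_mul_ediv hn,
      Int.ediv_eq_zero_of_lt (by omega) (by omega), zero_add]
  · rw [Int.ediv_eq_zero_of_lt (by omega) (by omega), neg_zero]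

theorem up_residue_node (i : Fin n) : up hna (residue hn (i : ℤ)) = rgt hna i := by
  rw [residue_fin, rgt]

theorem up_residue_node_sub_one (i : Fin n) :
    up hna (residue hn ((i : ℤ) - 1)) = lft hna i := by
  have hi := i.isLt
  refine Fin.ext ?_
  have h := residue_val hn ((i : ℤ) - 1)
  have h2 := Int.emod_add_mul_ediv ((i : ℤ) - 1) n
  rw [fin_sub_one_ediv, delta0] at h2
  change (residue hn ((i : ℤ) - 1)).val = if i.val = 0 then n - 1 else i.val - 1
  split_ifs at h2 ⊢ <;> simp at h2 <;> omega

/-- Splitting the summation variable `m < i` by its residue `k` modulo `n`: the integers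
`m = k - n (s + c)`, with `c = 0` for `k < i` and `c = 1` for `k ≥ i`, turn the sum defining `Q` into
the double sums of the evaluation elements. -/
theorem hasSum_below_loopUnit {i : ℤ} (hi0 : 0 ≤ i) (hin : i ≤ n) (p q : ℤ) (α β : Fin n → ℕ)
    (hα : ∀ k, (α k : ℤ) = (if (k : ℤ) < i then 0 else 1) + p / n)
    (hβ : ∀ k, (β k : ℤ) = (if (k : ℤ) < i then 0 else 1) + q / n) :
    HasSum (below i fun m => loopUnit hn hna κ p m * loopUnit hn hna κ m q)
      (∑ k : Fin n, (levelCurrents a κ).quad (up hna (residue hn p)) (up hna k)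
        (up hna (residue hn q)) (α k) (β k)) := by
  have h : ∀ k : Fin n, HasSum (fun m : ℤ => if residue hn m = k then
      below i (fun m => loopUnit hn hna κ p m * loopUnit hn hna κ m q) m else 0)
      ((levelCurrents a κ).quad (up hna (residue hn p)) (up hna k)
        (up hna (residue hn q)) (α k) (β k)) := by
    intro k
    have hk := k.isLt
    have hn0 : (0 : ℤ) < n := by omega
    obtain ⟨c, hc⟩ : ∃ c : ℤ, c = if (k : ℤ) < i then 0 else 1 := ⟨_, rfl⟩
    have hg : Function.Injective fun s : ℕ => (k : ℤ) + n * (-s - c) := by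
      intro s u hsu
      have := mul_left_cancel₀ hn0.ne' (add_left_cancel hsu)
      omega
    refine (hg.hasSum_iff ?_).mp (hasSum_of_eq ((levelCurrents a κ).hasSum_quad _ _ _ _ _)
      fun s => ?_)
    · intro m hm
      refine ite_eq_right_iff.mpr fun hr => if_neg fun hmi => hm ?_
      have h1 := residue_val hn m
      have h2 := Int.emod_add_mul_ediv m n
      rw [hr] at h1
      have h3 : m / n ≤ -c := by
        by_contra! h3
        have h4 : (n : ℤ) * (-c + 1) ≤ n * (m / n) := mul_le_mul_of_nonneg_left h3 hn0.le
        split_ifs at hc <;> subst hc <;> linarith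
      refine ⟨(-(m / n) - c).toNat, ?_⟩
      change (k : ℤ) + n * (-((-(m / n) - c).toNat : ℤ) - c) = m
      rw [Int.toNat_of_nonneg (by linarith), h1]
      linarith
    · have hr : residue hn ((k : ℤ) + n * (-s - c)) = k := by
        rw [← residue_fin hn k]
        exact (residue_eq_iff hn).mpr ⟨-(-s - c), by rw [residue_fin]; ring⟩
      have hlt : (k : ℤ) + n * (-s - c) < i := by
        have h4 : 0 ≤ (n : ℤ) * s := by positivity
        split_ifs at hc <;> subst hc <;> linarith
      refine Eq.trans ?_ (if_pos hr).symm
      rw [below, if_pos hlt, loopUnit, loopUnit, hr, add_mul_ediv hn, ediv_fin, hα, hβ, ← hc]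
      congr 2 <;> ring
  refine hasSum_of_eq (hasSum_sum fun k _ => h k) fun m => ?_
  rw [Finset.sum_ite_eq, if_pos (Finset.mem_univ _)]

theorem levelUnits_e_of_ne {p q : ℤ} (h : p ≠ q) :
    (levelUnits hn hna κ).e p q = loopUnit hn hna κ p q := by
  simp [levelUnits, h]

theorem levelUnits_e_self (p : ℤ) : (levelUnits hn hna κ).e p p =
    loopUnit hn hna κ p p - algebraMap ℂ _ (((p / n : ℤ) : ℂ) * κ) := by
  simp [levelUnits]

theorem levelUnits_e_of_ediv_eq_zero {p q : ℤ} (h : p / n = 0) :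
    (levelUnits hn hna κ).e p q = loopUnit hn hna κ p q := by
  by_cases hpq : p = q
  · rw [← hpq, levelUnits_e_self, h, Int.cast_zero, zero_mul, map_zero, sub_zero]
  · exact levelUnits_e_of_ne hn hna κ hpq

theorem levelUnits_e_of_ediv_eq_zero' {p q : ℤ} (h : q / n = 0) :
    (levelUnits hn hna κ).e p q = loopUnit hn hna κ p q := by
  by_cases hpq : p = q
  · rw [hpq, levelUnits_e_of_ediv_eq_zero hn hna κ h]
  · exact levelUnits_e_of_ne hn hna κ hpq

theorem levelUnits_raise (i : Fin n) :
    (levelUnits hn hna κ).e ((i : ℤ) - 1) i = (levelCurrents a κ).x hna 1 i := by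
  rw [levelUnits_e_of_ne hn hna κ (by omega), loopUnit, up_residue_node, up_residue_node_sub_one,
    ediv_fin, fin_sub_one_ediv, Currents.x, chevalleyX, if_pos rfl, zero_sub, neg_neg]

theorem levelUnits_lower (i : Fin n) :
    (levelUnits hn hna κ).e i ((i : ℤ) - 1) = (levelCurrents a κ).x hna (-1) i := by
  rw [levelUnits_e_of_ne hn hna κ (by omega), loopUnit, up_residue_node, up_residue_node_sub_one,
    ediv_fin, fin_sub_one_ediv, Currents.x, chevalleyX, if_neg (by decide), sub_zero]

theorem levelUnits_left (i : Fin n) : (levelUnits hn hna κ).e ((i : ℤ) - 1) ((i : ℤ) - 1) =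
    (levelCurrents a κ).E (lft hna i) (lft hna i) 0 + algebraMap ℂ _ ((delta0 i : ℂ) * κ) := by
  rw [levelUnits_e_self, loopUnit, up_residue_node_sub_one, sub_self, fin_sub_one_ediv,
    Int.cast_neg, neg_mul, map_neg, sub_neg_eq_add]

theorem levelUnits_right (i : Fin n) : (levelUnits hn hna κ).e i i =
    (levelCurrents a κ).E (rgt hna i) (rgt hna i) 0 := by
  rw [levelUnits_e_of_ediv_eq_zero hn hna κ (ediv_fin i), loopUnit, up_residue_node, sub_self]

theorem levelCurrents_C : (levelCurrents a κ).C = algebraMap ℂ _ κ :=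
  toCompletion_algebraMap κ (algebraMap_mem_level a κ κ)

theorem levelUnits_cartan0 (i : Fin n) :
    (levelUnits hn hna κ).cartan0 i = (levelCurrents a κ).h hna i := by
  rw [PeriodicUnits.cartan0, levelUnits_left, levelUnits_right, Currents.h, chevalleyH,
    levelCurrents_C, delta0]
  split_ifs
  · rw [Int.cast_one, one_mul]; abel
  · rw [Int.cast_zero, zero_mul, map_zero]; abel

/-- The sum of `E_{p,k} t^{-s-α} E_{k,q} t^{s+β}` over `s ≥ 0` and `k ≤ n`, where `α = β = 0` for
`k ≤ i` and `α = β = 1` for `k > i`. -/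
def quadSum (p : Fin a) (i : Fin n) (q : Fin a) : CompletedU a κ :=
  ∑ k : Fin n with k.val < i.val, (levelCurrents a κ).quad p (up hna k) q 0 0
    + ∑ k : Fin n with i.val ≤ k.val, (levelCurrents a κ).quad p (up hna k) q 1 1

theorem levelUnits_Q_of_ediv_eq_zero (i : Fin n) {p q : ℤ} (hp : p / n = 0) (hq : q / n = 0) :
    (levelUnits hn hna κ).Q i p q =
      quadSum hna κ (up hna (residue hn p)) i (up hna (residue hn q)) := by
  have h : ∀ k : Fin n, ((if (k : ℕ) < i then 0 else 1 : ℕ) : ℤ)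
      = (if (k : ℤ) < (i : ℤ) then 0 else 1) + 0 := by
    intro k
    split_ifs <;> omega
  have h1 := hasSum_below_loopUnit hn hna κ (i := i) (by omega) (by omega) p q
    (fun k => if (k : ℕ) < i then 0 else 1) (fun k => if (k : ℕ) < i then 0 else 1)
    (fun k => hp ▸ h k) (fun k => hq ▸ h k)
  have h2 := (levelUnits hn hna κ).hasSum_Q i p q
  have h3 : (fun m => (levelUnits hn hna κ).e p m * (levelUnits hn hna κ).e m q) =
      fun m => loopUnit hn hna κ p m * loopUnit hn hna κ m q := by
    funext m
    rw [levelUnits_e_of_ediv_eq_zero hn hna κ hp, levelUnits_e_of_ediv_eq_zero' hn hna κ hq]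
  rw [h3] at h2
  rw [h2.unique h1, quadSum, ← Finset.sum_filter_add_sum_filter_not _ fun k : Fin n => (k : ℕ) < i]
  simp only [not_lt]
  congr 1
  · refine Finset.sum_congr rfl fun k hk => ?_
    rw [if_pos (Finset.mem_filter.mp hk).2]
  · refine Finset.sum_congr rfl fun k hk => ?_
    rw [if_neg (not_lt.mpr (Finset.mem_filter.mp hk).2)]

/-- For the node `0` the matrix unit `e (-1) (-1)` carries the constant `κ`; this is the source of the
terms with `c` in the evaluation elements of that node. -/
theorem levelUnits_Q_zero (p q : ℤ) (hp : p = -1 ∨ p = 0) (hq : q = -1 ∨ q = 0) (α β : ℕ)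
    (hα : (α : ℤ) = 1 + p) (hβ : (β : ℤ) = 1 + q) :
    (levelUnits hn hna κ).Q 0 p q =
      ∑ k : Fin n, (levelCurrents a κ).quad (up hna (residue hn p)) (up hna k)
        (up hna (residue hn q)) α β
      + ((levelUnits hn hna κ).e p (-1) * (levelUnits hn hna κ).e (-1) q
        - loopUnit hn hna κ p (-1) * loopUnit hn hna κ (-1) q) := by
  have hdiv : ∀ p : ℤ, p = -1 ∨ p = 0 → p / n = p := by
    rintro p (rfl | rfl)
    exacts [neg_one_ediv hn, Int.zero_ediv _]
  have hk : ∀ k : Fin n, (if (k : ℤ) < 0 then 0 else 1 : ℤ) = 1 := fun k => if_neg (by omega)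
  have h1 := hasSum_below_loopUnit hn hna κ (i := 0) le_rfl (by omega) p q
    (fun _ => α) (fun _ => β) (fun k => by rw [hk, hdiv p hp, hα]) (fun k => by
      rw [hk, hdiv q hq, hβ])
  have h2 := (levelUnits hn hna κ).hasSum_Q 0 p q
  refine h2.unique (hasSum_of_eq (h1.add (hasSum_ite_eq (-1) _)) fun m => ?_)
  by_cases hm : m = -1
  · subst hm
    rw [if_pos rfl, below, below, if_pos (by decide), if_pos (by decide), add_sub_cancel]
  · rw [if_neg hm, add_zero, below, below]
    refine if_ctx_congr Iff.rfl (fun hm0 => ?_) fun _ => rfl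
    rw [levelUnits_e_of_ne hn hna κ (by omega), levelUnits_e_of_ne hn hna κ (by omega)]

theorem node_sub_one_ediv {i : Fin n} (hi : i.val ≠ 0) : ((i : ℤ) - 1) / n = 0 := by
  rw [fin_sub_one_ediv, delta0, if_neg hi, neg_zero]

theorem node_coeff (ħ x : ℂ) (hħ : ħ ≠ 0) (i : ℂ) :
    ħ * (x / ħ - i / 2) = -(i / 2 * ħ) + x := by
  field_simp
  ring

theorem smul_raise1_eq_evXPlus {ħ : ℂ} (hħ : ħ ≠ 0) (x : ℂ) (i : Fin n) :
    ħ • (levelUnits hn hna κ).raise1 (x / ħ) i =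
      (levelCurrents a κ).evXPlus hna ħ i + x • (levelCurrents a κ).x hna 1 i := by
  rw [PeriodicUnits.raise1, smul_add, smul_smul, node_coeff ħ x hħ, levelUnits_raise, Currents.evXPlus,
    add_smul]
  by_cases hi : i.val = 0
  · have h1 := levelUnits_raise hn hna κ i
    have h2 := up_residue_node hn hna i
    have h3 := up_residue_node_sub_one hn hna i
    simp only [hi, Nat.cast_zero, zero_sub] at h1 h2 h3
    simp only [hi, Nat.cast_zero, zero_sub, Int.cast_zero, if_true]
    rw [levelUnits_Q_zero hn hna κ (-1) 0 (.inl rfl) (.inr rfl) 0 1 (by norm_num) (by norm_num), h1,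
      levelUnits_e_self, neg_one_ediv hn, ← levelUnits_e_of_ne hn hna κ (by decide : (-1 : ℤ) ≠ 0),
      h1, h2, h3, ← sub_mul, sub_sub_cancel_left, levelCurrents_C, ← map_neg]
    simp only [Int.cast_neg, Int.cast_one, neg_mul, one_mul, neg_neg, smul_add, zero_div, zero_mul,
      neg_zero, zero_smul, zero_add]
    abel
  · rw [if_neg hi, levelUnits_Q_of_ediv_eq_zero hn hna κ i (node_sub_one_ediv hi) (ediv_fin i),
      up_residue_node, up_residue_node_sub_one, quadSum, smul_add, Int.cast_natCast]
    abel

theorem smul_lower1_eq_evXMinus {ħ : ℂ} (hħ : ħ ≠ 0) (x : ℂ) (i : Fin n) :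
    ħ • (levelUnits hn hna κ).lower1 (x / ħ) i =
      (levelCurrents a κ).evXMinus hna ħ i + x • (levelCurrents a κ).x hna (-1) i := by
  rw [PeriodicUnits.lower1, smul_add, smul_smul, node_coeff ħ x hħ, levelUnits_lower,
    Currents.evXMinus, add_smul]
  by_cases hi : i.val = 0
  · have h1 := levelUnits_lower hn hna κ i
    have h2 := up_residue_node hn hna i
    have h3 := up_residue_node_sub_one hn hna i
    simp only [hi, Nat.cast_zero, zero_sub] at h1 h2 h3
    simp only [hi, Nat.cast_zero, zero_sub, Int.cast_zero, if_true]
    rw [levelUnits_Q_zero hn hna κ 0 (-1) (.inr rfl) (.inl rfl) 1 0 (by norm_num) (by norm_num), h1,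
      levelUnits_e_self, neg_one_ediv hn, ← levelUnits_e_of_ne hn hna κ (by decide : (0 : ℤ) ≠ -1),
      h1, h2, h3, ← mul_sub, sub_sub_cancel_left, levelCurrents_C, ← map_neg, ← Algebra.commutes]
    simp only [Int.cast_neg, Int.cast_one, neg_mul, one_mul, neg_neg, smul_add, zero_div, zero_mul,
      neg_zero, zero_smul, zero_add]
    abel
  · rw [if_neg hi, levelUnits_Q_of_ediv_eq_zero hn hna κ i (ediv_fin i) (node_sub_one_ediv hi),
      up_residue_node, up_residue_node_sub_one, quadSum, smul_add, Int.cast_natCast]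
    abel

theorem smul_cartan1_eq_evH {ħ : ℂ} (hħ : ħ ≠ 0) (x : ℂ) (i : Fin n) :
    ħ • (levelUnits hn hna κ).cartan1 (x / ħ) i =
      (levelCurrents a κ).evH hna ħ i + x • (levelCurrents a κ).h hna i := by
  rw [PeriodicUnits.cartan1, smul_sub, smul_add, smul_sub, smul_smul, node_coeff ħ x hħ,
    levelUnits_cartan0, Currents.evH, add_smul, levelUnits_left, levelUnits_right]
  by_cases hi : i.val = 0
  · have h2 := up_residue_node hn hna i
    have h3 := up_residue_node_sub_one hn hna i
    have h4 := levelUnits_right hn hna κ i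
    have h5 := levelUnits_left hn hna κ i
    have h6 : (levelCurrents a κ).h hna i = (levelCurrents a κ).E (lft hna i) (lft hna i) 0
        - (levelCurrents a κ).E (rgt hna i) (rgt hna i) 0 + algebraMap ℂ _ κ := by
      rw [Currents.h, chevalleyH, if_pos hi, levelCurrents_C]
    simp only [hi, Nat.cast_zero, zero_sub, delta0, if_true, Int.cast_one, one_mul] at h2 h3 h4 h5
    simp only [hi, Nat.cast_zero, zero_sub, Int.cast_zero, if_true, delta0, Int.cast_one, one_mul]
    rw [levelUnits_Q_zero hn hna κ (-1) (-1) (.inl rfl) (.inl rfl) 0 0 (by norm_num) (by norm_num),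
      levelUnits_Q_zero hn hna κ 0 0 (.inr rfl) (.inr rfl) 1 1 (by norm_num) (by norm_num),
      levelUnits_e_of_ne hn hna κ (by decide : (0 : ℤ) ≠ -1),
      levelUnits_e_of_ne hn hna κ (by decide : (-1 : ℤ) ≠ 0), h5, loopUnit, loopUnit, loopUnit,
      h2, h3, sub_self, levelCurrents_C, h6]
    generalize (levelCurrents a κ).E (lft hna i) (lft hna i) 0 = y
    generalize (levelCurrents a κ).E (rgt hna i) (rgt hna i) 0 = w
    have hy := Algebra.commutes κ y
    generalize algebraMap ℂ (CompletedU a κ) κ = k at *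
    have key : (y + k) * (y + k) - y * y - (y + k) * w = k * (y - w + k) - y * (w - k) := by
      simp only [add_mul, mul_add, mul_sub, hy]
      abel
    rw [sub_eq_iff_eq_add.mp key]
    simp only [smul_add, smul_sub, sub_self, zero_div, zero_mul, neg_zero, zero_smul, smul_zero]
    abel
  · rw [if_neg hi, levelUnits_Q_of_ediv_eq_zero hn hna κ i (node_sub_one_ediv hi)
      (node_sub_one_ediv hi), levelUnits_Q_of_ediv_eq_zero hn hna κ i (ediv_fin i) (ediv_fin i),
      up_residue_node, up_residue_node_sub_one, quadSum, quadSum, smul_add, smul_add,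
      Int.cast_natCast, delta0, if_neg hi, Int.cast_zero, zero_mul, map_zero, add_zero]
    abel

end Matching

/-! ### Extension of homomorphisms to completions -/

section Extension

open completionPart

variable {A B : Type*} [Ring A] [Algebra ℂ A] [Ring B] [Algebra ℂ B] {𝒜 : ℤ → Submodule ℂ A}
  {ℬ : ℤ → Submodule ℂ B} [SetLike.GradedMonoid 𝒜] [SetLike.GradedMonoid ℬ]

theorem completionPart.proj_mul_congr {d e : ℤ} {f f' : completionPart 𝒜 d}
    {g g' : completionPart 𝒜 e} {N K : ℕ} (hK : (N : ℤ) ≤ K + e) (hf : proj d K f = proj d K f')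
    (hg : proj e N g = proj e N g') : proj (d + e) N (mul f g) = proj (d + e) N (mul f' g') :=
  (mul_apply f g hK (rep_mem f K) (rep_mem g N) (mk_rep f le_rfl) (mk_rep g le_rfl)).trans
    (mul_apply f' g' hK (rep_mem f K) (rep_mem g N) (hf.symm.trans (mk_rep f le_rfl))
      (hg.symm.trans (mk_rep g le_rfl))).symm

/-- A homogeneous element of degree `r > N` lies in the ideal `vanish 𝒜 N`, as `y = 1 · y`. -/
theorem mem_vanish_of_lt {r : ℤ} {N : ℕ} (hr : (N : ℤ) < r) {y : Completion 𝒜}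
    (hy : y ∈ homogeneousPart 𝒜 r) : y ∈ vanish 𝒜 N := by
  obtain ⟨g, rfl⟩ := exists_of_eq hy
  rw [of_mem_vanish, proj_eq_mk_rep g le_rfl, Submodule.Quotient.mk_eq_zero, ← one_mul (rep g N)]
  exact mul_mem_tail 𝒜 hr (by rw [sub_self]; exact SetLike.GradedOne.one_mem) (rep_mem g N)

theorem of_apply_of_mem {d : ℤ} {y : Completion 𝒜} (hy : y ∈ homogeneousPart 𝒜 d) :
    DirectSum.of (completionPart 𝒜) d (y d) = y := by
  obtain ⟨g, rfl⟩ := exists_of_eq hy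
  rw [DirectSum.of_eq_same]

theorem one_mem_homogeneousPart : (1 : Completion 𝒜) ∈ homogeneousPart 𝒜 0 :=
  of_mem_homogeneousPart _

variable (f : A →ₐ[ℂ] Completion ℬ) (hf : ∀ d, ∀ x ∈ 𝒜 d, f x ∈ homogeneousPart ℬ d)

omit [SetLike.GradedMonoid 𝒜] in
include hf in
theorem map_mem_vanish_of_mem_tail {N : ℕ} {d : ℤ} {x : A} (hx : x ∈ tail 𝒜 N d) :
    f x ∈ vanish ℬ N := by
  refine tail_induction 𝒜 (p := fun x => f x ∈ vanish ℬ N) (fun r hr x _ y hy => ?_)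
    (fun x y hx hy => ?_) ?_ hx
  · rw [map_mul]
    exact (vanish ℬ N).smul_mem (f x) (mem_vanish_of_lt hr (hf r y hy))
  · rw [map_add]
    exact add_mem hx hy
  · rw [map_zero]
    exact zero_mem _

include hf in
theorem proj_map_congr {N : ℕ} {d : ℤ} {x y : A}
    (hxy : (Submodule.Quotient.mk x : A ⧸ tail 𝒜 N d) = Submodule.Quotient.mk y) :
    proj d N (f x d) = proj d N (f y d) := by
  rw [← sub_eq_zero, ← map_sub, ← DirectSum.sub_apply, ← map_sub]
  exact map_mem_vanish_of_mem_tail f hf ((Submodule.Quotient.eq _).mp hxy) d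

/-- The extension of a homogeneous homomorphism `A → B̂` to the degree `d` part of the completion of
`A`: its value at level `N` is computed on a representative at level `N`. -/
def extendPart (d : ℤ) (g : completionPart 𝒜 d) : completionPart ℬ d :=
  ⟨fun N => proj d N (f (rep g N) d), fun N =>
    ⟨rep (f (rep g N) d) N, rep_mem _ _, fun M hM => by
      rw [← proj_eq_mk_rep _ hM]
      exact proj_map_congr f hf ((mk_rep g le_rfl).symm.trans (mk_rep g hM))⟩⟩

theorem proj_extendPart {d : ℤ} {g : completionPart 𝒜 d} {N : ℕ} {x : A}
    (hx : proj d N g = Submodule.Quotient.mk x) :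
    proj d N (extendPart f hf d g) = proj d N (f x d) :=
  proj_map_congr f hf ((mk_rep g le_rfl).symm.trans hx)

/-- `extendPart` as a linear map into the completion of `B`. -/
def extendLinear (d : ℤ) : completionPart 𝒜 d →ₗ[ℂ] Completion ℬ :=
  DirectSum.lof ℂ ℤ (completionPart ℬ) d ∘ₗ
    { toFun := extendPart f hf d
      map_add' g h := ext_proj fun N => by
        have hx : proj d N (g + h) = Submodule.Quotient.mk (rep g N + rep h N) := by
          rw [map_add, proj_eq_mk_rep g le_rfl, proj_eq_mk_rep h le_rfl, Submodule.Quotient.mk_add]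
        rw [proj_extendPart f hf hx, map_add, DirectSum.add_apply, map_add, map_add]
        rfl
      map_smul' r g := ext_proj fun N => by
        have hx : proj d N (r • g) = Submodule.Quotient.mk (r • rep g N) := by
          rw [map_smul, proj_eq_mk_rep g le_rfl, Submodule.Quotient.mk_smul]
        rw [proj_extendPart f hf hx, map_smul, DirectSum.smul_apply, map_smul, RingHom.id_apply,
          map_smul]
        rfl }

theorem extendLinear_apply (d : ℤ) (g : completionPart 𝒜 d) :
    extendLinear f hf d g = DirectSum.of (completionPart ℬ) d (extendPart f hf d g) := rfl

theorem extendLinear_of {d : ℤ} {x : A} (hx : x ∈ 𝒜 d) :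
    extendLinear f hf d (of x hx) = f x := by
  rw [extendLinear_apply, ← of_apply_of_mem (hf d x hx)]
  exact congrArg _ (ext_proj fun N => proj_extendPart f hf (proj_of x hx N))

theorem extendLinear_mul {d e : ℤ} (g : completionPart 𝒜 d) (h : completionPart 𝒜 e) :
    extendLinear f hf (d + e) (mul g h) = extendLinear f hf d g * extendLinear f hf e h := by
  rw [extendLinear_apply, extendLinear_apply, extendLinear_apply, DirectSum.of_mul_of]
  refine congrArg _ (ext_proj fun N => ?_)
  have hK : (N : ℤ) ≤ (N - e).toNat + e := by omega
  rw [proj_extendPart f hf (mul_apply_rep g h hK le_rfl), map_mul,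
    ← of_apply_of_mem (hf d _ (rep_mem g (N - e).toNat)),
    ← of_apply_of_mem (hf e _ (rep_mem h N)), DirectSum.of_mul_of, DirectSum.of_eq_same]
  exact proj_mul_congr hK (proj_extendPart f hf (proj_eq_mk_rep g le_rfl)).symm
    (proj_extendPart f hf (proj_eq_mk_rep h le_rfl)).symm

/-- The extension of a homogeneous homomorphism `A → B̂` to the completion of `A`. -/
def extend : Completion 𝒜 →ₐ[ℂ] Completion ℬ :=
  DirectSum.toAlgebra ℂ (completionPart 𝒜) (extendLinear f hf)
    ((extendLinear_of f hf SetLike.GradedOne.one_mem).trans (map_one f))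
    fun g h => extendLinear_mul f hf g h

theorem extend_of (d : ℤ) (g : completionPart 𝒜 d) :
    extend f hf (DirectSum.of (completionPart 𝒜) d g) =
      DirectSum.of (completionPart ℬ) d (extendPart f hf d g) :=
  DirectSum.toAddMonoid_of (β := completionPart 𝒜) (fun d => (extendLinear f hf d).toAddMonoidHom) d g

theorem extend_toCompletion {d : ℤ} {x : A} (hx : x ∈ 𝒜 d) :
    extend f hf (toCompletion d x hx) = f x :=
  (extend_of f hf d _).trans (extendLinear_of f hf hx)

theorem proj_extendPart_eq_zero {d : ℤ} {g : completionPart 𝒜 d} {N : ℕ} (hg : proj d N g = 0) :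
    proj d N (extendPart f hf d g) = 0 := by
  rw [proj_extendPart f hf (hg.trans (Submodule.Quotient.mk_zero _).symm), map_zero,
    DirectSum.zero_apply, map_zero]

theorem extend_mem_vanish {N : ℕ} {y : Completion 𝒜} (hy : y ∈ vanish 𝒜 N) :
    extend f hf y ∈ vanish ℬ N := by
  classical
  rw [← DirectSum.sum_support_of y, map_sum]
  refine sum_mem fun d _ => ?_
  rw [extend_of, of_mem_vanish]
  exact proj_extendPart_eq_zero f hf (hy d)

theorem hasSum_extend {ι : Type*} {g : ι → Completion 𝒜} {y : Completion 𝒜} (h : HasSum g y) :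
    HasSum (fun i => extend f hf (g i)) (extend f hf y) := by
  refine hasSum_completion_iff.mpr fun N => ?_
  obtain ⟨s, hs⟩ := hasSum_completion_iff.mp h N
  refine ⟨s, fun t ht => ?_⟩
  rw [← map_sum, ← map_sub]
  exact extend_mem_vanish f hf (hs t ht)

theorem isGradedContinuous_extend : IsGradedContinuous (extend f hf : Completion 𝒜 → Completion ℬ) where
  graded d g := ⟨_, extend_of f hf d g⟩
  continuous d N := ⟨N, fun g h hgh hg => by
    rw [extend_of] at hgh
    rw [← DirectSum.of_injective d hgh]
    exact proj_extendPart_eq_zero f hf hg⟩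

/-- A graded continuous homomorphism is determined by its values on the homogeneous elements of `A`,
since these are dense in every degree. -/
theorem IsGradedContinuous.algHom_ext {φ ψ : Completion 𝒜 →ₐ[ℂ] Completion ℬ}
    (hφ : IsGradedContinuous (φ : Completion 𝒜 → Completion ℬ))
    (hψ : IsGradedContinuous (ψ : Completion 𝒜 → Completion ℬ))
    (h : ∀ d x (hx : x ∈ 𝒜 d), φ (toCompletion d x hx) = ψ (toCompletion d x hx)) : φ = ψ := by
  refine DFunLike.ext _ _ fun y => ?_
  induction y using DirectSum.induction_on with
  | zero => rw [map_zero, map_zero]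
  | add u v hu hv => rw [map_add, map_add, hu, hv]
  | of d g =>
    obtain ⟨u, hu⟩ := hφ.graded d g
    obtain ⟨v, hv⟩ := hψ.graded d g
    rw [hu, hv]
    refine congrArg _ (ext_proj fun N => ?_)
    obtain ⟨K, hK⟩ := hφ.continuous d N
    obtain ⟨L, hL⟩ := hψ.continuous d N
    have hx := rep_mem g (max K L)
    obtain ⟨w, hw⟩ := hφ.graded d (of _ hx)
    have hw' : ψ (DirectSum.of (completionPart 𝒜) d (of _ hx)) = DirectSum.of (completionPart ℬ) d w :=
      (h d _ hx).symm.trans hw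
    have h0 := proj_sub_of_rep g (max K L)
    have h1 := hK (g - of _ hx) (u - w) (by rw [map_sub, map_sub, map_sub, hu, hw])
      (proj_eq_zero_of_le (le_max_left K L) h0)
    have h2 := hL (g - of _ hx) (v - w) (by rw [map_sub, map_sub, map_sub, hv, hw'])
      (proj_eq_zero_of_le (le_max_right K L) h0)
    have h3 : proj d N u - proj d N w = 0 := h1
    have h4 : proj d N v - proj d N w = 0 := h2
    rw [sub_eq_zero.mp h3, sub_eq_zero.mp h4]

theorem Currents.quad_mem_homogeneousPart {a : ℕ} (F : Currents 𝒜 a) (i k j : Fin a) (α β : ℕ) :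
    F.quad i k j α β ∈ homogeneousPart 𝒜 ((β : ℤ) - α) :=
  of_mem_homogeneousPart _

theorem Currents.map_evH {n a : ℕ} (hna : n ≤ a) (ħ : ℂ) {F : Currents 𝒜 a} {G : Currents ℬ a}
    {φ : Completion 𝒜 →ₐ[ℂ] Completion ℬ} (hE : ∀ i j s, φ (F.E i j s) = G.E i j s)
    (hC : φ F.C = G.C) (hQ : ∀ i k j α β, φ (F.quad i k j α β) = G.quad i k j α β) (i : Fin n) :
    φ (F.evH hna ħ i) = G.evH hna ħ i := by
  have hh : φ (F.h hna i) = G.h hna i := by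
    rw [Currents.h, Currents.h, chevalleyH, chevalleyH, map_add, map_sub, hE, hE, apply_ite φ, hC,
      map_zero]
  rw [Currents.evH, Currents.evH, apply_ite φ]
  simp only [map_add, map_sub, map_smul, map_mul, map_sum, hE, hC, hQ, hh]

end Extension

/-! ### Values at the generators -/

section Evaluation

theorem GuayRel.map {A B : Type*} [Ring A] [Algebra ℂ A] [Ring B] [Algebra ℂ B] {n : ℕ} {ħ ε : ℂ}
    {H : Fin n → Fin 2 → A} {X : ℤˣ → Fin n → Fin 2 → A} (φ : A →ₐ[ℂ] B) {u v : A}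
    (h : GuayRel ħ ε H X u v) :
    GuayRel ħ ε (fun i r => φ (H i r)) (fun σ i r => φ (X σ i r)) (φ u) (φ v) := by
  have hl : ∀ x y : A, φ ⁅x, y⁆ = ⁅φ x, φ y⁆ := fun x y => by
    rw [Ring.lie_def, map_sub, map_mul, map_mul, Ring.lie_def]
  cases h with
  | H_H i j r s => rw [hl, map_zero]; exact .H_H i j r s
  | X_X_zero i j => rw [hl, apply_ite φ, map_zero]; exact .X_X_zero i j
  | X_X_left i j => rw [hl, apply_ite φ, map_zero]; exact .X_X_left i j
  | X_X_right i j => rw [hl, apply_ite φ, map_zero]; exact .X_X_right i j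
  | H_X_zero σ i j r => rw [hl, map_smul]; exact .H_X_zero σ i j r
  | H_X_one σ i j hij =>
    rw [hl, map_sub, map_smul, map_smul, map_pow]
    exact .H_X_one (H := fun i r => φ (H i r)) (X := fun σ i r => φ (X σ i r)) σ i j hij
  | H_X_first_last σ i j hi hj =>
    rw [hl, map_sub, map_smul, map_pow, map_neg, map_smul, map_sub, map_smul]
    exact .H_X_first_last (H := fun i r => φ (H i r)) (X := fun σ i r => φ (X σ i r)) σ i j hi hj
  | H_X_last_first σ i j hi hj =>
    rw [hl, map_sub, map_smul, map_pow, map_neg, map_smul, map_add, map_smul]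
    exact .H_X_last_first (H := fun i r => φ (H i r)) (X := fun σ i r => φ (X σ i r)) σ i j hi hj
  | X_X_same σ i j hij =>
    rw [map_sub, hl, hl, map_smul, map_add, map_mul, map_mul]
    exact .X_X_same (H := fun i r => φ (H i r)) (X := fun σ i r => φ (X σ i r)) σ i j hij
  | X_X_first_last σ i j hi hj =>
    rw [map_sub, hl, hl, map_sub, map_neg, map_smul, map_add, map_mul, map_mul, map_smul, hl]
    exact .X_X_first_last (H := fun i r => φ (H i r)) (X := fun σ i r => φ (X σ i r)) σ i j hi hj
  | serre σ i j hij =>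
    have hs : ∀ m : ℕ, φ ((fun y => ⁅X σ i 0, y⁆)^[m] (X σ j 0)) =
        (fun y => ⁅φ (X σ i 0), y⁆)^[m] (φ (X σ j 0)) := by
      intro m
      induction m with
      | zero => rfl
      | succ m ih => rw [Function.iterate_succ_apply', Function.iterate_succ_apply', hl, ih]
    rw [hs, map_zero]
    exact .serre (H := fun i r => φ (H i r)) (X := fun σ i r => φ (X σ i r)) σ i j hij

variable {n a : ℕ} (hn : 0 < n) (hna : n ≤ a) (ħ ε κ x : ℂ)

/-- The values of the evaluation map at the generators. -/
def evGen : Gen n a → CompletedU a κ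
  | .H i r => (levelUnits hn hna κ).genH ħ (x / ħ) i r
  | .X σ i r => (levelUnits hn hna κ).genX ħ (x / ħ) σ i r
  | .e i j s => (levelCurrents a κ).E i j s
  | .c => algebraMap ℂ _ κ

theorem evGen_H_zero (i : Fin n) :
    evGen hn hna ħ κ x (.H i 0) = (levelCurrents a κ).h hna i :=
  levelUnits_cartan0 hn hna κ i

theorem evGen_X_zero (σ : ℤˣ) (i : Fin n) :
    evGen hn hna ħ κ x (.X σ i 0) = (levelCurrents a κ).x hna σ i := by
  rcases Int.units_eq_one_or σ with rfl | rfl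
  · exact levelUnits_raise hn hna κ i
  · exact levelUnits_lower hn hna κ i

variable {ħ}

theorem evGen_H_one (hħ : ħ ≠ 0) (i : Fin n) : evGen hn hna ħ κ x (.H i 1) =
    (levelCurrents a κ).evH hna ħ i + x • (levelCurrents a κ).h hna i :=
  smul_cartan1_eq_evH hn hna κ hħ x i

theorem evGen_X_one (hħ : ħ ≠ 0) (i : Fin n) : evGen hn hna ħ κ x (.X 1 i 1) =
    (levelCurrents a κ).evXPlus hna ħ i + x • (levelCurrents a κ).x hna 1 i :=
  smul_raise1_eq_evXPlus hn hna κ hħ x i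

theorem evGen_X_neg_one (hħ : ħ ≠ 0) (i : Fin n) : evGen hn hna ħ κ x (.X (-1) i 1) =
    (levelCurrents a κ).evXMinus hna ħ i + x • (levelCurrents a κ).x hna (-1) i :=
  smul_lower1_eq_evXMinus hn hna κ hħ x i

theorem Currents.E_mem_homogeneousPart {A : Type*} [Ring A] [Algebra ℂ A] {𝒜 : ℤ → Submodule ℂ A}
    [SetLike.GradedMonoid 𝒜] (F : Currents 𝒜 a) (i j : Fin a) (s : ℤ) :
    F.E i j s ∈ homogeneousPart 𝒜 s :=
  of_mem_homogeneousPart _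

section Degrees

variable {A : Type*} [Ring A] [Algebra ℂ A] {𝒜 : ℤ → Submodule ℂ A} [SetLike.GradedMonoid 𝒜]
  (F : Currents 𝒜 a)

theorem Currents.C_mem_homogeneousPart : F.C ∈ homogeneousPart 𝒜 0 :=
  of_mem_homogeneousPart _

theorem Currents.h_mem_homogeneousPart (i : Fin n) : F.h hna i ∈ homogeneousPart 𝒜 0 := by
  refine add_mem (sub_mem (F.E_mem_homogeneousPart _ _ _) (F.E_mem_homogeneousPart _ _ _)) ?_
  split_ifs
  exacts [F.C_mem_homogeneousPart, zero_mem _]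

theorem Currents.x_mem_homogeneousPart (σ : ℤˣ) (i : Fin n) :
    F.x hna σ i ∈ homogeneousPart 𝒜 ((σ : ℤ) * delta0 i) := by
  rcases Int.units_eq_one_or σ with rfl | rfl
  · rw [Units.val_one, one_mul]
    exact F.E_mem_homogeneousPart _ _ _
  · rw [Units.val_neg, Units.val_one, neg_one_mul]
    exact F.E_mem_homogeneousPart _ _ _

theorem Currents.quad_mem_homogeneousPart_of_eq {d : ℤ} (i k j : Fin a) {α β : ℕ}
    (h : (β : ℤ) - α = d) : F.quad i k j α β ∈ homogeneousPart 𝒜 d :=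
  h ▸ F.quad_mem_homogeneousPart i k j α β

theorem Currents.evXPlus_mem_homogeneousPart (i : Fin n) :
    F.evXPlus hna ħ i ∈ homogeneousPart 𝒜 (delta0 i) := by
  have hx := F.x_mem_homogeneousPart hna 1 i
  rw [Units.val_one, one_mul] at hx
  unfold Currents.evXPlus
  by_cases hi : i.val = 0
  · rw [if_pos hi]
    have hC := mul_mem_homogeneousPart F.C_mem_homogeneousPart hx
    rw [zero_add] at hC
    exact add_mem (Submodule.smul_mem _ _ hC) (Submodule.smul_mem _ _ (sum_mem fun k _ =>
      F.quad_mem_homogeneousPart_of_eq _ _ _ (by simp [delta0, hi])))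
  · rw [if_neg hi]
    exact add_mem (add_mem (Submodule.smul_mem _ _ hx) (Submodule.smul_mem _ _ (sum_mem fun k _ =>
      F.quad_mem_homogeneousPart_of_eq _ _ _ (by simp [delta0, hi]))))
      (Submodule.smul_mem _ _ (sum_mem fun k _ =>
      F.quad_mem_homogeneousPart_of_eq _ _ _ (by simp [delta0, hi])))

theorem Currents.evXMinus_mem_homogeneousPart (i : Fin n) :
    F.evXMinus hna ħ i ∈ homogeneousPart 𝒜 (-delta0 i) := by
  have hx := F.x_mem_homogeneousPart hna (-1) i
  rw [Units.val_neg, Units.val_one, neg_one_mul] at hx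
  unfold Currents.evXMinus
  by_cases hi : i.val = 0
  · rw [if_pos hi]
    have hC := mul_mem_homogeneousPart F.C_mem_homogeneousPart hx
    rw [zero_add] at hC
    exact add_mem (Submodule.smul_mem _ _ hC) (Submodule.smul_mem _ _ (sum_mem fun k _ =>
      F.quad_mem_homogeneousPart_of_eq _ _ _ (by simp [delta0, hi])))
  · rw [if_neg hi]
    exact add_mem (add_mem (Submodule.smul_mem _ _ hx) (Submodule.smul_mem _ _ (sum_mem fun k _ =>
      F.quad_mem_homogeneousPart_of_eq _ _ _ (by simp [delta0, hi]))))
      (Submodule.smul_mem _ _ (sum_mem fun k _ =>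
      F.quad_mem_homogeneousPart_of_eq _ _ _ (by simp [delta0, hi])))

theorem Currents.evH_mem_homogeneousPart (i : Fin n) :
    F.evH hna ħ i ∈ homogeneousPart 𝒜 0 := by
  have hh := F.h_mem_homogeneousPart hna i
  have hE : ∀ p q, F.E p q 0 ∈ homogeneousPart 𝒜 0 := fun p q => F.E_mem_homogeneousPart p q 0
  have hmul : ∀ {y z : Completion 𝒜}, y ∈ homogeneousPart 𝒜 0 → z ∈ homogeneousPart 𝒜 0 →
      y * z ∈ homogeneousPart 𝒜 0 := fun hy hz => by
    have := mul_mem_homogeneousPart hy hz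
    rwa [zero_add] at this
  have hQ : ∀ (s : Finset (Fin n)) (p q : Fin a) (α : ℕ),
      ħ • ∑ k ∈ s, F.quad p (up hna k) q α α ∈ homogeneousPart 𝒜 0 := fun s p q α =>
    Submodule.smul_mem _ _ (sum_mem fun k _ => F.quad_mem_homogeneousPart_of_eq _ _ _ (sub_self _))
  unfold Currents.evH
  split_ifs
  · exact sub_mem (add_mem (sub_mem (Submodule.smul_mem _ _ (hmul F.C_mem_homogeneousPart hh))
      (Submodule.smul_mem _ _ (hmul (hE _ _) (sub_mem (hE _ _) F.C_mem_homogeneousPart))))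
      (hQ _ _ _ _)) (hQ _ _ _ _)
  · exact sub_mem (sub_mem (add_mem (add_mem (sub_mem (Submodule.smul_mem _ _ hh)
      (Submodule.smul_mem _ _ (hmul (hE _ _) (hE _ _)))) (hQ _ _ _ _)) (hQ _ _ _ _))
      (hQ _ _ _ _)) (hQ _ _ _ _)

end Degrees

theorem evGen_mem_homogeneousPart (hħ : ħ ≠ 0) (g : Gen n a) :
    evGen hn hna ħ κ x g ∈ homogeneousPart (levelGrading a κ) g.deg := by
  cases g with
  | H i r =>
    have h := (levelCurrents a κ).h_mem_homogeneousPart hna i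
    match r with
    | 0 => rw [evGen_H_zero]; exact h
    | 1 =>
      rw [evGen_H_one hn hna κ x hħ]
      exact add_mem (Currents.evH_mem_homogeneousPart hna _ i) (Submodule.smul_mem _ _ h)
  | X σ i r =>
    have h := (levelCurrents a κ).x_mem_homogeneousPart hna σ i
    match r with
    | 0 => rw [evGen_X_zero]; exact h
    | 1 =>
      change _ ∈ homogeneousPart _ ((σ : ℤ) * delta0 i)
      rcases Int.units_eq_one_or σ with rfl | rfl
      · rw [evGen_X_one hn hna κ x hħ]
        refine add_mem ?_ (Submodule.smul_mem _ _ h)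
        rw [Units.val_one, one_mul]
        exact Currents.evXPlus_mem_homogeneousPart hna _ i
      · rw [evGen_X_neg_one hn hna κ x hħ]
        refine add_mem ?_ (Submodule.smul_mem _ _ h)
        rw [Units.val_neg, Units.val_one, neg_one_mul]
        exact Currents.evXMinus_mem_homogeneousPart hna _ i
  | e i j s => exact (levelCurrents a κ).E_mem_homogeneousPart i j s
  | c =>
    have h := (levelCurrents a κ).C_mem_homogeneousPart
    rw [levelCurrents_C] at h
    exact h

end Evaluation

/-! ### The evaluation homomorphism -/

section Homomorphism

variable {n a : ℕ} (hn : 3 ≤ n) (hna : n ≤ a) {ħ ε κ : ℂ} (hκ : ħ * κ = -(n * ħ + ε)) (x : ℂ)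

include hκ in
theorem lift_evGen_rel {u v : FreeAlgebra ℂ (Gen n a)} (h : TildeRel hna ħ ε u v) :
    FreeAlgebra.lift ℂ (evGen (by omega) hna ħ κ x) u =
      FreeAlgebra.lift ℂ (evGen (by omega) hna ħ κ x) v := by
  have hn' : 0 < n := by omega
  obtain ⟨f, hf⟩ : ∃ f, f = FreeAlgebra.lift ℂ (evGen hn' hna ħ κ x) := ⟨_, rfl⟩
  have hg : ∀ g, f (freeGen g) = evGen hn' hna ħ κ x g := fun g => by
    rw [hf, freeGen, FreeAlgebra.lift_ι_apply]
  have hl : ∀ y z, f ⁅y, z⁆ = ⁅f y, f z⁆ := fun y z => by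
    rw [Ring.lie_def, map_sub, map_mul, map_mul, Ring.lie_def]
  rw [← hf]
  cases h with
  | guay h =>
    have h' := h.map f
    simp only [hg] at h'
    exact (levelUnits hn' hna κ).guayRel hn hκ h'
  | e_e p q i j s u =>
    rw [hl, map_add, map_add, map_sub, apply_ite f, apply_ite f, apply_ite f, apply_ite f, map_zero,
      map_smul, AlgHom.commutes, hg, hg, hg, hg, hg]
    refine (levelCurrents_E_lie a κ p q i j s u).trans ?_
    rw [map_mul, ← Algebra.smul_def]
    rfl
  | c_central u =>
    rw [hl, hg, map_zero]
    exact algebraMap_lie_eq_zero κ _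
  | H_zero i =>
    rw [hg, evGen_H_zero, chevalleyH, map_add, map_sub, apply_ite f, map_zero, hg, hg, hg,
      Currents.h, chevalleyH, levelCurrents_C]
    rfl
  | X_zero σ i =>
    rw [hg, evGen_X_zero, chevalleyX, apply_ite f, hg, hg, Currents.x, chevalleyX]
    rfl

/-- The evaluation map on the algebra before completion. -/
def tildeEv : TildeYangian hna ħ ε →ₐ[ℂ] CompletedU a κ :=
  RingQuot.liftAlgHom ℂ ⟨FreeAlgebra.lift ℂ (evGen (by omega) hna ħ κ x),
    fun _ _ h => lift_evGen_rel hn hna hκ x h⟩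

theorem tildeEv_tildeGen (g : Gen n a) :
    tildeEv hn hna hκ x (tildeGen hna ħ ε g) = evGen (by omega) hna ħ κ x g := by
  rw [tildeEv, tildeGen, RingQuot.liftAlgHom_mkAlgHom_apply, freeGen, FreeAlgebra.lift_ι_apply]

/-- The evaluation map preserves degrees. -/
theorem tildeEv_mem_homogeneousPart (hħ : ħ ≠ 0) (d : ℤ) (y : TildeYangian hna ħ ε)
    (hy : y ∈ tildeGrading hna ħ ε d) :
    tildeEv hn hna hκ x y ∈ homogeneousPart (levelGrading a κ) d := by
  have hprod : ∀ l : List (Gen n a), tildeEv hn hna hκ x (l.map (tildeGen hna ħ ε)).prod ∈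
      homogeneousPart (levelGrading a κ) (l.map Gen.deg).sum := by
    intro l
    induction l with
    | nil =>
      change tildeEv hn hna hκ x 1 ∈ homogeneousPart _ 0
      rw [map_one]
      exact one_mem_homogeneousPart
    | cons g l ih =>
      rw [List.map_cons, List.map_cons, List.prod_cons, List.sum_cons, map_mul, tildeEv_tildeGen]
      exact mul_mem_homogeneousPart (evGen_mem_homogeneousPart _ hna κ x hħ g) ih
  refine Submodule.span_induction (p := fun y _ => tildeEv hn hna hκ x y ∈
    homogeneousPart (levelGrading a κ) d) ?_ ?_ ?_ ?_ hy
  · rintro _ ⟨l, rfl, rfl⟩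
    exact hprod l
  · rw [map_zero]
    exact zero_mem _
  · intro y z _ _ hy hz
    rw [map_add]
    exact add_mem hy hz
  · intro r y _ hy
    rw [map_smul]
    exact Submodule.smul_mem _ r hy

variable (hħ : ħ ≠ 0)

/-- The evaluation map on the completion: the continuous extension of `tildeEv`. -/
def hatEv : HatYangian hna ħ ε →ₐ[ℂ] CompletedU a κ :=
  extend (tildeEv hn hna hκ x) (tildeEv_mem_homogeneousPart hn hna hκ x hħ)

theorem hatEv_hatGen (g : Gen n a) :
    hatEv hn hna hκ x hħ (hatGen hna ħ ε g) = evGen (by omega) hna ħ κ x g :=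
  (extend_toCompletion _ _ _).trans (tildeEv_tildeGen hn hna hκ x g)

theorem hatEv_E (i j : Fin a) (s : ℤ) :
    hatEv hn hna hκ x hħ ((tildeCurrents hna ħ ε).E i j s) = (levelCurrents a κ).E i j s :=
  hatEv_hatGen hn hna hκ x hħ (.e i j s)

theorem hatEv_evH (i : Fin n) :
    hatEv hn hna hκ x hħ ((tildeCurrents hna ħ ε).evH hna ħ i) = (levelCurrents a κ).evH hna ħ i := by
  refine Currents.map_evH hna ħ (hatEv_E hn hna hκ x hħ) ?_ (fun i k j α β => ?_) i
  · exact (hatEv_hatGen hn hna hκ x hħ .c).trans (levelCurrents_C κ).symm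
  · refine (hasSum_extend _ _ ((tildeCurrents hna ħ ε).hasSum_quad i k j α β)).unique
      (hasSum_of_eq ((levelCurrents a κ).hasSum_quad i k j α β) fun s => ?_)
    rw [map_mul]
    exact (congrArg₂ (· * ·) (hatEv_E hn hna hκ x hħ _ _ _) (hatEv_E hn hna hκ x hħ _ _ _)).symm

theorem E_diag_lie (l i j : Fin a) (w : ℤ) :
    ⁅(levelCurrents a κ).E l l 0, (levelCurrents a κ).E i j w⁆ =
      (if i = l then (levelCurrents a κ).E i j w else 0)
        - (if j = l then (levelCurrents a κ).E i j w else 0) := by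
  rw [levelCurrents_E_lie, Int.cast_zero, zero_mul, map_zero, ite_self, ite_self, add_zero, add_zero,
    zero_add]
  congr 1
  · exact if_ctx_congr Iff.rfl (fun h => by rw [h]) fun _ => rfl
  · exact if_ctx_congr eq_comm (fun h => by rw [h]) fun _ => rfl

theorem h_lie_E (i : Fin n) (p q : Fin a) (w : ℤ) :
    ⁅(levelCurrents a κ).h hna i, (levelCurrents a κ).E p q w⁆ =
      (if p = lft hna i then (levelCurrents a κ).E p q w else 0)
        - (if q = lft hna i then (levelCurrents a κ).E p q w else 0)
        - ((if p = rgt hna i then (levelCurrents a κ).E p q w else 0)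
        - (if q = rgt hna i then (levelCurrents a κ).E p q w else 0)) := by
  have hc : ⁅if i.val = 0 then (levelCurrents a κ).C else 0, (levelCurrents a κ).E p q w⁆ = 0 := by
    split_ifs
    · rw [levelCurrents_C]
      exact algebraMap_lie_eq_zero κ _
    · exact zero_lie _
  rw [Currents.h, chevalleyH, add_lie, sub_lie, hc, add_zero, E_diag_lie, E_diag_lie]

theorem lft_ne_rgt (hn : 2 ≤ n) (i : Fin n) : lft hna i ≠ rgt hna i := by
  intro h
  have := congrArg Fin.val h
  change (if i.val = 0 then n - 1 else i.val - 1) = i.val at this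
  split_ifs at this <;> omega

theorem ne_lft {v : Fin a} (hv : n ≤ v.val) (i : Fin n) : v ≠ lft hna i := by
  rintro rfl
  change n ≤ (if i.val = 0 then n - 1 else i.val - 1) at hv
  have := i.isLt
  split_ifs at hv <;> omega

theorem ne_rgt {v : Fin a} (hv : n ≤ v.val) (i : Fin n) : v ≠ rgt hna i := by
  rintro rfl
  have := i.isLt
  exact absurd hv (not_le.mpr this)

/-- The further relations hold because the evaluation map sends `H_{i,1}` to its evaluation element plus
`x h_i`, and `h_i` commutes with the currents whose position in `1, …, n` does not belong to `i`, as
`h_{i'} + h_i` does with those at the common position. -/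
theorem hatEv_rel {u v : HatYangian hna ħ ε} (h : ExtRel hna ħ ε u v) :
    hatEv hn hna hκ x hħ u = hatEv hn hna hκ x hħ v := by
  have hl : ∀ y z, hatEv hn hna hκ x hħ ⁅y, z⁆ =
      ⁅hatEv hn hna hκ x hħ y, hatEv hn hna hκ x hħ z⁆ := fun y z => by
    rw [Ring.lie_def, map_sub, map_mul, map_mul, Ring.lie_def]
  have key : ∀ (i : Fin n) (p q : Fin a) (w : ℤ),
      hatEv hn hna hκ x hħ ⁅hatGen hna ħ ε (.H i 1), hatGen hna ħ ε (.e p q w)⁆ =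
        hatEv hn hna hκ x hħ ⁅(tildeCurrents hna ħ ε).evH hna ħ i, hatGen hna ħ ε (.e p q w)⁆
        + x • ⁅(levelCurrents a κ).h hna i, (levelCurrents a κ).E p q w⁆ := by
    intro i p q w
    rw [hl, hl, hatEv_evH, hatEv_hatGen, evGen_H_one _ hna κ x hħ, hatEv_hatGen, add_lie, smul_lie]
    rfl
  cases h with
  | lower i v hv j hl hr w =>
    rw [key, h_lie_E, if_neg (ne_lft hna hv i), if_neg (ne_rgt hna hv i), if_neg hl, if_neg hr]
    simp
  | upper i v hv j hl hr w =>
    rw [key, h_lie_E, if_neg (ne_lft hna hv i), if_neg (ne_rgt hna hv i), if_neg hl, if_neg hr]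
    simp
  | lower_sum i' i hi v hv w =>
    rw [map_add, map_add, key, key, h_lie_E, h_lie_E, ← hi]
    rw [if_neg (ne_lft hna hv i'), if_neg (ne_rgt hna hv i'), if_neg (ne_rgt hna hv i),
      if_neg (lft_ne_rgt hna (by omega) i').symm, hi, if_pos rfl, if_neg (lft_ne_rgt hna (by omega) i)]
    simp only [zero_sub, sub_zero, sub_neg_eq_add, zero_add, smul_neg]
    abel
  | upper_sum i' i hi v hv w =>
    rw [map_add, map_add, key, key, h_lie_E, h_lie_E, ← hi]
    rw [if_neg (ne_lft hna hv i'), if_neg (ne_rgt hna hv i'), if_neg (ne_rgt hna hv i),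
      if_neg (lft_ne_rgt hna (by omega) i').symm, hi, if_pos rfl, if_neg (lft_ne_rgt hna (by omega) i)]
    simp only [zero_sub, sub_zero, smul_neg]
    abel

/-- The evaluation map on the extended Yangian: the quotient of `hatEv`. -/
def extEv : ExtYangian hna ħ ε →ₐ[ℂ] CompletedU a κ :=
  RingQuot.liftAlgHom ℂ ⟨hatEv hn hna hκ x hħ, fun _ _ h => hatEv_rel hn hna hκ x hħ h⟩

theorem extEv_extMk (y : HatYangian hna ħ ε) :
    extEv hn hna hκ x hħ (extMk hna ħ ε y) = hatEv hn hna hκ x hħ y :=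
  RingQuot.liftAlgHom_mkAlgHom_apply ..

theorem extEv_extGen (g : Gen n a) :
    extEv hn hna hκ x hħ (extGen hna ħ ε g) = evGen (by omega) hna ħ κ x g :=
  (extEv_extMk ..).trans (hatEv_hatGen ..)

end Homomorphism

/-! ### Uniqueness -/

section Uniqueness

variable {n a : ℕ} (hna : n ≤ a) (ħ ε : ℂ)

theorem tildeGen_H_zero (i : Fin n) : tildeGen hna ħ ε (.H i 0) =
    chevalleyH hna (fun p q s => tildeGen hna ħ ε (.e p q s)) (tildeGen hna ħ ε .c) i := by
  refine (RingQuot.mkAlgHom_rel ℂ (TildeRel.H_zero (hna := hna) i)).trans ?_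
  rw [chevalleyH, map_add, map_sub, apply_ite (RingQuot.mkAlgHom ℂ (TildeRel hna ħ ε)), map_zero]
  rfl

theorem tildeGen_X_zero (σ : ℤˣ) (i : Fin n) : tildeGen hna ħ ε (.X σ i 0) =
    chevalleyX hna (fun p q s => tildeGen hna ħ ε (.e p q s)) σ i := by
  refine (RingQuot.mkAlgHom_rel ℂ (TildeRel.X_zero (hna := hna) σ i)).trans ?_
  rw [chevalleyX, apply_ite (RingQuot.mkAlgHom ℂ (TildeRel hna ħ ε))]
  rfl

theorem hatGen_H_zero (i : Fin n) :
    hatGen hna ħ ε (.H i 0) = (tildeCurrents hna ħ ε).h hna i := by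
  have hE := fun p => (tildeCurrents hna ħ ε).e_mem p p 0
  have hC := (tildeCurrents hna ħ ε).c_mem
  have h1 : (if i.val = 0 then (tildeCurrents hna ħ ε).c else 0) ∈ tildeGrading hna ħ ε 0 := by
    split_ifs
    exacts [hC, zero_mem _]
  have h2 : toCompletion 0 _ h1 = if i.val = 0 then (tildeCurrents hna ħ ε).C else 0 := by
    by_cases hi : i.val = 0
    · exact (toCompletion_congr rfl (if_pos hi) h1 hC).trans (if_pos hi).symm
    · exact ((toCompletion_congr rfl (if_neg hi) h1 (zero_mem _)).trans toCompletion_zero).trans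
        (if_neg hi).symm
  refine (toCompletion_congr rfl (tildeGen_H_zero hna ħ ε i) _
    (add_mem (sub_mem (hE (lft hna i)) (hE (rgt hna i))) h1)).trans ?_
  refine (toCompletion_add (sub_mem (hE _) (hE _)) h1).trans ?_
  rw [toCompletion_sub (hE _) (hE _), h2]
  rfl

theorem hatGen_X_zero (σ : ℤˣ) (i : Fin n) :
    hatGen hna ħ ε (.X σ i 0) = (tildeCurrents hna ħ ε).x hna σ i := by
  rcases Int.units_eq_one_or σ with rfl | rfl
  · exact toCompletion_congr (one_mul _) (tildeGen_X_zero hna ħ ε 1 i) _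
      ((tildeCurrents hna ħ ε).e_mem (lft hna i) (rgt hna i) (delta0 i))
  · exact toCompletion_congr (neg_one_mul _) (tildeGen_X_zero hna ħ ε (-1) i) _
      ((tildeCurrents hna ħ ε).e_mem (rgt hna i) (lft hna i) (-delta0 i))

variable {hna ħ ε}

/-- A graded continuous homomorphism on the completion is determined by its values at the generators
other than `H_{i,0}` and `X_{i,0}^±`, which are combinations of the others. -/
theorem hatYangian_algHom_ext {B : Type*} [Ring B] [Algebra ℂ B] {ℬ : ℤ → Submodule ℂ B}
    [SetLike.GradedMonoid ℬ] {φ ψ : HatYangian hna ħ ε →ₐ[ℂ] Completion ℬ}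
    (hφ : IsGradedContinuous (φ : HatYangian hna ħ ε → Completion ℬ))
    (hψ : IsGradedContinuous (ψ : HatYangian hna ħ ε → Completion ℬ))
    (he : ∀ i j s, φ (hatGen hna ħ ε (.e i j s)) = ψ (hatGen hna ħ ε (.e i j s)))
    (hc : φ (hatGen hna ħ ε .c) = ψ (hatGen hna ħ ε .c))
    (hH : ∀ i, φ (hatGen hna ħ ε (.H i 1)) = ψ (hatGen hna ħ ε (.H i 1)))
    (hX : ∀ σ i, φ (hatGen hna ħ ε (.X σ i 1)) = ψ (hatGen hna ħ ε (.X σ i 1))) : φ = ψ := by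
  have hgen : ∀ g, φ (hatGen hna ħ ε g) = ψ (hatGen hna ħ ε g) := by
    have hE : ∀ i j s, φ ((tildeCurrents hna ħ ε).E i j s) = ψ ((tildeCurrents hna ħ ε).E i j s) := he
    have hC : φ (tildeCurrents hna ħ ε).C = ψ (tildeCurrents hna ħ ε).C := hc
    intro g
    cases g with
    | H i r =>
      match r with
      | 0 =>
        rw [hatGen_H_zero, Currents.h, chevalleyH, map_add, map_sub, map_add, map_sub, hE, hE,
          apply_ite φ, apply_ite ψ, hC, map_zero, map_zero]
      | 1 => exact hH i
    | X σ i r =>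
      match r with
      | 0 => rw [hatGen_X_zero, Currents.x, chevalleyX, apply_ite φ, apply_ite ψ, hE, hE]
      | 1 => exact hX σ i
    | e i j s => exact he i j s
    | c => exact hc
  have hprod : ∀ l : List (Gen n a), ∃ h : (l.map (tildeGen hna ħ ε)).prod ∈
      tildeGrading hna ħ ε (l.map Gen.deg).sum,
      φ (toCompletion _ _ h) = ψ (toCompletion _ _ h) := by
    intro l
    induction l with
    | nil => exact ⟨SetLike.GradedOne.one_mem, (map_one φ).trans (map_one ψ).symm⟩
    | cons g l ih =>
      obtain ⟨h, hl⟩ := ih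
      refine ⟨SetLike.mul_mem_graded (mem_degreePart (tildeGen hna ħ ε) Gen.deg g) h, ?_⟩
      have hm : ∀ χ : HatYangian hna ħ ε →ₐ[ℂ] Completion ℬ, χ (toCompletion _ _
          (SetLike.mul_mem_graded (mem_degreePart (tildeGen hna ħ ε) Gen.deg g) h)) =
          χ (hatGen hna ħ ε g) * χ (toCompletion _ _ h) := fun χ => by
        rw [← toCompletion_mul, map_mul]
        rfl
      exact (hm φ).trans ((congrArg₂ (· * ·) (hgen g) hl).trans (hm ψ).symm)
  refine hφ.algHom_ext hψ fun d y hy => ?_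
  refine Submodule.span_induction (p := fun y hy => φ (toCompletion d y hy) =
    ψ (toCompletion d y hy)) ?_ ?_ ?_ ?_ hy
  · rintro _ ⟨l, rfl, rfl⟩
    exact (hprod l).2
  · rw [toCompletion_zero, map_zero, map_zero]
  · intro y z hy hz h1 h2
    rw [toCompletion_add hy hz, map_add, map_add, h1, h2]
  · intro r y hy h
    rw [toCompletion_smul r hy, map_smul, map_smul, h]

end Uniqueness

end ExtendedYangian
end

open ExtendedYangian in
theorem mainTheorem3 (n a : ℕ) (hn : 3 ≤ n) (hna : n ≤ a) (ħ ε : ℂ) (hħ : ħ ≠ 0) (x : ℂ) :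
    ∃! φ : ExtYangian hna ħ ε →ₐ[ℂ] CompletedU a (-(n * ħ + ε) / ħ),
      IsGradedContinuous (fun y => φ (extMk hna ħ ε y)) ∧
      (∀ (i j : Fin a) (s : ℤ), φ (extGen hna ħ ε (.e i j s)) = (levelCurrents a _).E i j s) ∧
      φ (extGen hna ħ ε .c) = algebraMap ℂ _ (-(n * ħ + ε) / ħ) ∧
      (∀ i : Fin n, φ (extGen hna ħ ε (.H i 1)) =
        (levelCurrents a _).evH hna ħ i + x • (levelCurrents a _).h hna i) ∧
      (∀ i : Fin n, φ (extGen hna ħ ε (.X 1 i 1)) =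
        (levelCurrents a _).evXPlus hna ħ i + x • (levelCurrents a _).x hna 1 i) ∧
      (∀ i : Fin n, φ (extGen hna ħ ε (.X (-1) i 1)) =
        (levelCurrents a _).evXMinus hna ħ i + x • (levelCurrents a _).x hna (-1) i) := by
  have hκ : ħ * (-(n * ħ + ε) / ħ) = -(n * ħ + ε) := mul_div_cancel₀ _ hħ
  refine ⟨extEv hn hna hκ x hħ, ⟨?_, fun i j s => extEv_extGen hn hna hκ x hħ (.e i j s),
    extEv_extGen hn hna hκ x hħ .c, fun i => ?_, fun i => ?_, fun i => ?_⟩, ?_⟩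
  · simp only [extEv_extMk]
    exact isGradedContinuous_extend _ _
  · exact (extEv_extGen hn hna hκ x hħ _).trans (evGen_H_one _ hna _ x hħ i)
  · exact (extEv_extGen hn hna hκ x hħ _).trans (evGen_X_one _ hna _ x hħ i)
  · exact (extEv_extGen hn hna hκ x hħ _).trans (evGen_X_neg_one _ hna _ x hħ i)
  · rintro φ ⟨hcont, he, hc, hH, hX, hX'⟩
    have hv := extEv_extGen (n := n) (a := a) hn hna hκ x hħ
    have hcont' : IsGradedContinuous fun y => extEv hn hna hκ x hħ (extMk hna ħ ε y) := by
      simp only [extEv_extMk]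
      exact isGradedContinuous_extend _ _
    refine RingQuot.ringQuot_ext' ℂ _ _ (hatYangian_algHom_ext
      (φ := φ.comp (extMk hna ħ ε)) (ψ := (extEv hn hna hκ x hħ).comp (extMk hna ħ ε)) hcont hcont'
      (fun i j s => (he i j s).trans (hv (.e i j s)).symm) (hc.trans (hv .c).symm)
      (fun i => (hH i).trans ?_) fun σ i => ?_)
    · exact ((hv _).trans (evGen_H_one _ hna _ x hħ i)).symm
    · rcases Int.units_eq_one_or σ with rfl | rfl
      · exact (hX i).trans ((hv _).trans (evGen_X_one _ hna _ x hħ i)).symm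
      · exact (hX' i).trans ((hv _).trans (evGen_X_neg_one _ hna _ x hħ i)).symm
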